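/- **Average consistency of the two-step expected shortfall (ES) panel estimator.** *Model.* Let $\tau\in(0,1)$ and let $d,r\ge 0$ be fixed integers. For $i,t\in\mathbb N$ let $Y_{it}\in\mathbb R$, $X_{it}\in\mathbb R^d$ and $f_t^0\in\mathbb R^r$ be random variables on one probability space, and let $\alpha_i^0,\beta_i^0\in\mathbb R^d$, $\lambda_i^0\in\mathbb R^r$ be non-random. Put $$Z^*_{it}(a)=\tfrac1\tau\big\{(Y_{it}-X_{it}^\top a)\mathbf 1(Y_{it}\le X_{it}^\top a)+\tau X_{it}^\top a\big\},\quad \epsilon_{it}=Y_{it}-X_{it}^\top\alpha_i^0,\quad \varepsilon_{it}=Z^*_{it}(\alpha_i^0)-X_{it}^\top\beta_i^0-\lambda_i^{0\top}f_t^0 .$$ For given $N,T$ let $X_i$ be the $T\times d$ matrix with rows $X_{it}^\top$, $F^0$ the $T\times r$ matrix with rows $f_t^{0\top}$, $Z_i^*(a)=(Z^*_{i1}(a),\dots,Z^*_{iT}(a))^\top$, $\varepsilon_i=(\varepsilon_{i1},\dots,\varepsilon_{iT})^\top$, and $M_F=I_T-F(F^\top F)^{-1}F^\top$. A $T\times r$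 matrix $F$ is called normalized if $F^\top F/T=I_r$. Let $\mathcal X$ be the $\sigma$-algebra generated by all $X_{it}$ and all $f_t^0$. The norm $\|\cdot\|$ is the Euclidean norm for vectors and the Frobenius norm for matrices. *Limits.* All statements "with probability tending to one" (w.p.t.o.) in (A2), (A3) and in the definition of the second step, and all $o_p(1)$ in the conclusion, refer to one fixed limiting regime $N,T\to\infty$: either the joint limit or a given path along which both $N$ and $T$ tend to infinity (formally, a filter on $\mathbb N^2$ finer than the product of the two filters at infinity). *Assumptions.* (A1) $P(Y_{it}\le X_{it}^\top\alpha_i^0\mid X_{it})=\tau$ and $E[\varepsilon_{it}\mid\mathcal X]=0$ a.s. for all $i,t$. (A2) $\sup_{i,t}E\|X_{it}\|^4<\infty$ and $\sup_{i,t}E\,\epsilon_{it}^4<\infty$; for some $C$, w.p.t.o. $\max_{i\le N}T^{-1}\sum_{t\le T}\|X_{it}\|^4\le C$; and there are $\kappa,s_0>0$ such that for all $i,t$, a.s., $P(a<\epsilon_{it}\le b\mid X_{it})\ge\kappa(b-a)$ for all $-s_0\le a\le b\le s_0$. (A3) Let $A_i(F)=T^{-1}X_i^\top M_FX_i$, $B_i=(\lambda_i^0\lambda_i^{0\top})\otimes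 I_T$, $C_i(F)=T^{-1/2}\lambda_i^0\otimes(M_FX_i)$ and $E_i(F)=B_i-C_i(F)A_i(F)^{-1}C_i(F)^\top$. There is $c>0$ such that w.p.t.o.: (1) $\lambda_{\min}(A_i(F^0))\ge c$ for all $i\le N$; (2) $\lambda_{\min}\big(N^{-1}\sum_{i\le N}E_i(F)\big)\ge c$ for every normalized $F$ for which $A_1(F),\dots,A_N(F)$ are invertible. (A4) $F^{0\top}F^0/T\to\Sigma_F$ in probability as $T\to\infty$, and $N^{-1}\sum_{i\le N}\lambda_i^0\lambda_i^{0\top}\to\Sigma_\Lambda$ as $N\to\infty$, with $\Sigma_F,\Sigma_\Lambda$ positive definite; $\sup_i\|\lambda_i^0\|<\infty$. (A5) There is $M<\infty$ such that for all $N,T,i,t$: $E\,\varepsilon_{it}^4\le M$; for every $v\in\mathbb R^T$, $E[(v^\top\varepsilon_i)^2\mid\mathcal X]\le M\|v\|^2$ a.s. (the largest eigenvalue of $E[\varepsilon_i\varepsilon_i^\top\mid\mathcal X]$ is at most $M$); and $$\frac1{T^2N}\sum_{t,s,u,v\le T}\ \sum_{k,\ell\le N}\big|\operatorname{Cov}(\varepsilon_{kt}\varepsilon_{ks},\varepsilon_{\ell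 u}\varepsilon_{\ell v})\big|\le M .$$ (A6) For each $i$ the process $(X_{it},Y_{it})_t$ is $\alpha$-mixing, with mixing coefficients bounded, uniformly in $i$, by a summable sequence. *Estimator.* First step: $\widehat\alpha_i$ (depending on $T$) is any minimizer over $a\in\mathbb R^d$ of $T^{-1}\sum_{t\le T}\rho_\tau(Y_{it}-X_{it}^\top a)$, where $\rho_\tau(u)=u(\tau-\mathbf 1(u<0))$. Second step: $(\widehat\beta_1,\dots,\widehat\beta_N,\widehat F)$ is such that, w.p.t.o., it minimizes $$\frac1{NT}\sum_{i=1}^N\{Z_i^*(\widehat\alpha_i)-X_i\beta_i\}^\top M_F\{Z_i^*(\widehat\alpha_i)-X_i\beta_i\}$$ over all $\beta_1,\dots,\beta_N\in\mathbb R^d$ and all normalized $F$. Put $\widehat\lambda_i=T^{-1}\widehat F^\top\{Z_i^*(\widehat\alpha_i)-X_i\widehat\beta_i\}$, and let $G=(F^{0\top}F^0)^{-1}F^{0\top}\widehat F$ be the $r\times r$ rotation. Let $\widehat\gamma_i=(\widehat\beta_i^\top,\widehat\lambda_i^\top)^\top$ and, in the rotated coordinates, $\gamma_i^0=(\beta_i^{0\top},(G^{-1}\lambda_i^0)^\top)^\top$.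 *Conclusion.* In the given regime, $G$ is invertible with probability tending to one, and $$T^{-1/2}\|\widehat F-F^0G\|=o_p(1),\qquad \frac1N\sum_{i=1}^N\|\widehat\beta_i-\beta_i^0\|^2=o_p(1),\qquad \frac1N\sum_{i=1}^N\|\widehat\gamma_i-\gamma_i^0\|^2=o_p(1).$$ -/

import Mathlib

open MeasureTheory ProbabilityTheory Filter Topology
open scoped Matrix Kronecker

noncomputable section

namespace ESPanel

/-- Squared Euclidean norm of a finite real vector. -/
def sqNorm {ι : Type*} [Fintype ι] (v : ι → ℝ) : ℝ := ∑ j, v j ^ 2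

/-- Frobenius norm of a real matrix. -/
def frobNorm {ι κ : Type*} [Fintype ι] [Fintype κ] (A : Matrix ι κ ℝ) : ℝ :=
  Real.sqrt (∑ i, ∑ j, A i j ^ 2)

/-- The annihilator `M_F = I - F (FᵀF)⁻¹ Fᵀ` of the column space of `F`.
It equals `I - F Fᵀ / T` when `FᵀF / T = I`. -/
def annihilator {T r : ℕ} (F : Matrix (Fin T) (Fin r) ℝ) : Matrix (Fin T) (Fin T) ℝ :=
  1 - F * (Fᵀ * F)⁻¹ * Fᵀ

/-- The normalization `FᵀF / T = I_r`, written as `FᵀF = T • I_r`. -/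
def IsNormalized {T r : ℕ} (F : Matrix (Fin T) (Fin r) ℝ) : Prop :=
  Fᵀ * F = (T : ℝ) • (1 : Matrix (Fin r) (Fin r) ℝ)

/-- The data of the panel: responses, regressors, latent factors, and the true parameters.
No law is imposed here. -/
structure Panel (Ω : Type*) (d r : ℕ) where
  /-- the tail level `τ` -/
  τ : ℝ
  /-- the response `Y_{it}` -/
  Y : ℕ → ℕ → Ω → ℝ
  /-- the regressor `X_{it}` -/
  X : ℕ → ℕ → Ω → (Fin d → ℝ)
  /-- the latent factor `f_t⁰` -/
  f : ℕ → Ω → (Fin r → ℝ)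
  /-- the loading `λ_i⁰` -/
  lam : ℕ → (Fin r → ℝ)
  /-- the quantile coefficient `α_i⁰` -/
  α : ℕ → (Fin d → ℝ)
  /-- the expected shortfall coefficient `β_i⁰` -/
  β : ℕ → (Fin d → ℝ)

namespace Panel

variable {Ω : Type*} {d r : ℕ} (P : Panel Ω d r)

/-- The `T × d` regressor matrix `X_i`. -/
def Xmat (T i : ℕ) (ω : Ω) : Matrix (Fin T) (Fin d) ℝ := Matrix.of fun t => P.X i t ω

/-- The `T × r` matrix `F⁰` of true factors. -/
def Fmat (T : ℕ) (ω : Ω) : Matrix (Fin T) (Fin r) ℝ := Matrix.of fun t => P.f t ω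

/-- Quantile regression error `ϵ_{it} = Y_{it} - X_{it}ᵀ α_i⁰`. -/
def qErr (i t : ℕ) (ω : Ω) : ℝ := P.Y i t ω - P.X i t ω ⬝ᵥ P.α i

open Classical in
/-- `Z*_{it}(a) = τ⁻¹ {(Y_{it} - X_{it}ᵀ a) 1(Y_{it} ≤ X_{it}ᵀ a) + τ X_{it}ᵀ a}`. -/
def Zstar (i t : ℕ) (a : Fin d → ℝ) (ω : Ω) : ℝ :=
  P.τ⁻¹ * ((P.Y i t ω - P.X i t ω ⬝ᵥ a) * (if P.Y i t ω ≤ P.X i t ω ⬝ᵥ a then 1 else 0)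
    + P.τ * (P.X i t ω ⬝ᵥ a))

/-- The vector `Z*_i(a) = (Z*_{i1}(a), …, Z*_{iT}(a))`. -/
def ZstarVec (T i : ℕ) (a : Fin d → ℝ) (ω : Ω) : Fin T → ℝ := fun t => P.Zstar i t a ω

/-- Expected shortfall error `ε_{it} = Z*_{it}(α_i⁰) - X_{it}ᵀ β_i⁰ - λ_i⁰ᵀ f_t⁰`. -/
def esErr (i t : ℕ) (ω : Ω) : ℝ :=
  P.Zstar i t (P.α i) ω - P.X i t ω ⬝ᵥ P.β i - P.lam i ⬝ᵥ P.f t ω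

/-- The σ-algebra generated by all regressors and all factors. -/
@[reducible] def sigmaXF : MeasurableSpace Ω :=
  (⨆ i : ℕ, ⨆ t : ℕ, MeasurableSpace.comap (P.X i t) inferInstance) ⊔
    ⨆ t : ℕ, MeasurableSpace.comap (P.f t) inferInstance

/-! ### The two-step estimator -/

open Classical in
/-- The check loss `ρ_τ(u) = u (τ - 1(u < 0))`. -/
def checkLoss (τ u : ℝ) : ℝ := u * (τ - if u < 0 then 1 else 0)

/-- First step: the empirical quantile loss of unit `i` over `T` periods. -/
def quantLoss (T i : ℕ) (ω : Ω) (a : Fin d → ℝ) : ℝ :=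
  (T : ℝ)⁻¹ * ∑ t : Fin T, checkLoss P.τ (P.Y i t ω - P.X i t ω ⬝ᵥ a)

/-- First step: `αhat T i ω` is a (linear) quantile regression estimate for every `T`, `i`. -/
def IsQuantileEstimator (αhat : ℕ → ℕ → Ω → (Fin d → ℝ)) : Prop :=
  ∀ T i ω, IsMinOn (P.quantLoss T i ω) Set.univ (αhat T i ω)

/-- Second step: the least squares objective with the loadings concentrated out,
`(NT)⁻¹ ∑_i (Z*_i(a_i) - X_i b_i)ᵀ M_F (Z*_i(a_i) - X_i b_i)`. -/
def lsObj (N T : ℕ) (a : ℕ → (Fin d → ℝ)) (ω : Ω) (b : Fin N → (Fin d → ℝ))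
    (F : Matrix (Fin T) (Fin r) ℝ) : ℝ :=
  ((N : ℝ) * T)⁻¹ * ∑ i : Fin N,
    (P.ZstarVec T i (a i) ω - P.Xmat T i ω *ᵥ b i) ⬝ᵥ
      (annihilator F *ᵥ (P.ZstarVec T i (a i) ω - P.Xmat T i ω *ᵥ b i))

/-- `(b, F)` minimizes the second-step objective over all slopes in `(ℝ^d)^N` and all
normalized factor matrices. -/
def IsLSMinimizer (N T : ℕ) (a : ℕ → (Fin d → ℝ)) (ω : Ω) (b : Fin N → (Fin d → ℝ))
    (F : Matrix (Fin T) (Fin r) ℝ) : Prop :=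
  IsNormalized F ∧ ∀ (b' : Fin N → (Fin d → ℝ)) (F' : Matrix (Fin T) (Fin r) ℝ),
    IsNormalized F' → P.lsObj N T a ω b F ≤ P.lsObj N T a ω b' F'

/-- The loading estimate `λhat_i = T⁻¹ Fᵀ (Z*_i(a) - X_i b)`. -/
def lamEst (T i : ℕ) (a : Fin d → ℝ) (ω : Ω) (b : Fin d → ℝ) (F : Matrix (Fin T) (Fin r) ℝ) :
    Fin r → ℝ :=
  (T : ℝ)⁻¹ • (Fᵀ *ᵥ (P.ZstarVec T i a ω - P.Xmat T i ω *ᵥ b))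

/-- The rotation `G = (F⁰ᵀF⁰)⁻¹ F⁰ᵀ F`. -/
def rot (T : ℕ) (ω : Ω) (F : Matrix (Fin T) (Fin r) ℝ) : Matrix (Fin r) (Fin r) ℝ :=
  ((P.Fmat T ω)ᵀ * P.Fmat T ω)⁻¹ * (P.Fmat T ω)ᵀ * F

/-! ### The matrices of the rank condition -/

/-- `A_i(F) = T⁻¹ X_iᵀ M_F X_i`. -/
def Amat (T i : ℕ) (ω : Ω) (F : Matrix (Fin T) (Fin r) ℝ) : Matrix (Fin d) (Fin d) ℝ :=
  (T : ℝ)⁻¹ • ((P.Xmat T i ω)ᵀ * annihilator F * P.Xmat T i ω)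

/-- `B_i = (λ_i⁰ λ_i⁰ᵀ) ⊗ I_T`. -/
def Bmat (T i : ℕ) : Matrix (Fin r × Fin T) (Fin r × Fin T) ℝ :=
  Matrix.vecMulVec (P.lam i) (P.lam i) ⊗ₖ (1 : Matrix (Fin T) (Fin T) ℝ)

/-- `C_i(F) = T^{-1/2} λ_i⁰ ⊗ (M_F X_i)`. -/
def Cmat (T i : ℕ) (ω : Ω) (F : Matrix (Fin T) (Fin r) ℝ) : Matrix (Fin r × Fin T) (Fin d) ℝ :=
  Matrix.of fun kt a => (Real.sqrt T)⁻¹ * (P.lam i kt.1 * (annihilator F * P.Xmat T i ω) kt.2 a)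

/-- `E_i(F) = B_i - C_i A_i⁻¹ C_iᵀ`. -/
def Emat (T i : ℕ) (ω : Ω) (F : Matrix (Fin T) (Fin r) ℝ) :
    Matrix (Fin r × Fin T) (Fin r × Fin T) ℝ :=
  P.Bmat T i - P.Cmat T i ω F * (P.Amat T i ω F)⁻¹ * (P.Cmat T i ω F)ᵀ

end Panel

/-! ### Probabilistic vocabulary -/

/-- The (possibly non-measurable) events `S n` have outer probability tending to one,
in the sense that their complements have outer probability tending to zero. -/
def WithProbTendingToOne {Ω ι : Type*} [MeasurableSpace Ω] (μ : Measure Ω) (l : Filter ι)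
    (S : ι → Ω → Prop) : Prop :=
  Tendsto (fun n => μ {ω | ¬ S n ω}) l (𝓝 0)

/-- `E[g] ≤ M`, with `g` integrable. -/
def MeanLE {Ω : Type*} [MeasurableSpace Ω] (μ : Measure Ω) (g : Ω → ℝ) (M : ℝ) : Prop :=
  Integrable g μ ∧ ∫ ω, g ω ∂μ ≤ M

/-- The process `Z` is α-mixing (strongly mixing) with coefficients bounded by `a`. -/
def IsAlphaMixing {Ω S : Type*} [MeasurableSpace Ω] [MeasurableSpace S] (μ : Measure Ω)
    (Z : ℕ → Ω → S) (a : ℕ → ℝ) : Prop :=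
  ∀ (t h : ℕ) (A B : Set Ω),
    MeasurableSet[⨆ s ∈ Set.Iic t, MeasurableSpace.comap (Z s) inferInstance] A →
    MeasurableSet[⨆ s ∈ Set.Ici (t + h), MeasurableSpace.comap (Z s) inferInstance] B →
    |μ.real (A ∩ B) - μ.real A * μ.real B| ≤ a h

/-! ### Assumptions -/

section Assumptions

variable {Ω : Type*} [MeasurableSpace Ω] {d r : ℕ}

/-- The model: measurability, the conditional quantile restriction
`P(Y_{it} ≤ X_{it}ᵀα_i⁰ | X_{it}) = τ`, and the expected shortfall equation
`E[Z*_{it}(α_i⁰) | X, F⁰] = X_{it}ᵀβ_i⁰ + λ_i⁰ᵀf_t⁰`, that is `E[ε_{it} | X, F⁰] = 0`. -/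
structure ModelAssumption (P : Panel Ω d r) (μ : Measure Ω) [IsProbabilityMeasure μ] : Prop where
  tau_pos : 0 < P.τ
  tau_lt_one : P.τ < 1
  measurable_Y : ∀ i t, Measurable (P.Y i t)
  measurable_X : ∀ i t, Measurable (P.X i t)
  measurable_f : ∀ t, Measurable (P.f t)
  quantile : ∀ i t, ∀ᵐ x ∂(μ.map (P.X i t)),
    condDistrib (P.qErr i t) (P.X i t) μ x (Set.Iic 0) = ENNReal.ofReal P.τ
  shortfall : ∀ i t, μ[P.esErr i t | P.sigmaXF] =ᵐ[μ] 0

/-- Regressors and quantile regression errors: uniformly bounded fourth moments, sample fourth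
moments of the regressors bounded uniformly over units, and a conditional law of `ϵ_{it}` given
`X_{it}` whose density is bounded below by `κ` on `[-s₀, s₀]`. -/
structure DesignAssumption (P : Panel Ω d r) (μ : Measure Ω) [IsProbabilityMeasure μ]
    (l : Filter (ℕ × ℕ)) : Prop where
  moments : ∃ M : ℝ, ∀ i t,
    MeanLE μ (fun ω => sqNorm (P.X i t ω) ^ 2) M ∧ MeanLE μ (fun ω => P.qErr i t ω ^ 4) M
  sample_moment : ∃ C : ℝ, WithProbTendingToOne μ l fun n ω =>
    ∀ i < n.1, (n.2 : ℝ)⁻¹ * ∑ t : Fin n.2, sqNorm (P.X i t ω) ^ 2 ≤ C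
  density : ∃ κ s₀ : ℝ, 0 < κ ∧ 0 < s₀ ∧ ∀ i t, ∀ᵐ x ∂(μ.map (P.X i t)),
    ∀ a b : ℝ, -s₀ ≤ a → a ≤ b → b ≤ s₀ →
      ENNReal.ofReal (κ * (b - a)) ≤ condDistrib (P.qErr i t) (P.X i t) μ x (Set.Ioc a b)

/-- Eigenvalue conditions: with probability tending to one, the eigenvalues of `A_i(F⁰)`, `i ≤ N`,
and those of `N⁻¹ ∑_i E_i(F)`, over all normalized `F` for which the inverses in `E_i(F)` exist,
are bounded below by a positive constant. -/
structure EigenvalueAssumption (P : Panel Ω d r) (μ : Measure Ω) (l : Filter (ℕ × ℕ)) : Prop where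
  design : ∃ c : ℝ, 0 < c ∧ WithProbTendingToOne μ l fun n ω =>
    ∀ i < n.1, ∀ v : Fin d → ℝ,
      c * sqNorm v ≤ v ⬝ᵥ (P.Amat n.2 i ω (P.Fmat n.2 ω) *ᵥ v)
  schur : ∃ c : ℝ, 0 < c ∧ WithProbTendingToOne μ l fun n ω =>
    ∀ F : Matrix (Fin n.2) (Fin r) ℝ, IsNormalized F →
      (∀ i < n.1, IsUnit (P.Amat n.2 i ω F).det) →
      ∀ v : Fin r × Fin n.2 → ℝ,
        c * sqNorm v ≤ v ⬝ᵥ (((n.1 : ℝ)⁻¹ • ∑ i ∈ Finset.range n.1, P.Emat n.2 i ω F) *ᵥ v)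

/-- Factors and loadings: `F⁰ᵀF⁰/T` converges in probability and `Λ⁰ᵀΛ⁰/N` converges, both to
positive definite limits, and the loadings are bounded. -/
structure FactorAssumption (P : Panel Ω d r) (μ : Measure Ω) : Prop where
  factors : ∃ SF : Matrix (Fin r) (Fin r) ℝ, SF.PosDef ∧ ∀ j k,
    TendstoInMeasure μ (fun (T : ℕ) ω => (T : ℝ)⁻¹ * ((P.Fmat T ω)ᵀ * P.Fmat T ω) j k) atTop
      (fun _ => SF j k)
  loadings_bdd : ∃ M : ℝ, ∀ i, sqNorm (P.lam i) ≤ M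
  loadings : ∃ SL : Matrix (Fin r) (Fin r) ℝ, SL.PosDef ∧ ∀ j k,
    Tendsto (fun N : ℕ => (N : ℝ)⁻¹ * ∑ i ∈ Finset.range N, P.lam i j * P.lam i k) atTop
      (𝓝 (SL j k))

/-- Expected shortfall errors: bounded fourth moments; the largest eigenvalue of
`E[ε_i ε_iᵀ | X, F⁰]` is bounded; and
`T⁻² N⁻¹ ∑_{t,s,u,v} ∑_{k,ℓ} |Cov(ε_{kt} ε_{ks}, ε_{ℓu} ε_{ℓv})|` is bounded. -/
structure ErrorAssumption (P : Panel Ω d r) (μ : Measure Ω) : Prop where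
  moments : ∃ M : ℝ, ∀ i t, MeanLE μ (fun ω => P.esErr i t ω ^ 4) M
  eigen : ∃ M : ℝ, ∀ (i T : ℕ) (v : Fin T → ℝ),
    μ[fun ω => (∑ t : Fin T, v t * P.esErr i t ω) ^ 2 | P.sigmaXF] ≤ᵐ[μ] fun _ => M * sqNorm v
  cov : ∃ M : ℝ, ∀ N T : ℕ,
    ∑ t : Fin T, ∑ s : Fin T, ∑ u : Fin T, ∑ v : Fin T, ∑ k : Fin N, ∑ m : Fin N,
      |covariance (fun ω => P.esErr k t ω * P.esErr k s ω)
        (fun ω => P.esErr m u ω * P.esErr m v ω) μ| ≤ M * (T : ℝ) ^ 2 * N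

/-- Weak dependence over time: for each unit, `(X_{it}, Y_{it})_t` is α-mixing, with coefficients
dominated, uniformly in the unit, by a summable sequence. -/
def WeakDependenceAssumption (P : Panel Ω d r) (μ : Measure Ω) : Prop :=
  ∃ a : ℕ → ℝ, Summable a ∧ ∀ i, IsAlphaMixing μ (fun t ω => (P.X i t ω, P.Y i t ω)) a

end Assumptions

end ESPanel

end

/-! Write `z_i = X_i (β_i⁰ - b_i) + F⁰ λ_i` for the signal left in the second-step residual of unit
`i`. Comparing the minimizer with the true slopes and a normalized basis of the column space of `F⁰`
bounds the mean square of `M_F z_i` by the Frobenius norm of `(NT)⁻¹ ∑ ε_i ε_iᵀ`, the first-step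
error, and the cross term `(NT)⁻¹ ∑ ⟨M_F z_i, ε_i⟩`. The cross term is the difficulty: the slopes
range over an unbounded set of growing dimension, slopes and `F` both depend on the errors, and no
rate links `N` and `T`.

Cross term. Scale each signal to `z_i / ‖M_F z_i‖`. The coordinates of its projection on `F` form a
vector of `ℝ^r`, so among any `m + 1` units all but at most `r` have coordinates that combine those
of the others with coefficients in `[-1, 1]`. For such a unit let `s` be the same combination of the
other scaled signals. Scaled signal and `s` have equal projections on `F`, so their difference is a
difference of residuals and has bounded norm. It lies in the span of the regressors of `m + 1` units
and the true factors, a space of bounded dimension determined by regressors and factors, on which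
the squared projection of `ε_i` has bounded mean (`exists_projection_bound`). The rest of `M_F z_i`
lies in a space spanned by `F` and the `m` other signals. That space depends on the errors but not
on `i`, so the squared projections summed over `i` are at most its dimension times the Frobenius
norm of `∑ ε_i ε_iᵀ`. Averaging over all `m`-tuples leaves a share `r / (m + 1)` of exceptional
pairs, treated by Cauchy-Schwarz and fourth moments (`cross_term_le`, `signalLoss_consistent`).

Rank condition. The minimum over `b_i` of `T⁻¹ ‖M_F z_i‖²` is the quadratic form of `E_i(F)` at
`T^{-1/2} vec(M_F F⁰)`, so a small projected signal forces `T⁻¹ ‖M_F F⁰‖²` to be small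
(`frobSq_annihilator_mul_Fmat_le`). The column spaces of `F` and `F⁰` are then close, and slopes and
loadings follow by linear algebra (`slope_loss_le`, `loading_loss_le`).

First step. Mixing bounds the probability of a large quantile regression error by `O(1/T)` for each
unit, too weak for a union over units. An average suffices: exceptional units obey a crude bound by
the second moment of their errors, which their small probability makes negligible
(`quantile_estimator_consistent`). -/

noncomputable section

namespace ESPanel

/-! ### Squared Euclidean norms -/

section SqNorm

variable {ι κ : Type*} [Fintype ι] [Fintype κ]

lemma sqNorm_eq_dotProduct (v : ι → ℝ) : sqNorm v = v ⬝ᵥ v := by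
  simp [sqNorm, dotProduct, sq]

lemma sqNorm_nonneg (v : ι → ℝ) : 0 ≤ sqNorm v := Finset.sum_nonneg fun _ _ => sq_nonneg _

@[simp] lemma sqNorm_zero : sqNorm (0 : ι → ℝ) = 0 := by simp [sqNorm]

lemma sqNorm_eq_zero {v : ι → ℝ} : sqNorm v = 0 ↔ v = 0 := by
  rw [sqNorm_eq_dotProduct, dotProduct_self_eq_zero]

lemma sqNorm_smul (c : ℝ) (v : ι → ℝ) : sqNorm (c • v) = c ^ 2 * sqNorm v := by
  simp [sqNorm, mul_pow, Finset.mul_sum]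

lemma sqNorm_neg (v : ι → ℝ) : sqNorm (-v) = sqNorm v := by simp [sqNorm]

lemma sqNorm_add_le (u v : ι → ℝ) : sqNorm (u + v) ≤ 2 * sqNorm u + 2 * sqNorm v := by
  simp only [sqNorm, Finset.mul_sum, ← Finset.sum_add_distrib, Pi.add_apply]
  exact Finset.sum_le_sum fun i _ => by nlinarith [sq_nonneg (u i - v i)]

lemma sqNorm_sub_le (u v : ι → ℝ) : sqNorm (u - v) ≤ 2 * sqNorm u + 2 * sqNorm v := by
  rw [sub_eq_add_neg, ← sqNorm_neg v]
  exact sqNorm_add_le u (-v)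

lemma sqNorm_sum_le {σ : Type*} (s : Finset σ) (v : σ → ι → ℝ) :
    sqNorm (∑ k ∈ s, v k) ≤ s.card * ∑ k ∈ s, sqNorm (v k) := by
  simp only [sqNorm, Finset.sum_apply]
  rw [Finset.sum_comm, Finset.mul_sum]
  exact Finset.sum_le_sum fun i _ => sq_sum_le_card_mul_sum_sq

lemma dotProduct_sq_le (u v : ι → ℝ) : (u ⬝ᵥ v) ^ 2 ≤ sqNorm u * sqNorm v :=
  Finset.sum_mul_sq_le_sq_mul_sq _ _ _

lemma sqNorm_elim (u : ι → ℝ) (v : κ → ℝ) :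
    sqNorm (Sum.elim u v) = sqNorm u + sqNorm v := by
  simp [sqNorm]

/-- Squared Frobenius norm. -/
def frobSq (A : Matrix ι κ ℝ) : ℝ := ∑ i, ∑ j, A i j ^ 2

lemma frobSq_nonneg (A : Matrix ι κ ℝ) : 0 ≤ frobSq A :=
  Finset.sum_nonneg fun _ _ => Finset.sum_nonneg fun _ _ => sq_nonneg _

lemma frobNorm_eq (A : Matrix ι κ ℝ) : frobNorm A = Real.sqrt (frobSq A) := rfl

lemma frobSq_transpose (A : Matrix ι κ ℝ) : frobSq Aᵀ = frobSq A := Finset.sum_comm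

lemma frobSq_eq_sum_sqNorm_col (A : Matrix ι κ ℝ) : frobSq A = ∑ j, sqNorm (Aᵀ j) :=
  Finset.sum_comm

lemma frobSq_eq_trace (A : Matrix ι κ ℝ) : frobSq A = (Aᵀ * A).trace := by
  rw [frobSq_eq_sum_sqNorm_col]
  simp [Matrix.trace, Matrix.mul_apply, sqNorm, sq]

lemma sqNorm_mulVec_le (A : Matrix ι κ ℝ) (v : κ → ℝ) :
    sqNorm (A *ᵥ v) ≤ frobSq A * sqNorm v := by
  rw [frobSq, Finset.sum_mul]
  exact Finset.sum_le_sum fun i _ => dotProduct_sq_le (A i) v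

lemma frobSq_mul_le {σ : Type*} [Fintype σ] (A : Matrix ι κ ℝ) (B : Matrix κ σ ℝ) :
    frobSq (A * B) ≤ frobSq A * frobSq B := by
  rw [frobSq_eq_sum_sqNorm_col, frobSq_eq_sum_sqNorm_col B, Finset.mul_sum]
  exact Finset.sum_le_sum fun j _ => sqNorm_mulVec_le A (Bᵀ j)

lemma dotProduct_transpose_mulVec (A : Matrix ι κ ℝ) (u : κ → ℝ) (v : ι → ℝ) :
    u ⬝ᵥ (Aᵀ *ᵥ v) = (A *ᵥ u) ⬝ᵥ v := by
  rw [Matrix.mulVec_transpose, dotProduct_comm, ← Matrix.dotProduct_mulVec, dotProduct_comm]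

lemma dotProduct_gram_mulVec (A : Matrix ι κ ℝ) (v : κ → ℝ) :
    v ⬝ᵥ ((Aᵀ * A) *ᵥ v) = sqNorm (A *ᵥ v) := by
  rw [← Matrix.mulVec_mulVec, dotProduct_transpose_mulVec, sqNorm_eq_dotProduct]

end SqNorm

/-! ### The annihilator -/

section Annihilator

variable {T r : ℕ}

lemma posSemidef_transpose_mul_self {ι κ : Type*} [Fintype ι] [Fintype κ] (A : Matrix ι κ ℝ) :
    (Aᵀ * A).PosSemidef := by
  have := Matrix.posSemidef_conjTranspose_mul_self A
  rwa [Matrix.conjTranspose_eq_transpose_of_trivial] at this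

lemma annihilator_transpose (F : Matrix (Fin T) (Fin r) ℝ) : (annihilator F)ᵀ = annihilator F := by
  simp [annihilator, Matrix.transpose_nonsing_inv, Matrix.mul_assoc]

lemma annihilator_mul_self {F : Matrix (Fin T) (Fin r) ℝ} (h : IsUnit (Fᵀ * F).det) :
    annihilator F * F = 0 := by
  rw [annihilator, Matrix.sub_mul, Matrix.one_mul, Matrix.mul_assoc, Matrix.mul_assoc,
    Matrix.nonsing_inv_mul _ h, Matrix.mul_one, sub_self]

lemma annihilator_mul_annihilator {F : Matrix (Fin T) (Fin r) ℝ} (h : IsUnit (Fᵀ * F).det) :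
    annihilator F * annihilator F = annihilator F := by
  nth_rw 2 [annihilator]
  rw [Matrix.mul_sub, Matrix.mul_one, ← Matrix.mul_assoc, ← Matrix.mul_assoc,
    annihilator_mul_self h, Matrix.zero_mul, Matrix.zero_mul, sub_zero]

lemma dotProduct_annihilator_mulVec {F : Matrix (Fin T) (Fin r) ℝ} (h : IsUnit (Fᵀ * F).det)
    (u v : Fin T → ℝ) :
    u ⬝ᵥ (annihilator F *ᵥ v) = (annihilator F *ᵥ u) ⬝ᵥ (annihilator F *ᵥ v) := by
  rw [← dotProduct_transpose_mulVec, annihilator_transpose, Matrix.mulVec_mulVec,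
    annihilator_mul_annihilator h]

lemma dotProduct_annihilator_self {F : Matrix (Fin T) (Fin r) ℝ} (h : IsUnit (Fᵀ * F).det)
    (u : Fin T → ℝ) : u ⬝ᵥ (annihilator F *ᵥ u) = sqNorm (annihilator F *ᵥ u) := by
  rw [dotProduct_annihilator_mulVec h, sqNorm_eq_dotProduct]

/-- No rank condition is needed: a singular Gram matrix has inverse `0` by convention, and the
inverse is positive semidefinite in either case. -/
lemma dotProduct_annihilator_self_le (F : Matrix (Fin T) (Fin r) ℝ) (u : Fin T → ℝ) :
    u ⬝ᵥ (annihilator F *ᵥ u) ≤ sqNorm u := by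
  have h : 0 ≤ (Fᵀ *ᵥ u) ⬝ᵥ ((Fᵀ * F)⁻¹ *ᵥ (Fᵀ *ᵥ u)) := by
    simpa using (posSemidef_transpose_mul_self F).inv.dotProduct_mulVec_nonneg (Fᵀ *ᵥ u)
  have h2 : u ⬝ᵥ (annihilator F *ᵥ u)
      = sqNorm u - (Fᵀ *ᵥ u) ⬝ᵥ ((Fᵀ * F)⁻¹ *ᵥ (Fᵀ *ᵥ u)) := by
    rw [annihilator, Matrix.sub_mulVec, dotProduct_sub, Matrix.one_mulVec, ← sqNorm_eq_dotProduct,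
      ← Matrix.mulVec_mulVec, ← Matrix.mulVec_mulVec]
    congr 1
    nth_rw 1 [← Matrix.transpose_transpose F]
    rw [dotProduct_transpose_mulVec]
  linarith

lemma sqNorm_annihilator_mulVec_le {F : Matrix (Fin T) (Fin r) ℝ} (h : IsUnit (Fᵀ * F).det)
    (u : Fin T → ℝ) : sqNorm (annihilator F *ᵥ u) ≤ sqNorm u := by
  rw [← dotProduct_annihilator_self h]
  exact dotProduct_annihilator_self_le F u

/-- The annihilator depends on the column space only, so a normalization can be imposed or dropped
without changing it. -/
lemma annihilator_mul_of_isUnit (F : Matrix (Fin T) (Fin r) ℝ) {H : Matrix (Fin r) (Fin r) ℝ}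
    (hH : IsUnit H.det) : annihilator (F * H) = annihilator F := by
  have hH' : IsUnit Hᵀ.det := by rwa [Matrix.det_transpose]
  have e : (F * H)ᵀ * (F * H) = Hᵀ * ((Fᵀ * F) * H) := by
    rw [Matrix.transpose_mul]; simp only [Matrix.mul_assoc]
  rw [annihilator, annihilator, e, Matrix.mul_inv_rev, Matrix.mul_inv_rev, Matrix.transpose_mul]
  congr 1
  calc F * H * (H⁻¹ * (Fᵀ * F)⁻¹ * Hᵀ⁻¹) * (Hᵀ * Fᵀ)
      = F * (H * H⁻¹) * (Fᵀ * F)⁻¹ * (Hᵀ⁻¹ * Hᵀ) * Fᵀ := by simp only [Matrix.mul_assoc]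
    _ = F * (Fᵀ * F)⁻¹ * Fᵀ := by
      rw [Matrix.mul_nonsing_inv _ hH, Matrix.nonsing_inv_mul _ hH', Matrix.mul_one, Matrix.mul_one]

lemma IsNormalized.isUnit_det {F : Matrix (Fin T) (Fin r) ℝ} (hF : IsNormalized F) (hT : 0 < T) :
    IsUnit (Fᵀ * F).det := by
  rw [hF, Matrix.det_smul, Matrix.det_one, mul_one]
  exact (pow_ne_zero _ (by positivity)).isUnit

lemma IsNormalized.sqNorm_mulVec {F : Matrix (Fin T) (Fin r) ℝ} (hF : IsNormalized F)
    (v : Fin r → ℝ) : sqNorm (F *ᵥ v) = T * sqNorm v := by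
  rw [← dotProduct_gram_mulVec, hF, Matrix.smul_mulVec, Matrix.one_mulVec, dotProduct_smul,
    sqNorm_eq_dotProduct, smul_eq_mul]

lemma IsNormalized.annihilator_eq {F : Matrix (Fin T) (Fin r) ℝ} (hF : IsNormalized F)
    (hT : 0 < T) : annihilator F = 1 - (T : ℝ)⁻¹ • (F * Fᵀ) := by
  have hT' : (T : ℝ) ≠ 0 := by positivity
  have : ((T : ℝ) • (1 : Matrix (Fin r) (Fin r) ℝ))⁻¹ = (T : ℝ)⁻¹ • 1 := by
    apply Matrix.inv_eq_right_inv
    rw [Matrix.smul_mul, Matrix.mul_smul, Matrix.one_mul, smul_smul, mul_inv_cancel₀ hT', one_smul]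
  rw [annihilator, hF, this]
  simp

lemma IsNormalized.annihilator_mulVec {F : Matrix (Fin T) (Fin r) ℝ} (hF : IsNormalized F)
    (hT : 0 < T) (u : Fin T → ℝ) :
    annihilator F *ᵥ u = u - F *ᵥ ((T : ℝ)⁻¹ • (Fᵀ *ᵥ u)) := by
  rw [hF.annihilator_eq hT, Matrix.sub_mulVec, Matrix.one_mulVec, Matrix.smul_mulVec,
    Matrix.mulVec_smul, Matrix.mulVec_mulVec]

lemma IsNormalized.sqNorm_transpose_mulVec {F : Matrix (Fin T) (Fin r) ℝ} (hF : IsNormalized F)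
    (hT : 0 < T) (u : Fin T → ℝ) :
    u ⬝ᵥ (annihilator F *ᵥ u) = sqNorm u - (T : ℝ)⁻¹ * sqNorm (Fᵀ *ᵥ u) := by
  rw [hF.annihilator_mulVec hT, dotProduct_sub, Matrix.mulVec_smul, dotProduct_smul,
    ← sqNorm_eq_dotProduct, smul_eq_mul]
  congr 2
  rw [sqNorm_eq_dotProduct, dotProduct_transpose_mulVec, dotProduct_comm]

lemma IsNormalized.sqNorm_transpose_mulVec_le {F : Matrix (Fin T) (Fin r) ℝ}
    (hF : IsNormalized F) (hT : 0 < T) (u : Fin T → ℝ) :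
    (T : ℝ)⁻¹ * sqNorm (Fᵀ *ᵥ u) ≤ sqNorm u := by
  have h1 := hF.sqNorm_transpose_mulVec hT u
  have h2 := dotProduct_annihilator_self (hF.isUnit_det hT) u
  have h3 := sqNorm_nonneg (annihilator F *ᵥ u)
  linarith

open scoped MatrixOrder ComplexOrder in
lemma exists_eq_transpose_mul_self {ι : Type*} [Fintype ι] [DecidableEq ι] {A : Matrix ι ι ℝ}
    (hA : A.PosDef) : ∃ B : Matrix ι ι ℝ, IsUnit B.det ∧ A = Bᵀ * B := by
  obtain ⟨B, hB⟩ := CStarAlgebra.nonneg_iff_eq_star_mul_self.mp hA.posSemidef.nonneg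
  have hB' : A = Bᵀ * B := by
    rw [hB, Matrix.star_eq_conjTranspose, Matrix.conjTranspose_eq_transpose_of_trivial]
  refine ⟨B, ?_, hB'⟩
  have h := (Matrix.isUnit_iff_isUnit_det _).mp hA.isUnit
  rw [hB', Matrix.det_mul] at h
  exact isUnit_of_mul_isUnit_right h

lemma posDef_transpose_mul_self {F : Matrix (Fin T) (Fin r) ℝ} (h : IsUnit (Fᵀ * F).det) :
    (Fᵀ * F).PosDef := by
  refine (posSemidef_transpose_mul_self F).posDef_iff_isUnit.mpr ?_
  rwa [Matrix.isUnit_iff_isUnit_det]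

/-- A matrix of full column rank can be normalized without changing its column space. -/
lemma exists_isNormalized (hT : 0 < T) {F : Matrix (Fin T) (Fin r) ℝ}
    (h : IsUnit (Fᵀ * F).det) :
    ∃ H : Matrix (Fin r) (Fin r) ℝ, IsUnit H.det ∧ IsNormalized (F * H) ∧
      annihilator (F * H) = annihilator F := by
  obtain ⟨B, hB, e⟩ := exists_eq_transpose_mul_self (posDef_transpose_mul_self h)
  have hB' : IsUnit (Bᵀ).det := by rwa [Matrix.det_transpose]
  -- With `FᵀF = BᵀB` the matrix `H = √T B⁻¹` normalizes, since `(FH)ᵀ(FH) = T B⁻ᵀ BᵀB B⁻¹`.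
  have hH : IsUnit (Real.sqrt T • B⁻¹).det := by
    rw [Matrix.det_smul]
    have hB2 : IsUnit (B⁻¹).det := (Matrix.isUnit_nonsing_inv_det_iff).mpr hB
    exact IsUnit.mul (pow_ne_zero _ (by positivity)).isUnit hB2
  refine ⟨Real.sqrt T • B⁻¹, hH, ?_, annihilator_mul_of_isUnit F hH⟩
  have : (F * (Real.sqrt T • B⁻¹))ᵀ * (F * (Real.sqrt T • B⁻¹))
      = (Real.sqrt T * Real.sqrt T) • ((B⁻¹)ᵀ * (Fᵀ * F) * B⁻¹) := by
    simp only [Matrix.transpose_mul, Matrix.transpose_smul, Matrix.mul_smul, Matrix.smul_mul,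
      smul_smul, Matrix.mul_assoc]
  rw [IsNormalized, this, e, Real.mul_self_sqrt (by positivity), Matrix.transpose_nonsing_inv,
    ← Matrix.mul_assoc, Matrix.nonsing_inv_mul _ hB', Matrix.one_mul, Matrix.mul_nonsing_inv _ hB]

end Annihilator

/-! ### Vectors that are bounded combinations of the others -/

section LeaveOneOut

/-- Among finitely many vectors of `ℝ^r`, all but at most `r` are combinations of the others
with coefficients in `[-1, 1]`. -/
lemma card_not_bounded_combination_le {ι : Type*} [Fintype ι] [DecidableEq ι] {r : ℕ}
    (g : ι → Fin r → ℝ) (s : Finset ι)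
    (hs : ∀ j ∈ s, ¬ ∃ c : ι → ℝ, c j = 0 ∧ (∀ k, |c k| ≤ 1) ∧ g j = ∑ k, c k • g k) :
    s.card ≤ r := by
  by_contra! hr
  have hdep : ¬ LinearIndependent ℝ (fun j : s => g j) := by
    intro h
    have := h.fintype_card_le_finrank
    simp at this
    omega
  obtain ⟨a, ha, i, hi⟩ := Fintype.not_linearIndependent_iff.mp hdep
  -- Solving a linear relation for the vector whose coefficient has the largest modulus keeps all
  -- other coefficients in `[-1, 1]`.
  obtain ⟨j, -, hj⟩ := Finset.exists_max_image Finset.univ (fun j => |a j|) ⟨i, Finset.mem_univ i⟩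
  have haj : a j ≠ 0 := by
    intro h0
    have := hj i (Finset.mem_univ i)
    rw [h0, abs_zero] at this
    exact hi (abs_eq_zero.mp (le_antisymm this (abs_nonneg _)))
  refine hs j j.2 ⟨fun k => if h : k ∈ s then (if k = j then 0 else - (a ⟨k, h⟩ / a j)) else 0,
    by simp, ?_, ?_⟩
  · intro k
    by_cases h : k ∈ s
    · by_cases hk : k = j
      · simp [hk]
      · simp only [h, hk, dite_true, if_false, abs_neg, abs_div]
        exact div_le_one_of_le₀ (hj ⟨k, h⟩ (Finset.mem_univ _)) (abs_nonneg _)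
    · simp [h]
  · have e1 : ∑ k, (if h : k ∈ s then (if k = j then 0 else - (a ⟨k, h⟩ / a j)) else 0) • g k
        = ∑ k : s, (if k = j then 0 else - (a k / a j)) • g k := by
      rw [← Finset.sum_subset (Finset.subset_univ s), ← Finset.sum_coe_sort s]
      · refine Finset.sum_congr rfl fun k _ => ?_
        rw [dif_pos k.2]
        by_cases hk : k = j
        · rw [if_pos hk, if_pos (congrArg Subtype.val hk)]
        · rw [if_neg hk, if_neg fun h => hk (Subtype.ext h)]
      · intro k _ hk
        simp [hk]
    rw [e1]
    have e2 : ∀ k : s, (if k = j then (0 : ℝ) else - (a k / a j)) • g k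
        = (if k = j then g j else 0) - (a j)⁻¹ • (a k • g k) := by
      intro k
      split_ifs with h
      · subst h
        rw [smul_smul, inv_mul_cancel₀ haj]
        simp
      · rw [smul_smul, zero_sub, ← neg_smul]
        congr 1
        ring
    simp only [e2, Finset.sum_sub_distrib, ← Finset.smul_sum, ha]
    simp

/-- Vectors are indexed by the positions of a tuple, so repeated units do no harm; the coefficient
at `j` itself vanishes and drops out. -/
lemma card_not_bounded_combination_succAbove_le {m r : ℕ} (g : Fin (m + 1) → Fin r → ℝ)
    (s : Finset (Fin (m + 1)))
    (hs : ∀ j ∈ s, ¬ ∃ c : Fin m → ℝ, (∀ k, |c k| ≤ 1) ∧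
      g j = ∑ k, c k • g (j.succAbove k)) : s.card ≤ r := by
  refine card_not_bounded_combination_le g s fun j hj ⟨c, hc0, hc, e⟩ => hs j hj
    ⟨fun k => c (j.succAbove k), fun k => hc _, ?_⟩
  rw [e, Fin.sum_univ_succAbove _ j, hc0, zero_smul, zero_add]

open Classical in
/-- If every `(m+1)`-tuple has at most `r` exceptional positions, then a proportion of at most
`r / (m + 1)` of all pairs (index, `m`-tuple) is exceptional. -/
lemma sum_exceptional_le {N m r : ℕ} (bad : Fin N → (Fin m → Fin N) → Prop)
    (h : ∀ J : Fin (m + 1) → Fin N,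
      (Finset.univ.filter fun j => bad (J j) fun k => J (j.succAbove k)).card ≤ r) :
    ((m : ℝ) + 1) * ∑ i, ∑ I, (if bad i I then (1 : ℝ) else 0) ≤ r * (N : ℝ) ^ (m + 1) := by
  -- Each position `j` identifies `(m+1)`-tuples with pairs of an entry and the remaining `m`-tuple,
  -- so all `m + 1` sums agree.
  have h1 : ∀ j : Fin (m + 1), ∑ J : Fin (m + 1) → Fin N,
      (if bad (J j) (fun k => J (j.succAbove k)) then (1 : ℝ) else 0)
      = ∑ i, ∑ I, (if bad i I then (1 : ℝ) else 0) := by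
    intro j
    rw [← Fintype.sum_prod_type', ← (Fin.insertNthEquiv (fun _ => Fin N) j).sum_comp]
    simp [Fin.insertNthEquiv]
  have h2 : ∑ J : Fin (m + 1) → Fin N, ∑ j : Fin (m + 1),
      (if bad (J j) (fun k => J (j.succAbove k)) then (1 : ℝ) else 0)
      ≤ ∑ J : Fin (m + 1) → Fin N, (r : ℝ) := by
    refine Finset.sum_le_sum fun J _ => ?_
    rw [Finset.sum_boole]
    exact_mod_cast h J
  rw [Finset.sum_comm] at h2
  simp only [h1] at h2
  simp only [Finset.sum_const, Finset.card_univ, Fintype.card_fin, Fintype.card_pi,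
    Finset.prod_const, nsmul_eq_mul] at h2
  push_cast at h2
  linarith

end LeaveOneOut

/-! ### Orthonormal families and cross terms -/

section CrossTerm

lemma dotProduct_eq_inner {T : ℕ} (u v : Fin T → ℝ) :
    u ⬝ᵥ v = inner ℝ (WithLp.toLp 2 u : EuclideanSpace ℝ (Fin T)) (WithLp.toLp 2 v) := by
  rw [EuclideanSpace.inner_toLp_toLp]
  simp [dotProduct_comm]

lemma sqNorm_eq_norm_sq {T : ℕ} (u : Fin T → ℝ) :
    sqNorm u = ‖(WithLp.toLp 2 u : EuclideanSpace ℝ (Fin T))‖ ^ 2 := by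
  rw [sqNorm_eq_dotProduct, dotProduct_eq_inner, real_inner_self_eq_norm_sq]

/-- Expand `y` in the orthonormal family and apply Cauchy-Schwarz to the coefficients. -/
lemma Orthonormal.inner_sq_le {E σ : Type*} [NormedAddCommGroup E] [InnerProductSpace ℝ E]
    [Fintype σ] {v : σ → E} (hv : Orthonormal ℝ v) {y : E}
    (hy : y ∈ Submodule.span ℝ (Set.range v)) (w : E) :
    inner ℝ y w ^ 2 ≤ ‖y‖ ^ 2 * ∑ j, inner ℝ (v j) w ^ 2 := by
  obtain ⟨c, rfl⟩ := (Submodule.mem_span_range_iff_exists_fun ℝ).mp hy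
  have h1 : ‖∑ i, c i • v i‖ ^ 2 = ∑ i, c i ^ 2 := by
    rw [← real_inner_self_eq_norm_sq, hv.inner_sum]
    simp [sq]
  rw [h1, sum_inner]
  simp only [real_inner_smul_left]
  exact Finset.sum_mul_sq_le_sq_mul_sq _ _ _

/-- A subspace of dimension `k` has `k` unit vectors that control all inner products with its
elements. -/
lemma exists_unit_vectors {T : ℕ} (V : Submodule ℝ (Fin T → ℝ)) :
    ∃ e : Fin (Module.finrank ℝ V) → Fin T → ℝ, (∀ j, sqNorm (e j) = 1) ∧
      ∀ y ∈ V, ∀ w, (y ⬝ᵥ w) ^ 2 ≤ sqNorm y * ∑ j, (e j ⬝ᵥ w) ^ 2 := by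
  let L : EuclideanSpace ℝ (Fin T) ≃ₗ[ℝ] (Fin T → ℝ) := WithLp.linearEquiv 2 ℝ (Fin T → ℝ)
  let V' : Submodule ℝ (EuclideanSpace ℝ (Fin T)) := V.map (L.symm : _ →ₗ[ℝ] _)
  have hfr : Module.finrank ℝ V' = Module.finrank ℝ V := LinearEquiv.finrank_map_eq L.symm V
  let b := (stdOrthonormalBasis ℝ V').reindex (finCongr hfr)
  have hon : Orthonormal ℝ (fun j => (b j : EuclideanSpace ℝ (Fin T))) :=
    b.orthonormal.comp_linearIsometry V'.subtypeₗᵢ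
  refine ⟨fun j => WithLp.ofLp (b j : EuclideanSpace ℝ (Fin T)), fun j => ?_, fun y hy w => ?_⟩
  · have h : ‖(b j : EuclideanSpace ℝ (Fin T))‖ = 1 := hon.1 j
    rw [sqNorm_eq_norm_sq, WithLp.toLp_ofLp, h, one_pow]
  · have hy' : (WithLp.toLp 2 y : EuclideanSpace ℝ (Fin T)) ∈ V' :=
      ⟨y, hy, rfl⟩
    have hsp : (WithLp.toLp 2 y : EuclideanSpace ℝ (Fin T)) ∈
        Submodule.span ℝ (Set.range fun j => (b j : EuclideanSpace ℝ (Fin T))) := by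
      rw [Submodule.mem_span_range_iff_exists_fun]
      refine ⟨fun j => b.repr ⟨_, hy'⟩ j, ?_⟩
      have := congrArg (Subtype.val) (b.sum_repr ⟨_, hy'⟩)
      simpa using this
    have := Orthonormal.inner_sq_le hon hsp (WithLp.toLp 2 w)
    rw [dotProduct_eq_inner, sqNorm_eq_norm_sq]
    refine this.trans (le_of_eq ?_)
    congr 1
    refine Finset.sum_congr rfl fun j _ => ?_
    rw [dotProduct_eq_inner]

/-- The sum is the quadratic form of `∑ ε_i ε_iᵀ` at `e`, and the Frobenius norm dominates the
operator norm. The bound is uniform in `e`, which may therefore depend on the errors. -/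
lemma sum_dotProduct_sq_le {N T : ℕ} (ε : Fin N → Fin T → ℝ) (e : Fin T → ℝ)
    (he : sqNorm e = 1) :
    ∑ i, (e ⬝ᵥ ε i) ^ 2 ≤ Real.sqrt (∑ t, ∑ s, (∑ i, ε i t * ε i s) ^ 2) := by
  let A : Matrix (Fin T) (Fin T) ℝ := Matrix.of fun t s => ∑ i, ε i t * ε i s
  have h1 : ∑ i, (e ⬝ᵥ ε i) ^ 2 = e ⬝ᵥ (A *ᵥ e) := by
    have h2 : ∀ i, (e ⬝ᵥ ε i) ^ 2 = ∑ t, ∑ s, e t * ε i t * (e s * ε i s) := fun i => by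
      rw [sq, dotProduct, Finset.sum_mul_sum]
    rw [Finset.sum_congr rfl fun i _ => h2 i]
    simp only [dotProduct, Matrix.mulVec, A, Matrix.of_apply, Finset.sum_mul, Finset.mul_sum]
    rw [Finset.sum_comm]
    refine Finset.sum_congr rfl fun t _ => ?_
    rw [Finset.sum_comm]
    refine Finset.sum_congr rfl fun s _ => Finset.sum_congr rfl fun i _ => ?_
    ring
  rw [h1]
  apply Real.le_sqrt_of_sq_le
  refine (dotProduct_sq_le _ _).trans ?_
  have := sqNorm_mulVec_le A e
  rw [he, mul_one] at this
  rw [he, one_mul]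
  exact this

lemma sum_sum_dotProduct_sq_le {N T k : ℕ} (ε : Fin N → Fin T → ℝ) (e : Fin k → Fin T → ℝ)
    (he : ∀ j, sqNorm (e j) = 1) :
    ∑ i, ∑ j, (e j ⬝ᵥ ε i) ^ 2 ≤ k * Real.sqrt (∑ t, ∑ s, (∑ i, ε i t * ε i s) ^ 2) := by
  rw [Finset.sum_comm]
  refine (Finset.sum_le_sum fun j _ => sum_dotProduct_sq_le ε (e j) (he j)).trans ?_
  simp

/-- The scale `z / ‖M_F z‖` of a vector, zero if `M_F z = 0`. -/
def residScale {T r : ℕ} (F : Matrix (Fin T) (Fin r) ℝ) (z : Fin T → ℝ) : ℝ :=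
  (Real.sqrt (sqNorm (annihilator F *ᵥ z)))⁻¹

/-- The coordinates of `P_F z / ‖M_F z‖` in the basis of the columns of `F`. -/
def residCoord {T r : ℕ} (F : Matrix (Fin T) (Fin r) ℝ) (z : Fin T → ℝ) : Fin r → ℝ :=
  residScale F z • (T : ℝ)⁻¹ • (Fᵀ *ᵥ z)

lemma sqNorm_residScale_le {T r : ℕ} (F : Matrix (Fin T) (Fin r) ℝ) (z : Fin T → ℝ) :
    sqNorm (annihilator F *ᵥ (residScale F z • z)) ≤ 1 := by
  rw [Matrix.mulVec_smul, sqNorm_smul, residScale, inv_pow, Real.sq_sqrt (sqNorm_nonneg _)]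
  exact inv_mul_le_one

lemma mulVec_residCoord {T r : ℕ} {F : Matrix (Fin T) (Fin r) ℝ} (hF : IsNormalized F)
    (hT : 0 < T) (z : Fin T → ℝ) :
    F *ᵥ residCoord F z = residScale F z • z - annihilator F *ᵥ (residScale F z • z) := by
  rw [hF.annihilator_mulVec hT, sub_sub_cancel, residCoord]
  simp only [Matrix.mulVec_smul]
  rw [smul_comm]

/-- If the coordinates of `z` are a bounded combination of those of the vectors `w k`, then the
inner product of `M_F z` with a vector `x` is controlled by projections of `x` on subspaces that
contain `z` and the `w k`, respectively the `w k` and the columns of `F`. -/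
lemma annihilator_dotProduct_sq_le {T r m : ℕ} {F : Matrix (Fin T) (Fin r) ℝ}
    (hF : IsNormalized F) (hT : 0 < T) {z x : Fin T → ℝ} {w : Fin m → Fin T → ℝ}
    {V W : Submodule ℝ (Fin T → ℝ)} (hzV : z ∈ V) (hwV : ∀ k, w k ∈ V) (hwW : ∀ k, w k ∈ W)
    (hFW : ∀ v, F *ᵥ v ∈ W) {p q : ℝ} (hp0 : 0 ≤ p) (hq0 : 0 ≤ q)
    (hp : ∀ y ∈ V, (y ⬝ᵥ x) ^ 2 ≤ sqNorm y * p) (hq : ∀ y ∈ W, (y ⬝ᵥ x) ^ 2 ≤ sqNorm y * q)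
    {c : Fin m → ℝ} (hc : ∀ k, |c k| ≤ 1)
    (hcoord : residCoord F z = ∑ k, c k • residCoord F (w k)) :
    ((annihilator F *ᵥ z) ⬝ᵥ x) ^ 2
      ≤ sqNorm (annihilator F *ᵥ z) * ((12 + 8 * (m : ℝ) ^ 2) * (p + q)) := by
  by_cases h0 : sqNorm (annihilator F *ᵥ z) = 0
  · rw [sqNorm_eq_zero.mp h0]; simp
  set σ := Real.sqrt (sqNorm (annihilator F *ᵥ z)) with hσ
  have hσ2 : σ ^ 2 = sqNorm (annihilator F *ᵥ z) := Real.sq_sqrt (sqNorm_nonneg _)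
  have hσ0 : σ ≠ 0 := fun h => h0 (by rw [← hσ2, h]; simp)
  have hz : σ • residScale F z • z = z := by
    rw [residScale, ← hσ, smul_smul, mul_inv_cancel₀ hσ0, one_smul]
  set zh := residScale F z • z with hzh
  set wh : Fin m → Fin T → ℝ := fun k => residScale F (w k) • w k with hwh
  set s := ∑ k, c k • wh k with hs
  set y := zh - s with hy
  -- The hypothesis on the coordinates says that `zh` and `s` have the same projection on the
  -- columns of `F`.
  have hP : F *ᵥ residCoord F z = s - annihilator F *ᵥ s := by
    rw [hcoord, Matrix.mulVec_sum, hs, Matrix.mulVec_sum, ← Finset.sum_sub_distrib]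
    refine Finset.sum_congr rfl fun k _ => ?_
    rw [Matrix.mulVec_smul, mulVec_residCoord hF hT, smul_sub, Matrix.mulVec_smul (annihilator F) (c k)]
  -- Hence `y = M_F (zh - s)`, which is bounded although `zh` and `s` can be arbitrarily large.
  have hyM : y = annihilator F *ᵥ zh - annihilator F *ᵥ s := by
    have := mulVec_residCoord hF hT z
    rw [hP] at this
    rw [hy]
    have e : zh = s - annihilator F *ᵥ s + annihilator F *ᵥ zh := by rw [this]; abel
    nth_rw 1 [e]
    abel
  have hMz : sqNorm (annihilator F *ᵥ zh) ≤ 1 := sqNorm_residScale_le F z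
  have hMs : sqNorm (annihilator F *ᵥ s) ≤ (m : ℝ) ^ 2 := by
    rw [hs, Matrix.mulVec_sum]
    refine (sqNorm_sum_le _ _).trans ?_
    have : ∑ k, sqNorm (annihilator F *ᵥ (c k • wh k)) ≤ ∑ _k : Fin m, (1 : ℝ) := by
      refine Finset.sum_le_sum fun k _ => ?_
      rw [Matrix.mulVec_smul, sqNorm_smul]
      have h1 : c k ^ 2 ≤ 1 := (sq_le_one_iff_abs_le_one _).mpr (hc k)
      have h2 := sqNorm_residScale_le F (w k)
      exact mul_le_one₀ h1 (sqNorm_nonneg _) h2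
    simp only [Finset.sum_const, Finset.card_univ, Fintype.card_fin, nsmul_eq_mul, mul_one] at this ⊢
    rw [sq]
    exact mul_le_mul_of_nonneg_left this (by positivity)
  have hyn : sqNorm y ≤ 2 + 2 * (m : ℝ) ^ 2 := by
    rw [hyM]
    refine (sqNorm_sub_le _ _).trans ?_
    linarith
  have hsW : s ∈ W := Submodule.sum_mem _ fun k _ =>
    Submodule.smul_mem _ _ (Submodule.smul_mem _ _ (hwW k))
  have hyV : y ∈ V := by
    refine Submodule.sub_mem _ (Submodule.smul_mem _ _ hzV) (Submodule.sum_mem _ fun k _ =>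
      Submodule.smul_mem _ _ (Submodule.smul_mem _ _ (hwV k)))
  -- The remainder no longer contains `z` except through `F`: it equals `s` minus the projection of
  -- `zh` on `F`.
  set y' := annihilator F *ᵥ zh - y with hy'
  have hy'W : y' ∈ W := by
    have : y' = s - F *ᵥ residCoord F z := by
      rw [mulVec_residCoord hF hT z, hy', hy]
      abel
    rw [this]
    exact Submodule.sub_mem _ hsW (hFW _)
  have hy'n : sqNorm y' ≤ 6 + 4 * (m : ℝ) ^ 2 := by
    refine (sqNorm_sub_le _ _).trans ?_
    linarith
  have e1 : annihilator F *ᵥ z = σ • (y + y') := by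
    rw [hy', add_sub_cancel, ← Matrix.mulVec_smul, hz]
  have h1 := hp y hyV
  have h2 := hq y' hy'W
  have h3 : ((annihilator F *ᵥ z) ⬝ᵥ x) ^ 2 = σ ^ 2 * (y ⬝ᵥ x + y' ⬝ᵥ x) ^ 2 := by
    rw [e1, smul_dotProduct, add_dotProduct, smul_eq_mul, mul_pow]
  rw [h3, hσ2]
  refine mul_le_mul_of_nonneg_left ?_ (sqNorm_nonneg _)
  have h4 : sqNorm y * p ≤ (6 + 4 * (m : ℝ) ^ 2) * p :=
    mul_le_mul_of_nonneg_right (hyn.trans (by nlinarith [sq_nonneg (m : ℝ)])) hp0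
  have h5 : sqNorm y' * q ≤ (6 + 4 * (m : ℝ) ^ 2) * q := mul_le_mul_of_nonneg_right hy'n hq0
  nlinarith [sq_nonneg (y ⬝ᵥ x - y' ⬝ᵥ x)]

open Classical in
/-- Uniform bound for the cross term `-2 ∑ i, ⟨M_F z_i, ε_i⟩`: apart from a quarter of
`∑ i, ‖M_F z_i‖²` it is controlled by the projections of the `ε_i` on subspaces of bounded
dimension, averaged over all `m`-tuples of indices. -/
lemma cross_term_le {N T r m k : ℕ} (hN : 0 < N) (hT : 0 < T) {F : Matrix (Fin T) (Fin r) ℝ}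
    (hF : IsNormalized F) (z ε : Fin N → Fin T → ℝ)
    (V : Fin N → (Fin m → Fin N) → Submodule ℝ (Fin T → ℝ))
    (hzV : ∀ i I, z i ∈ V i I) (hwV : ∀ i I k, z (I k) ∈ V i I)
    (p : Fin N → (Fin m → Fin N) → ℝ) (hp0 : ∀ i I, 0 ≤ p i I)
    (hp : ∀ i I, ∀ y ∈ V i I, (y ⬝ᵥ ε i) ^ 2 ≤ sqNorm y * p i I)
    (W : (Fin m → Fin N) → Submodule ℝ (Fin T → ℝ)) (hk : ∀ I, Module.finrank ℝ (W I) ≤ k)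
    (hwW : ∀ I k, z (I k) ∈ W I) (hFW : ∀ I v, F *ᵥ v ∈ W I)
    {lam K : ℝ} (hlam : 0 < lam) (hK : (N : ℝ)⁻¹ * ∑ i, (sqNorm (ε i) / T) ^ 2 ≤ K) :
    ((N : ℝ) * T)⁻¹ * ∑ i, -2 * ((annihilator F *ᵥ z i) ⬝ᵥ ε i)
      ≤ 1 / 4 * (((N : ℝ) * T)⁻¹ * ∑ i, sqNorm (annihilator F *ᵥ z i))
        + 2 * lam * (r / (m + 1)) + 2 * K / lam
        + 4 * (12 + 8 * (m : ℝ) ^ 2) * (((N : ℝ) ^ (m + 1) * T)⁻¹ * (∑ i, ∑ I, p i I)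
          + k * (((N : ℝ) * T)⁻¹ *
              Real.sqrt (∑ t, ∑ s, (∑ i, ε i t * ε i s) ^ 2))) := by
  choose e he1 he using fun I => exists_unit_vectors (W I)
  set S := Real.sqrt (∑ t, ∑ s, (∑ i, ε i t * ε i s) ^ 2) with hS
  set q : Fin N → (Fin m → Fin N) → ℝ := fun i I => ∑ j, (e I j ⬝ᵥ ε i) ^ 2 with hq
  obtain ⟨bad, hbad⟩ : ∃ bad : Fin N → (Fin m → Fin N) → Prop, ∀ i I, bad i I ↔
      ¬ ∃ c : Fin m → ℝ, (∀ k, |c k| ≤ 1) ∧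
        residCoord F (z i) = ∑ k, c k • residCoord F (z (I k)) := ⟨_, fun _ _ => Iff.rfl⟩
  have hcard := sum_exceptional_le bad (r := r) fun J =>
    card_not_bounded_combination_succAbove_le (fun j => residCoord F (z (J j))) _
      fun j hj => (hbad _ _).mp (Finset.mem_filter.mp hj).2
  set B := ∑ i, ∑ I, (if bad i I then (1 : ℝ) else 0) with hB
  have hN' : (0 : ℝ) < N := by exact_mod_cast hN
  have hT' : (0 : ℝ) < T := by exact_mod_cast hT
  set Q : Fin N → ℝ := fun i => sqNorm (annihilator F *ᵥ z i) with hQ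
  set c := 12 + 8 * (m : ℝ) ^ 2 with hc
  have hc0 : 0 < c := by positivity
  set ξ : Fin N → ℝ := fun i => sqNorm (ε i) / T with hξ
  have hpt : ∀ i I, -2 * ((annihilator F *ᵥ z i) ⬝ᵥ ε i) ≤ 1 / 4 * Q i
      + T * (2 * lam * (if bad i I then (1 : ℝ) else 0) + 2 * ξ i ^ 2 / lam)
      + 4 * c * (p i I + q i I) := by
    intro i I
    have hq0 : 0 ≤ q i I := Finset.sum_nonneg fun _ _ => sq_nonneg _
    have hQ0 : 0 ≤ Q i := sqNorm_nonneg _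
    have hξ0 : 0 ≤ 2 * ξ i ^ 2 / lam := by positivity
    -- Weighted arithmetic-geometric mean: `2 √(A b) ≤ A / 4 + 4 b`. The quarter is absorbed later
    -- by the left side of the basic inequality.
    have key : ∀ A a b : ℝ, 0 ≤ A → 0 ≤ b → a ^ 2 ≤ A * b → -2 * a ≤ 1 / 4 * A + 4 * b := by
      intro A a b hA hb h
      have h1 : (2 * a) ^ 2 ≤ (1 / 4 * A + 4 * b) ^ 2 := by nlinarith [sq_nonneg (1 / 4 * A - 4 * b)]
      have h2 := abs_le_of_sq_le_sq h1 (by positivity)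
      linarith [(abs_le.mp h2).1]
    -- An exceptional pair has only Cauchy-Schwarz; `4ξ ≤ 2λ + 2ξ²/λ` splits its cost into a
    -- multiple of the indicator and a fourth-moment term that a large `λ` makes small.
    by_cases hb : bad i I
    · have h1 : ((annihilator F *ᵥ z i) ⬝ᵥ ε i) ^ 2 ≤ Q i * sqNorm (ε i) := dotProduct_sq_le _ _
      have h2 := key _ _ _ hQ0 (sqNorm_nonneg _) h1
      have h3 : sqNorm (ε i) = T * ξ i := by rw [hξ]; field_simp
      have h4 : 4 * ξ i ≤ 2 * lam + 2 * ξ i ^ 2 / lam := by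
        have : 2 * lam + 2 * ξ i ^ 2 / lam - 4 * ξ i = 2 / lam * (lam - ξ i) ^ 2 := by
          field_simp; ring
        have h5 : 0 ≤ 2 / lam * (lam - ξ i) ^ 2 := by positivity
        linarith
      rw [if_pos hb, mul_one]
      have h6 : T * (4 * ξ i) ≤ T * (2 * lam + 2 * ξ i ^ 2 / lam) :=
        mul_le_mul_of_nonneg_left h4 hT'.le
      have h7 : 0 ≤ 4 * c * (p i I + q i I) := by have := hp0 i I; positivity
      rw [h3] at h2
      linarith
    · obtain ⟨a, ha, e⟩ := not_not.mp fun h => hb ((hbad i I).mpr h)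
      have h1 := annihilator_dotProduct_sq_le hF hT (hzV i I) (hwV i I) (hwW I) (hFW I)
        (hp0 i I) hq0 (hp i I) (fun y hy => he I y hy (ε i)) ha e
      have h2 := key _ _ _ hQ0 (by have := hp0 i I; positivity) h1
      rw [if_neg hb]
      have h3 : 0 ≤ T * (2 * lam * 0 + 2 * ξ i ^ 2 / lam) := by positivity
      linarith
  have hsum := Finset.sum_le_sum fun i (_ : i ∈ Finset.univ) =>
    Finset.sum_le_sum fun I (_ : I ∈ Finset.univ) => hpt i I
  -- The directions `e I` do not involve `i`, so the sum over `i` is taken first and the bound for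
  -- `∑ ε_i ε_iᵀ` applies.
  have hqs : ∑ i, ∑ I, q i I ≤ (N : ℝ) ^ m * (k * S) := by
    rw [Finset.sum_comm]
    have : ∀ I ∈ (Finset.univ : Finset (Fin m → Fin N)), ∑ i, q i I ≤ k * S := fun I _ =>
      (sum_sum_dotProduct_sq_le ε (e I) (he1 I)).trans
        (mul_le_mul_of_nonneg_right (by exact_mod_cast hk I) (Real.sqrt_nonneg _))
    refine (Finset.sum_le_sum this).trans ?_
    simp
  simp only [Finset.sum_add_distrib, ← Finset.mul_sum, Finset.sum_const, Finset.card_univ,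
    Fintype.card_pi, Fintype.card_fin, Finset.prod_const, nsmul_eq_mul, ← Finset.sum_div] at hsum
  push_cast at hsum
  rw [← hB] at hsum
  have hK' : ∑ i, ξ i ^ 2 ≤ N * K := by
    rw [inv_mul_le_iff₀ hN'] at hK
    exact hK
  have hB' : B ≤ r / (m + 1) * (N : ℝ) ^ (m + 1) := by
    rw [div_mul_eq_mul_div, le_div_iff₀ (by positivity)]
    linarith
  have hNm : (0 : ℝ) < (N : ℝ) ^ m := by positivity
  -- The left side involves no tuple; averaging over the `N^m` tuples leaves it unchanged.
  have e0 : ((N : ℝ) ^ (m + 1) * T)⁻¹ * ((N : ℝ) ^ m * ∑ i, -2 * ((annihilator F *ᵥ z i) ⬝ᵥ ε i))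
      = ((N : ℝ) * T)⁻¹ * ∑ i, -2 * ((annihilator F *ᵥ z i) ⬝ᵥ ε i) := by
    rw [pow_succ]; field_simp
  rw [← e0]
  have hpos : (0 : ℝ) < (N : ℝ) ^ (m + 1) * T := by positivity
  rw [inv_mul_le_iff₀ hpos]
  have hstep : (N : ℝ) ^ m * ∑ i, -2 * ((annihilator F *ᵥ z i) ⬝ᵥ ε i) ≤
      1 / 4 * ((N : ℝ) ^ m * ∑ i, Q i) + T * (2 * lam * (r / (m + 1) * (N : ℝ) ^ (m + 1))
        + (N : ℝ) ^ m * (2 * (N * K) / lam)) + 4 * c * (∑ i, ∑ I, p i I + (N : ℝ) ^ m * (k * S)) := by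
    have h1 : T * (2 * lam * B) ≤ T * (2 * lam * (r / (m + 1) * (N : ℝ) ^ (m + 1))) := by gcongr
    have h2 : T * ((N : ℝ) ^ m * (2 * (∑ i, ξ i ^ 2) / lam)) ≤
        T * ((N : ℝ) ^ m * (2 * (N * K) / lam)) := by gcongr
    have h3 : 4 * c * (∑ i, ∑ I, q i I) ≤ 4 * c * ((N : ℝ) ^ m * (k * S)) := by gcongr
    have e1 : ∑ i, (N : ℝ) ^ m * (2 * ξ i ^ 2 / lam)
        = (N : ℝ) ^ m * (2 * (∑ i, ξ i ^ 2) / lam) := by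
      rw [← Finset.mul_sum, ← Finset.sum_div, ← Finset.mul_sum]
    have e2 : ∑ i, (N : ℝ) ^ m * (1 / 4 * Q i) = 1 / 4 * ((N : ℝ) ^ m * ∑ i, Q i) := by
      rw [← Finset.mul_sum, ← Finset.mul_sum]; ring
    have e3 : ∑ i, (N : ℝ) ^ m * (-2 * ((annihilator F *ᵥ z i) ⬝ᵥ ε i))
        = (N : ℝ) ^ m * ∑ i, -2 * ((annihilator F *ᵥ z i) ⬝ᵥ ε i) := by
      rw [← Finset.mul_sum]
    simp only [← Finset.mul_sum] at hsum e1 e2 e3 ⊢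
    linarith
  refine hstep.trans (le_of_eq ?_)
  rw [pow_succ]
  field_simp
  ring

end CrossTerm

/-! ### The basic inequality of the second step -/

namespace Panel

variable {Ω : Type*} {d r : ℕ} (P : Panel Ω d r)

/-- The vector of expected shortfall errors of unit `i`. -/
def errVec (T i : ℕ) (ω : Ω) : Fin T → ℝ := fun t => P.esErr i t ω

/-- The error in the responses of the second step that is due to the first step. -/
def firstStepErr (T i : ℕ) (a : Fin d → ℝ) (ω : Ω) : Fin T → ℝ :=
  P.ZstarVec T i a ω - P.ZstarVec T i (P.α i) ω

/-- The regression part `X_i (β_i⁰ - b) + F⁰ λ_i⁰` of the second step residual. -/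
def signal (T i : ℕ) (ω : Ω) (b : Fin d → ℝ) : Fin T → ℝ :=
  P.Xmat T i ω *ᵥ (P.β i - b) + P.Fmat T ω *ᵥ P.lam i

lemma residual_eq (T i : ℕ) (a b : Fin d → ℝ) (ω : Ω) :
    P.ZstarVec T i a ω - P.Xmat T i ω *ᵥ b
      = P.signal T i ω b + (P.errVec T i ω + P.firstStepErr T i a ω) := by
  ext t
  simp only [signal, firstStepErr, errVec, esErr, Matrix.mulVec_sub, Pi.add_apply, Pi.sub_apply,
    ZstarVec, Matrix.mulVec, Xmat, Fmat, Matrix.of_apply]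
  rw [dotProduct_comm (P.lam i)]
  ring

/-- Mean square of the projected signal, `(NT)⁻¹ ∑ i, ‖M_F (X_i (β_i⁰ - b_i) + F⁰ λ_i⁰)‖²`. -/
def signalLoss (N T : ℕ) (ω : Ω) (b : Fin N → (Fin d → ℝ)) (F : Matrix (Fin T) (Fin r) ℝ) : ℝ :=
  ((N : ℝ) * T)⁻¹ * ∑ i : Fin N, sqNorm (annihilator F *ᵥ P.signal T i ω (b i))

/-- Mean square of the first step errors. -/
def firstStepLoss (N T : ℕ) (ω : Ω) (a : ℕ → (Fin d → ℝ)) : ℝ :=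
  ((N : ℝ) * T)⁻¹ * ∑ i : Fin N, sqNorm (P.firstStepErr T i (a i) ω)

/-- The Frobenius norm of `(NT)⁻¹ ∑ i, ε_i ε_iᵀ`. -/
def errGram (N T : ℕ) (ω : Ω) : ℝ :=
  ((N : ℝ) * T)⁻¹ *
    Real.sqrt (∑ t : Fin T, ∑ s : Fin T, (∑ i : Fin N, P.errVec T i ω t * P.errVec T i ω s) ^ 2)

/-- The columns of `F / √T` are unit vectors, so each of the `r` directions costs one Frobenius
norm, for all normalized `F` at once. -/
lemma sum_sqNorm_transpose_mulVec_errVec_le {N T : ℕ} (hT : 0 < T) (ω : Ω)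
    {F : Matrix (Fin T) (Fin r) ℝ} (hF : IsNormalized F) :
    ((N : ℝ) * T)⁻¹ * ∑ i : Fin N, (T : ℝ)⁻¹ * sqNorm (Fᵀ *ᵥ P.errVec T i ω)
      ≤ r * P.errGram N T ω := by
  have hT' : (0 : ℝ) < T := by exact_mod_cast hT
  have hs : Real.sqrt T ^ 2 = T := Real.sq_sqrt hT'.le
  have he : ∀ j : Fin r, sqNorm ((Real.sqrt T)⁻¹ • Fᵀ j) = 1 := by
    intro j
    have h := congrFun (congrFun hF j) j
    rw [Matrix.mul_apply] at h
    simp only [Matrix.transpose_apply, Matrix.smul_apply, Matrix.one_apply_eq, smul_eq_mul,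
      mul_one] at h
    rw [sqNorm_smul, sqNorm_eq_dotProduct, dotProduct]
    simp only [Matrix.transpose_apply]
    rw [h, inv_pow, hs, inv_mul_cancel₀ hT'.ne']
  have h := sum_sum_dotProduct_sq_le (fun i : Fin N => P.errVec T i ω)
    (fun j => (Real.sqrt T)⁻¹ • Fᵀ j) he
  have e : ∀ i : Fin N, ∑ j, ((Real.sqrt T)⁻¹ • Fᵀ j ⬝ᵥ P.errVec T i ω) ^ 2
      = (T : ℝ)⁻¹ * sqNorm (Fᵀ *ᵥ P.errVec T i ω) := by
    intro i
    simp only [smul_dotProduct, smul_eq_mul, mul_pow, inv_pow, hs, ← Finset.mul_sum]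
    rfl
  simp only [e] at h
  rw [errGram, ← mul_assoc, mul_comm (r : ℝ), mul_assoc]
  exact mul_le_mul_of_nonneg_left h (by positivity)

/-- The basic inequality of the second step, before the cross term is treated. -/
lemma signalLoss_le_of_isLSMinimizer {N T : ℕ} (hN : 0 < N) (hT : 0 < T) {ω : Ω}
    (hF0 : IsUnit ((P.Fmat T ω)ᵀ * P.Fmat T ω).det) {a : ℕ → (Fin d → ℝ)}
    {b : Fin N → (Fin d → ℝ)} {F : Matrix (Fin T) (Fin r) ℝ}
    (h : P.IsLSMinimizer N T a ω b F) :
    P.signalLoss N T ω b F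
      ≤ ((N : ℝ) * T)⁻¹ * (∑ i : Fin N,
          -2 * ((annihilator F *ᵥ P.signal T i ω (b i)) ⬝ᵥ P.errVec T i ω))
        + 1 / 4 * P.signalLoss N T ω b F + 2 * r * P.errGram N T ω
        + 6 * P.firstStepLoss N T ω a := by
  obtain ⟨hF, hmin⟩ := h
  -- `F⁰` need not be normalized and so need not be admissible; `F⁰ H` is admissible and has the
  -- same annihilator.
  obtain ⟨H, -, hH1, hH2⟩ := exists_isNormalized hT hF0
  have hmin := hmin (fun i => P.β i) _ hH1
  have hdet := hF.isUnit_det hT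
  rw [lsObj, lsObj, hH2] at hmin
  have hNT : (0 : ℝ) < (N : ℝ) * T := by positivity
  have hmin' := le_of_mul_le_mul_left hmin (inv_pos.mpr hNT)
  set M := annihilator F with hM
  set z : Fin N → Fin T → ℝ := fun i => P.signal T i ω (b i) with hz
  set e : Fin N → Fin T → ℝ := fun i => P.errVec T i ω with he
  set R : Fin N → Fin T → ℝ := fun i => P.firstStepErr T i (a i) ω with hR
  -- At the competitor the signal reduces to `F⁰ λ_i`, which `M_{F⁰}` annihilates.
  have h1 : ∀ i : Fin N, (P.ZstarVec T i (a i) ω - P.Xmat T i ω *ᵥ P.β i) ⬝ᵥ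
      (annihilator (P.Fmat T ω) *ᵥ (P.ZstarVec T i (a i) ω - P.Xmat T i ω *ᵥ P.β i))
      ≤ sqNorm (e i + R i) := by
    intro i
    rw [P.residual_eq, signal, sub_self, Matrix.mulVec_zero, zero_add,
      dotProduct_annihilator_self hF0, Matrix.mulVec_add, Matrix.mulVec_mulVec,
      annihilator_mul_self hF0, Matrix.zero_mulVec, zero_add]
    exact sqNorm_annihilator_mulVec_le hF0 _
  -- The product of signal and first-step error costs a quarter of the signal. The term `‖M_F (e +
  -- R)‖²` falls short of `‖e + R‖²` only by the projection on `F`, so `‖e + R‖²` cancels against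
  -- the value at the competitor.
  have h2 : ∀ i : Fin N, sqNorm (M *ᵥ z i) + 2 * ((M *ᵥ z i) ⬝ᵥ e i) - 1 / 4 * sqNorm (M *ᵥ z i)
      - 4 * sqNorm (R i) + sqNorm (e i + R i) - (2 * ((T : ℝ)⁻¹ * sqNorm (Fᵀ *ᵥ e i))
        + 2 * sqNorm (R i))
      ≤ (P.ZstarVec T i (a i) ω - P.Xmat T i ω *ᵥ b i) ⬝ᵥ
      (M *ᵥ (P.ZstarVec T i (a i) ω - P.Xmat T i ω *ᵥ b i)) := by
    intro i
    have e1 : (P.ZstarVec T i (a i) ω - P.Xmat T i ω *ᵥ b i) ⬝ᵥ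
      (M *ᵥ (P.ZstarVec T i (a i) ω - P.Xmat T i ω *ᵥ b i)) = sqNorm (M *ᵥ z i)
        + 2 * ((M *ᵥ z i) ⬝ᵥ e i) + 2 * ((M *ᵥ z i) ⬝ᵥ R i)
        + (e i + R i) ⬝ᵥ (M *ᵥ (e i + R i)) := by
      rw [P.residual_eq]
      change (z i + (e i + R i)) ⬝ᵥ (M *ᵥ (z i + (e i + R i))) = _
      rw [Matrix.mulVec_add, add_dotProduct, dotProduct_add, dotProduct_add,
        dotProduct_annihilator_self hdet]
      have e2 : z i ⬝ᵥ (M *ᵥ (e i + R i)) = (M *ᵥ z i) ⬝ᵥ (e i + R i) := by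
        rw [← dotProduct_transpose_mulVec, hM, annihilator_transpose]
      rw [e2, dotProduct_comm (e i + R i) (M *ᵥ z i), dotProduct_add]
      ring
    have e3 : -(1 / 4 * sqNorm (M *ᵥ z i) + 4 * sqNorm (R i)) ≤ 2 * ((M *ᵥ z i) ⬝ᵥ R i) := by
      have := sqNorm_nonneg ((1 / 2 : ℝ) • (M *ᵥ z i) + (2 : ℝ) • R i)
      rw [sqNorm_eq_dotProduct] at this
      simp only [dotProduct_add, add_dotProduct, dotProduct_smul, smul_dotProduct, smul_eq_mul,
        ← sqNorm_eq_dotProduct, dotProduct_comm (R i)] at this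
      linarith
    have e4 : (T : ℝ)⁻¹ * sqNorm (Fᵀ *ᵥ (e i + R i))
        ≤ 2 * ((T : ℝ)⁻¹ * sqNorm (Fᵀ *ᵥ e i)) + 2 * sqNorm (R i) := by
      have h3 := sqNorm_add_le (Fᵀ *ᵥ e i) (Fᵀ *ᵥ R i)
      have h4 := hF.sqNorm_transpose_mulVec_le hT (R i)
      rw [Matrix.mulVec_add]
      have h5 := mul_le_mul_of_nonneg_left h3 (inv_nonneg.mpr (Nat.cast_nonneg (α := ℝ) T))
      linarith
    have e5 := hF.sqNorm_transpose_mulVec hT (e i + R i)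
    rw [e1, hM, e5]
    linarith
  have h3 := (Finset.sum_le_sum fun i (_ : i ∈ Finset.univ) => h2 i).trans
    (hmin'.trans (Finset.sum_le_sum fun i (_ : i ∈ Finset.univ) => h1 i))
  simp only [Finset.sum_add_distrib, Finset.sum_sub_distrib, ← Finset.mul_sum] at h3
  have h4 := P.sum_sqNorm_transpose_mulVec_errVec_le (N := N) hT ω hF
  rw [inv_mul_le_iff₀ hNT, ← Finset.mul_sum] at h4
  rw [signalLoss, firstStepLoss, ← sub_nonneg]
  have e5 : ∑ i : Fin N, -2 * ((M *ᵥ P.signal T i ω (b i)) ⬝ᵥ P.errVec T i ω)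
      = -2 * ∑ i, (M *ᵥ z i) ⬝ᵥ e i := by rw [← Finset.mul_sum]
  rw [e5]
  have e6 : ((N : ℝ) * T)⁻¹ * (-2 * ∑ i, (M *ᵥ z i) ⬝ᵥ e i)
      + 1 / 4 * (((N : ℝ) * T)⁻¹ * ∑ i, sqNorm (M *ᵥ z i)) + 2 * r * P.errGram N T ω
      + 6 * (((N : ℝ) * T)⁻¹ * ∑ i, sqNorm (R i)) - ((N : ℝ) * T)⁻¹ * ∑ i, sqNorm (M *ᵥ z i)
      = ((N : ℝ) * T)⁻¹ * (-2 * (∑ i, (M *ᵥ z i) ⬝ᵥ e i) + 1 / 4 * (∑ i, sqNorm (M *ᵥ z i))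
        + 2 * ((N : ℝ) * T * (r * P.errGram N T ω)) + 6 * (∑ i, sqNorm (R i))
        - ∑ i, sqNorm (M *ᵥ z i)) := by field_simp
  change 0 ≤ ((N : ℝ) * T)⁻¹ * (-2 * ∑ i, (M *ᵥ z i) ⬝ᵥ e i)
      + 1 / 4 * (((N : ℝ) * T)⁻¹ * ∑ i, sqNorm (M *ᵥ z i)) + 2 * r * P.errGram N T ω
      + 6 * (((N : ℝ) * T)⁻¹ * ∑ i, sqNorm (R i)) - ((N : ℝ) * T)⁻¹ * ∑ i, sqNorm (M *ᵥ z i)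
  rw [e6]
  refine mul_nonneg (by positivity) ?_
  linarith

/-- The columns of `X_i`, of the `X_j` with `j` in the tuple `I`, and of `F⁰`. -/
def designSpan (T i : ℕ) (ω : Ω) {m : ℕ} (I : Fin m → ℕ) : Submodule ℝ (Fin T → ℝ) :=
  Submodule.span ℝ (Set.range (Sum.elim (fun x : Option (Fin m) × Fin d =>
      (P.Xmat T (x.1.elim i I) ω)ᵀ x.2) fun k : Fin r => (P.Fmat T ω)ᵀ k))

lemma mulVec_mem_of_col_mem {T k : ℕ} {A : Matrix (Fin T) (Fin k) ℝ}
    {V : Submodule ℝ (Fin T → ℝ)} (h : ∀ j, Aᵀ j ∈ V) (v : Fin k → ℝ) : A *ᵥ v ∈ V := by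
  have : A *ᵥ v = ∑ j, v j • Aᵀ j := by
    ext t
    simp [Matrix.mulVec, dotProduct, mul_comm]
  rw [this]
  exact Submodule.sum_mem _ fun j _ => Submodule.smul_mem _ _ (h j)

lemma signal_mem_designSpan (T i : ℕ) (ω : Ω) {m : ℕ} (I : Fin m → ℕ) (x : Option (Fin m))
    (b : Fin d → ℝ) : P.signal T (x.elim i I) ω b ∈ P.designSpan T i ω I := by
  refine Submodule.add_mem _ (mulVec_mem_of_col_mem (fun j => ?_) _)
    (mulVec_mem_of_col_mem (fun j => ?_) _)
  · exact Submodule.subset_span ⟨Sum.inl (x, j), rfl⟩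
  · exact Submodule.subset_span ⟨Sum.inr j, rfl⟩

/-- Bound for the projected signal in terms of quantities that do not depend on the estimator. -/
lemma signalLoss_le {N T m : ℕ} (hN : 0 < N) (hT : 0 < T) {ω : Ω}
    (hF0 : IsUnit ((P.Fmat T ω)ᵀ * P.Fmat T ω).det) {a : ℕ → (Fin d → ℝ)}
    {b : Fin N → (Fin d → ℝ)} {F : Matrix (Fin T) (Fin r) ℝ}
    (h : P.IsLSMinimizer N T a ω b F) (p : Fin N → (Fin m → Fin N) → ℝ)
    (hp0 : ∀ i I, 0 ≤ p i I)
    (hp : ∀ (i : Fin N) (I : Fin m → Fin N), ∀ y ∈ P.designSpan T i ω (fun k => (I k : ℕ)),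
      (y ⬝ᵥ P.errVec T i ω) ^ 2 ≤ sqNorm y * p i I)
    {lam K : ℝ} (hlam : 0 < lam)
    (hK : (N : ℝ)⁻¹ * ∑ i : Fin N, (sqNorm (P.errVec T i ω) / T) ^ 2 ≤ K) :
    P.signalLoss N T ω b F ≤ 2 * (2 * lam * (r / (m + 1)) + 2 * K / lam
        + 4 * (12 + 8 * (m : ℝ) ^ 2) * (((N : ℝ) ^ (m + 1) * T)⁻¹ * (∑ i, ∑ I, p i I)
          + (m + r : ℕ) * P.errGram N T ω)
        + 2 * r * P.errGram N T ω + 6 * P.firstStepLoss N T ω a) := by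
  have h1 := P.signalLoss_le_of_isLSMinimizer hN hT hF0 h
  -- `W` involves the estimates, and with them the errors, but it is common to all units and has
  -- dimension at most `m + r`.
  let W : (Fin m → Fin N) → Submodule ℝ (Fin T → ℝ) := fun I =>
    Submodule.span ℝ (Set.range (Sum.elim (fun k => P.signal T (I k) ω (b (I k)))
      (fun j : Fin r => Fᵀ j)))
  have h2 := cross_term_le hN hT h.1 (fun i => P.signal T i ω (b i))
    (fun i => P.errVec T i ω) (fun i I => P.designSpan T i ω (fun k => (I k : ℕ)))
    (fun i I => P.signal_mem_designSpan T i ω _ none _)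
    (fun i I k => P.signal_mem_designSpan T i ω (fun k => (I k : ℕ)) (some k) _) p hp0 hp W
    (k := m + r)
    (fun I => (finrank_range_le_card _).trans (by simp))
    (fun I k => Submodule.subset_span (Set.mem_range.mpr ⟨Sum.inl k, rfl⟩))
    (fun I v => mulVec_mem_of_col_mem
      (fun j => Submodule.subset_span (Set.mem_range.mpr ⟨Sum.inr j, rfl⟩)) v)
    hlam hK
  -- One quarter of the signal pays for the first-step error and one for the cross term; the
  -- remaining half explains the factor `2`.
  rw [signalLoss, errGram] at *
  linarith

end Panel

/-! ### The rank condition -/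

section Perturbation

variable {T r d : ℕ}

/-- Schur complement: for `F` of full rank, singularity of `Xᵀ M_F X` is rank deficiency of `(F,
X)`, whose Gram determinant, unlike `M_F`, is polynomial in `F`. -/
lemma det_gram_fromCols {F : Matrix (Fin T) (Fin r) ℝ} (hF : IsUnit (Fᵀ * F).det)
    (X : Matrix (Fin T) (Fin d) ℝ) :
    ((Matrix.fromCols F X)ᵀ * Matrix.fromCols F X).det
      = (Fᵀ * F).det * (Xᵀ * annihilator F * X).det := by
  rw [Matrix.transpose_fromCols, Matrix.fromRows_mul_fromCols]
  have : Invertible (Fᵀ * F) := Matrix.invertibleOfIsUnitDet _ hF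
  rw [Matrix.det_fromBlocks₁₁, Matrix.invOf_eq_nonsing_inv, annihilator]
  congr 2
  simp only [Matrix.mul_sub, Matrix.sub_mul, Matrix.mul_one, Matrix.mul_assoc]

/-- Along a line of matrices, the Gram determinant vanishes identically or only finitely often. -/
lemma finite_gram_det_eq_zero {ι κ : Type*} [Fintype ι] [Fintype κ] [DecidableEq κ]
    (A B : Matrix ι κ ℝ) (h : ((A + B)ᵀ * (A + B)).det ≠ 0) :
    {s : ℝ | ((A + s • B)ᵀ * (A + s • B)).det = 0}.Finite := by
  let W : Matrix ι κ (Polynomial ℝ) :=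
    A.map Polynomial.C + (Polynomial.X : Polynomial ℝ) • B.map Polynomial.C
  let q : Polynomial ℝ := (Wᵀ * W).det
  have hq : ∀ s : ℝ, q.eval s = ((A + s • B)ᵀ * (A + s • B)).det := by
    intro s
    have e : W.map (Polynomial.evalRingHom s) = A + s • B := by
      ext i j
      simp only [W, Matrix.map_apply, Matrix.add_apply, Matrix.smul_apply, smul_eq_mul,
        Polynomial.coe_evalRingHom, Polynomial.eval_add, Polynomial.eval_mul, Polynomial.eval_C, Polynomial.eval_X]
    change Polynomial.evalRingHom s (Wᵀ * W).det = _
    rw [RingHom.map_det, RingHom.mapMatrix_apply, Matrix.map_mul, ← e, Matrix.transpose_map]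
  have hq0 : q ≠ 0 := by
    intro h0
    have h1 := hq 1
    rw [h0, Polynomial.eval_zero, one_smul] at h1
    exact h h1.symm
  refine (Finset.finite_toSet q.roots.toFinset).subset fun s hs => ?_
  simp only [Finset.mem_coe, Multiset.mem_toFinset, Polynomial.mem_roots hq0, Polynomial.IsRoot.def]
  rw [hq]
  exact hs

lemma eventually_notMem_of_finite {S : Set ℝ} (hS : S.Finite) (x : ℝ) :
    ∀ᶠ s in 𝓝[≠] x, s ∉ S := by
  have h : (S \ {x})ᶜ ∈ 𝓝 x :=
    (hS.subset Set.sdiff_subset).isClosed.isOpen_compl.mem_nhds (by simp)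
  filter_upwards [nhdsWithin_le_nhds h, self_mem_nhdsWithin] with s hs hne hsS
  exact hs ⟨hsS, hne⟩

lemma continuousAt_annihilator_line (A B : Matrix (Fin T) (Fin r) ℝ)
    (h : IsUnit (Aᵀ * A).det) :
    ContinuousAt (fun s : ℝ => annihilator (A + s • B)) 0 := by
  have hc : Continuous fun s : ℝ => A + s • B := by fun_prop
  have hg : Continuous fun s : ℝ => (A + s • B)ᵀ * (A + s • B) :=
    hc.matrix_transpose.matrix_mul hc
  have hinv : ContinuousAt (fun s : ℝ => ((A + s • B)ᵀ * (A + s • B))⁻¹) 0 := by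
    simp only [Matrix.inv_def, Ring.inverse_eq_inv']
    refine ContinuousAt.smul (ContinuousAt.inv₀ hg.matrix_det.continuousAt ?_)
      hg.matrix_adjugate.continuousAt
    simpa using h.ne_zero
  unfold annihilator
  refine continuousAt_const.sub ?_
  have h1 : ContinuousAt (fun s : ℝ => (A + s • B) * ((A + s • B)ᵀ * (A + s • B))⁻¹) 0 := by
    have : Continuous fun p : Matrix (Fin T) (Fin r) ℝ × Matrix (Fin r) (Fin r) ℝ => p.1 * p.2 :=
      continuous_fst.matrix_mul continuous_snd
    exact this.continuousAt.comp (f := fun s : ℝ => (A + s • B, ((A + s • B)ᵀ * (A + s • B))⁻¹))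
      (hc.continuousAt.prodMk hinv)
  have : Continuous fun p : Matrix (Fin T) (Fin r) ℝ × Matrix (Fin r) (Fin T) ℝ => p.1 * p.2 :=
    continuous_fst.matrix_mul continuous_snd
  exact this.continuousAt.comp
    (f := fun s : ℝ => ((A + s • B) * ((A + s • B)ᵀ * (A + s • B))⁻¹, (A + s • B)ᵀ))
    (h1.prodMk hc.matrix_transpose.continuousAt)

end Perturbation

namespace Panel

variable {Ω : Type*} {d r : ℕ} (P : Panel Ω d r)

lemma Amat_congr (T i : ℕ) (ω : Ω) {F F' : Matrix (Fin T) (Fin r) ℝ}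
    (h : annihilator F = annihilator F') : P.Amat T i ω F = P.Amat T i ω F' := by
  rw [Amat, Amat, h]

lemma Amat_posSemidef (T i : ℕ) (ω : Ω) {F : Matrix (Fin T) (Fin r) ℝ}
    (hF : IsUnit (Fᵀ * F).det) : (P.Amat T i ω F).PosSemidef := by
  have : P.Amat T i ω F = (T : ℝ)⁻¹ •
      ((annihilator F * P.Xmat T i ω)ᵀ * (annihilator F * P.Xmat T i ω)) := by
    rw [Amat, Matrix.transpose_mul, annihilator_transpose, Matrix.mul_assoc, Matrix.mul_assoc,
      ← Matrix.mul_assoc (annihilator F), annihilator_mul_annihilator hF]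
  rw [this]
  exact (posSemidef_transpose_mul_self _).smul (by positivity)

lemma dotProduct_Amat_mulVec (T i : ℕ) (ω : Ω) {F : Matrix (Fin T) (Fin r) ℝ}
    (hF : IsUnit (Fᵀ * F).det) (v : Fin d → ℝ) :
    v ⬝ᵥ (P.Amat T i ω F *ᵥ v)
      = (T : ℝ)⁻¹ * sqNorm (annihilator F *ᵥ (P.Xmat T i ω *ᵥ v)) := by
  rw [Amat, Matrix.smul_mulVec, dotProduct_smul, smul_eq_mul, ← Matrix.mulVec_mulVec,
    ← Matrix.mulVec_mulVec, dotProduct_transpose_mulVec, dotProduct_annihilator_self hF]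

/-- The vector `T^{-1/2} vec(M_F F⁰)`. -/
def vecResid (T : ℕ) (ω : Ω) (F : Matrix (Fin T) (Fin r) ℝ) : Fin r × Fin T → ℝ :=
  fun kt => (Real.sqrt T)⁻¹ * (annihilator F * P.Fmat T ω) kt.2 kt.1

lemma sqNorm_vecResid (T : ℕ) (ω : Ω) (F : Matrix (Fin T) (Fin r) ℝ) :
    sqNorm (P.vecResid T ω F) = (T : ℝ)⁻¹ * frobSq (annihilator F * P.Fmat T ω) := by
  simp only [sqNorm, vecResid, frobSq, mul_pow, inv_pow, Real.sq_sqrt (Nat.cast_nonneg (α := ℝ) T),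
    ← Finset.mul_sum]
  rw [Fintype.sum_prod_type_right]

/-- Completing the square: the Schur complement `E_i(F)` bounds the projected signal. -/
lemma dotProduct_Emat_mulVec_le (T i : ℕ) (ω : Ω) {F : Matrix (Fin T) (Fin r) ℝ}
    (hF : IsUnit (Fᵀ * F).det) (hA : IsUnit (P.Amat T i ω F).det) (b : Fin d → ℝ) :
    P.vecResid T ω F ⬝ᵥ (P.Emat T i ω F *ᵥ P.vecResid T ω F)
      ≤ (T : ℝ)⁻¹ * sqNorm (annihilator F *ᵥ P.signal T i ω b) := by
  set v := P.vecResid T ω F with hv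
  set A := P.Amat T i ω F with hAdef
  set C := P.Cmat T i ω F with hC
  set M := annihilator F with hM
  set κ := (Real.sqrt T)⁻¹ with hκ
  have hκ2 : κ ^ 2 = (T : ℝ)⁻¹ := by rw [hκ, inv_pow, Real.sq_sqrt (Nat.cast_nonneg _)]
  set w : Fin T → ℝ := κ • (M *ᵥ (P.Fmat T ω *ᵥ P.lam i)) with hw
  set u : Fin T → ℝ := κ • (M *ᵥ (P.Xmat T i ω *ᵥ (P.β i - b))) with hu
  set g := Cᵀ *ᵥ v with hg
  set x := P.β i - b with hx
  have hwt : ∀ t, w t = ∑ k, P.lam i k * v (k, t) := by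
    intro t
    simp only [hw, hv, vecResid, Pi.smul_apply, smul_eq_mul, Matrix.mulVec_mulVec, Matrix.mulVec,
      dotProduct, Finset.mul_sum]
    exact Finset.sum_congr rfl fun k _ => by ring
  have hB : v ⬝ᵥ (P.Bmat T i *ᵥ v) = sqNorm w := by
    have h1 : ∀ kt : Fin r × Fin T, (P.Bmat T i *ᵥ v) kt = P.lam i kt.1 * w kt.2 := by
      rintro ⟨k, t⟩
      simp only [Bmat, Matrix.mulVec, dotProduct, Fintype.sum_prod_type, Matrix.kroneckerMap_apply,
        Matrix.vecMulVec_apply, Matrix.one_apply, hwt, Finset.mul_sum]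
      refine Finset.sum_congr rfl fun k' _ => ?_
      simp [mul_assoc]
    simp only [dotProduct, h1]
    rw [Fintype.sum_prod_type_right, sqNorm]
    refine Finset.sum_congr rfl fun t _ => ?_
    rw [sq]
    nth_rw 2 [hwt]
    rw [Finset.mul_sum]
    exact Finset.sum_congr rfl fun k _ => by ring
  have hgu : x ⬝ᵥ g = u ⬝ᵥ w := by
    have h1 : g = κ • ((M * P.Xmat T i ω)ᵀ *ᵥ w) := by
      ext a
      simp only [hg, hC, Cmat, Matrix.mulVec, dotProduct, Matrix.transpose_apply, Matrix.of_apply,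
        Pi.smul_apply, smul_eq_mul, hwt, Finset.mul_sum]
      rw [Fintype.sum_prod_type_right]
      exact Finset.sum_congr rfl fun t _ => Finset.sum_congr rfl fun k _ => by ring
    rw [h1, dotProduct_smul, dotProduct_transpose_mulVec, hu, smul_dotProduct,
      Matrix.mulVec_mulVec]
  have hE : v ⬝ᵥ (P.Emat T i ω F *ᵥ v) = sqNorm w - g ⬝ᵥ (A⁻¹ *ᵥ g) := by
    rw [Emat, Matrix.sub_mulVec, dotProduct_sub, hB, ← Matrix.mulVec_mulVec, ← Matrix.mulVec_mulVec,
      ← hg]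
    congr 1
    have := dotProduct_transpose_mulVec Cᵀ v (A⁻¹ *ᵥ g)
    rwa [Matrix.transpose_transpose] at this
  have hS : (T : ℝ)⁻¹ * sqNorm (M *ᵥ P.signal T i ω b) = sqNorm u + 2 * (u ⬝ᵥ w) + sqNorm w := by
    have h1 : κ • (M *ᵥ P.signal T i ω b) = u + w := by
      rw [signal, Matrix.mulVec_add, smul_add]
    rw [← hκ2, ← sqNorm_smul, h1]
    simp only [sqNorm_eq_dotProduct, add_dotProduct, dotProduct_add, dotProduct_comm w u]
    ring
  have huA : sqNorm u = x ⬝ᵥ (A *ᵥ x) := by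
    rw [hu, sqNorm_smul, hκ2, hAdef, P.dotProduct_Amat_mulVec T i ω hF]
  have hpsd := P.Amat_posSemidef T i ω hF
  have hsymm : Aᵀ = A := by
    have := hpsd.isHermitian.eq
    rwa [Matrix.conjTranspose_eq_transpose_of_trivial] at this
  -- The scaled squared norm is `xᵀAx + 2 xᵀg + ‖w‖²`, minimal at `x = -A⁻¹g`; this is the square
  -- completed there.
  have hsq : 0 ≤ (x + A⁻¹ *ᵥ g) ⬝ᵥ (A *ᵥ (x + A⁻¹ *ᵥ g)) := by
    simpa using hpsd.dotProduct_mulVec_nonneg (x + A⁻¹ *ᵥ g)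
  have e1 : A *ᵥ (A⁻¹ *ᵥ g) = g := by
    rw [Matrix.mulVec_mulVec, Matrix.mul_nonsing_inv _ hA, Matrix.one_mulVec]
  have e2 : (A⁻¹ *ᵥ g) ⬝ᵥ (A *ᵥ x) = x ⬝ᵥ g := by
    rw [dotProduct_comm, ← dotProduct_transpose_mulVec, hsymm, e1]
  rw [Matrix.mulVec_add, e1, add_dotProduct, dotProduct_add, dotProduct_add, e2,
    dotProduct_comm (A⁻¹ *ᵥ g)] at hsq
  rw [hE, hS, huA, ← hgu]
  linarith

lemma sum_Emat_le {N T : ℕ} {ω : Ω} {F : Matrix (Fin T) (Fin r) ℝ}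
    (hF : IsUnit (Fᵀ * F).det) (hA : ∀ i < N, IsUnit (P.Amat T i ω F).det)
    (b : Fin N → (Fin d → ℝ)) :
    P.vecResid T ω F ⬝ᵥ
        (((N : ℝ)⁻¹ • ∑ i ∈ Finset.range N, P.Emat T i ω F) *ᵥ P.vecResid T ω F)
      ≤ P.signalLoss N T ω b F := by
  have e : P.vecResid T ω F ⬝ᵥ
        (((N : ℝ)⁻¹ • ∑ i ∈ Finset.range N, P.Emat T i ω F) *ᵥ P.vecResid T ω F)
      = (N : ℝ)⁻¹ * ∑ i : Fin N, P.vecResid T ω F ⬝ᵥ (P.Emat T i ω F *ᵥ P.vecResid T ω F) := by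
    rw [Matrix.smul_mulVec, dotProduct_smul, smul_eq_mul, Matrix.sum_mulVec, dotProduct_sum,
      Finset.sum_range]
  rw [e, signalLoss, mul_inv, mul_assoc, Finset.mul_sum (a := (T : ℝ)⁻¹)]
  exact mul_le_mul_of_nonneg_left (Finset.sum_le_sum fun i _ =>
    P.dotProduct_Emat_mulVec_le T i ω hF (hA i i.2) (b i)) (by positivity)

/-- The rank condition bounds `‖M_F F⁰‖²` by the projected signal, for every normalized `F`,
including those for which some `A_i(F)` is singular. -/
lemma frobSq_annihilator_mul_Fmat_le {N T : ℕ} (hT : 0 < T) {ω : Ω} {c : ℝ}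
    (hF0 : IsUnit ((P.Fmat T ω)ᵀ * P.Fmat T ω).det)
    (hA0 : ∀ i < N, IsUnit (P.Amat T i ω (P.Fmat T ω)).det)
    (hschur : ∀ F : Matrix (Fin T) (Fin r) ℝ, IsNormalized F →
      (∀ i < N, IsUnit (P.Amat T i ω F).det) →
      ∀ v : Fin r × Fin T → ℝ,
        c * sqNorm v ≤ v ⬝ᵥ (((N : ℝ)⁻¹ • ∑ i ∈ Finset.range N, P.Emat T i ω F) *ᵥ v))
    {F : Matrix (Fin T) (Fin r) ℝ} (hF : IsNormalized F) (b : Fin N → (Fin d → ℝ)) :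
    c * ((T : ℝ)⁻¹ * frobSq (annihilator F * P.Fmat T ω)) ≤ P.signalLoss N T ω b F := by
  have hT' : (T : ℝ) ≠ 0 := by positivity
  set F0 := P.Fmat T ω with hF0def
  have hFdet := hF.isUnit_det hT
  -- The line from `F` to `F⁰`: at `s = 1` every `A_i` is invertible, so the polynomial Gram
  -- determinants vanish only finitely often. The inequality therefore holds for small `s ≠ 0` and
  -- passes to the limit `s → 0`.
  set L : ℝ → Matrix (Fin T) (Fin r) ℝ := fun s => F + s • (F0 - F) with hL
  have hL0 : L 0 = F := by simp [hL]
  have hcont := continuousAt_annihilator_line F (F0 - F) hFdet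
  have hev1 : ∀ᶠ s in 𝓝[≠] (0 : ℝ), IsUnit ((L s)ᵀ * L s).det := by
    have hc : Continuous fun s : ℝ => L s := by fun_prop
    have : ∀ᶠ s in 𝓝 (0 : ℝ), ((L s)ᵀ * L s).det ≠ 0 :=
      (hc.matrix_transpose.matrix_mul hc).matrix_det.continuousAt.eventually_ne
        (by rw [hL0]; exact hFdet.ne_zero)
    filter_upwards [nhdsWithin_le_nhds this] with s hs using hs.isUnit
  have hev2 : ∀ᶠ s in 𝓝[≠] (0 : ℝ), ∀ i ∈ Finset.range N,
      ((Matrix.fromCols (L s) (P.Xmat T i ω))ᵀ * Matrix.fromCols (L s) (P.Xmat T i ω)).det ≠ 0 := by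
    rw [Filter.eventually_all_finset]
    intro i hi
    have e : ∀ s, Matrix.fromCols (L s) (P.Xmat T i ω) = Matrix.fromCols F (P.Xmat T i ω)
        + s • Matrix.fromCols (F0 - F) (0 : Matrix (Fin T) (Fin d) ℝ) := by
      intro s
      ext t (j | j) <;> simp [hL]
    refine (eventually_notMem_of_finite (finite_gram_det_eq_zero (Matrix.fromCols F (P.Xmat T i ω))
      (Matrix.fromCols (F0 - F) (0 : Matrix (Fin T) (Fin d) ℝ)) ?_) 0).mono fun s hs => ?_
    · have h1 := e 1
      rw [one_smul] at h1
      have hL1 : L 1 = F0 := by simp [hL]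
      rw [← h1, hL1, det_gram_fromCols hF0]
      refine mul_ne_zero hF0.ne_zero ?_
      have h2 := (hA0 i (Finset.mem_range.mp hi)).ne_zero
      rw [Amat, Matrix.det_smul] at h2
      exact right_ne_zero_of_mul h2
    · rw [e]
      exact hs
  have hineq : ∀ᶠ s in 𝓝[≠] (0 : ℝ), c * ((T : ℝ)⁻¹ * frobSq (annihilator (L s) * F0))
      ≤ P.signalLoss N T ω b (L s) := by
    filter_upwards [hev1, hev2] with s hs1 hs2
    -- The rank condition concerns normalized matrices, but the resulting inequality contains only
    -- the annihilator and so returns to `L s`.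
    obtain ⟨H, -, hH1, hH2⟩ := exists_isNormalized hT hs1
    have hA : ∀ i < N, IsUnit (P.Amat T i ω (L s * H)).det := by
      intro i hi
      rw [P.Amat_congr T i ω hH2, Amat, Matrix.det_smul]
      have := hs2 i (Finset.mem_range.mpr hi)
      rw [det_gram_fromCols hs1] at this
      exact (mul_ne_zero (pow_ne_zero _ (inv_ne_zero hT')) (right_ne_zero_of_mul this)).isUnit
    have h1 := (hschur _ hH1 hA (P.vecResid T ω (L s * H))).trans
      (P.sum_Emat_le (hH1.isUnit_det hT) hA b)
    rw [sqNorm_vecResid, signalLoss, hH2] at h1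
    exact h1
  have hcont' : Tendsto (fun s => annihilator (L s)) (𝓝[≠] 0) (𝓝 (annihilator F)) := by
    have := hcont.tendsto.mono_left (nhdsWithin_le_nhds (s := {0}ᶜ))
    simpa using this
  refine le_of_tendsto_of_tendsto ?_ ?_ hineq
  · have : Continuous fun M : Matrix (Fin T) (Fin T) ℝ => c * ((T : ℝ)⁻¹ * frobSq (M * F0)) := by
      unfold frobSq
      have h1 : Continuous fun M : Matrix (Fin T) (Fin T) ℝ => M * F0 :=
        continuous_id.matrix_mul continuous_const
      have h2 : ∀ i j, Continuous fun M : Matrix (Fin T) (Fin T) ℝ => (M * F0) i j :=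
        fun i j => h1.matrix_elem i j
      fun_prop
    exact (this.tendsto _).comp hcont'
  · have : Continuous fun M : Matrix (Fin T) (Fin T) ℝ => ((N : ℝ) * T)⁻¹ *
        ∑ i : Fin N, sqNorm (M *ᵥ P.signal T i ω (b i)) := by
      unfold sqNorm
      have h2 : ∀ (i : Fin N) (t : Fin T), Continuous fun M : Matrix (Fin T) (Fin T) ℝ =>
          (M *ᵥ P.signal T i ω (b i)) t := by
        intro i t
        unfold Matrix.mulVec dotProduct
        exact continuous_finsetSum _ fun j _ => (continuous_id.matrix_elem t j).mul continuous_const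
      fun_prop
    exact (this.tendsto _).comp hcont'

end Panel

/-! ### From the projected signal to the parameters -/

section TwoProjections

variable {T r : ℕ}

lemma frobSq_annihilator_mul {k : ℕ} {F : Matrix (Fin T) (Fin r) ℝ} (hF : IsNormalized F)
    (hT : 0 < T) (B : Matrix (Fin T) (Fin k) ℝ) :
    frobSq (annihilator F * B) = frobSq B - (T : ℝ)⁻¹ * frobSq (Fᵀ * B) := by
  rw [frobSq_eq_sum_sqNorm_col, frobSq_eq_sum_sqNorm_col B, frobSq_eq_sum_sqNorm_col (Fᵀ * B),
    Finset.mul_sum, ← Finset.sum_sub_distrib]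
  refine Finset.sum_congr rfl fun j _ => ?_
  have h1 := hF.sqNorm_transpose_mulVec hT (Bᵀ j)
  rw [dotProduct_annihilator_self (hF.isUnit_det hT)] at h1
  exact h1

lemma IsNormalized.frobSq_eq {F : Matrix (Fin T) (Fin r) ℝ} (hF : IsNormalized F) :
    frobSq F = T * r := by
  rw [frobSq_eq_trace, hF, Matrix.trace_smul, Matrix.trace_one, Fintype.card_fin, smul_eq_mul]

/-- Both sides equal `T r - T⁻¹ ‖FᵀF'‖²`: column spaces of equal dimension are equally far from each
other in either direction. -/
lemma frobSq_annihilator_mul_comm {F F' : Matrix (Fin T) (Fin r) ℝ} (hF : IsNormalized F)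
    (hF' : IsNormalized F') (hT : 0 < T) :
    frobSq (annihilator F * F') = frobSq (annihilator F' * F) := by
  rw [frobSq_annihilator_mul hF hT, frobSq_annihilator_mul hF' hT, hF.frobSq_eq, hF'.frobSq_eq,
    ← frobSq_transpose (Fᵀ * F'), Matrix.transpose_mul, Matrix.transpose_transpose]

/-- The distance of the column spaces of `F⁰` and of a normalized `F`. -/
lemma frobSq_annihilator_mul_le {F0 F : Matrix (Fin T) (Fin r) ℝ} (hT : 0 < T)
    (hF : IsNormalized F) (hF0 : IsUnit (F0ᵀ * F0).det) {c : ℝ} (hc : 0 < c)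
    (hmin : ∀ v, c * sqNorm v ≤ (T : ℝ)⁻¹ * sqNorm (F0 *ᵥ v)) :
    frobSq (annihilator F0 * F) ≤ frobSq (annihilator F * F0) * (r / c) := by
  have hT' : (T : ℝ) ≠ 0 := by positivity
  obtain ⟨H, -, hH1, hH2⟩ := exists_isNormalized hT hF0
  rw [← hH2, ← frobSq_annihilator_mul_comm hF hH1 hT, ← Matrix.mul_assoc]
  refine (frobSq_mul_le _ _).trans (mul_le_mul_of_nonneg_left ?_ (frobSq_nonneg _))
  rw [le_div_iff₀ hc, mul_comm, frobSq_eq_sum_sqNorm_col, Finset.mul_sum]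
  -- A column `h` of `H` satisfies `c ‖h‖² ≤ T⁻¹ ‖F⁰ h‖² = 1`, so `‖H‖² ≤ r / c`.
  have h1 : ∀ j : Fin r, c * sqNorm (Hᵀ j) ≤ 1 := by
    intro j
    refine (hmin (Hᵀ j)).trans (le_of_eq ?_)
    have h2 := hH1.sqNorm_mulVec (Pi.single j 1)
    have h3 : (F0 * H) *ᵥ Pi.single j 1 = F0 *ᵥ Hᵀ j := by
      rw [← Matrix.mulVec_mulVec, Matrix.mulVec_single_one]
      rfl
    have h4 : sqNorm (Pi.single j 1 : Fin r → ℝ) = 1 := by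
      rw [sqNorm_eq_dotProduct]; simp
    rw [← h3, h2, h4, mul_one, inv_mul_cancel₀ hT']
  refine (Finset.sum_le_sum fun j _ => h1 j).trans ?_
  simp

/-- Vectors that are nearly orthogonal to `F` are nearly orthogonal to `F⁰`. -/
lemma sqNorm_annihilator_mulVec_le_add {F0 F : Matrix (Fin T) (Fin r) ℝ} (hT : 0 < T)
    (hF : IsNormalized F) (hF0 : IsUnit (F0ᵀ * F0).det) (u : Fin T → ℝ) :
    sqNorm (annihilator F0 *ᵥ u) ≤ 2 * sqNorm (annihilator F *ᵥ u)
      + 2 * ((T : ℝ)⁻¹ * frobSq (annihilator F0 * F)) * sqNorm u := by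
  have hT' : (T : ℝ) ≠ 0 := by positivity
  -- Of the residual and the projection of `u` on `F`, only the projection meets the distance
  -- between the column spaces.
  have e : u = annihilator F *ᵥ u + F *ᵥ ((T : ℝ)⁻¹ • (Fᵀ *ᵥ u)) := by
    rw [hF.annihilator_mulVec hT]; abel
  have h1 : annihilator F0 *ᵥ u = annihilator F0 *ᵥ (annihilator F *ᵥ u)
      + (annihilator F0 * F) *ᵥ ((T : ℝ)⁻¹ • (Fᵀ *ᵥ u)) := by
    nth_rw 1 [e]
    rw [Matrix.mulVec_add, Matrix.mulVec_mulVec _ _ F]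
  rw [h1]
  refine (sqNorm_add_le _ _).trans (add_le_add ?_ ?_)
  · exact mul_le_mul_of_nonneg_left (sqNorm_annihilator_mulVec_le hF0 _) (by norm_num)
  · have h2 := sqNorm_mulVec_le (annihilator F0 * F) ((T : ℝ)⁻¹ • (Fᵀ *ᵥ u))
    rw [sqNorm_smul] at h2
    have h3 := mul_le_mul_of_nonneg_left (hF.sqNorm_transpose_mulVec_le hT u)
      (mul_nonneg (frobSq_nonneg (annihilator F0 * F)) (inv_nonneg.mpr (Nat.cast_nonneg (α := ℝ) T)))
    have e2 : frobSq (annihilator F0 * F) * (T : ℝ)⁻¹ * ((T : ℝ)⁻¹ * sqNorm (Fᵀ *ᵥ u))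
      = frobSq (annihilator F0 * F) * ((T : ℝ)⁻¹ ^ 2 * sqNorm (Fᵀ *ᵥ u)) := by ring
    linarith

end TwoProjections

/-! ### Deterministic bounds for rotation, slopes and loadings -/

namespace Panel

variable {Ω : Type*} {d r : ℕ} (P : Panel Ω d r)

/-- The squared distance `T⁻¹ ‖M_{F⁰} F‖²` of the column space of `F` from that of `F⁰`. -/
def factorDist (T : ℕ) (ω : Ω) (F : Matrix (Fin T) (Fin r) ℝ) : ℝ :=
  (T : ℝ)⁻¹ * frobSq (annihilator (P.Fmat T ω) * F)

lemma factorDist_nonneg (T : ℕ) (ω : Ω) (F : Matrix (Fin T) (Fin r) ℝ) :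
    0 ≤ P.factorDist T ω F := mul_nonneg (by positivity) (frobSq_nonneg _)

/-- `F⁰ G` is the projection of `F` on the columns of `F⁰`, so the factor error is exactly the
distance between the column spaces. -/
lemma annihilator_mul_eq_sub_rot (T : ℕ) (ω : Ω) (F : Matrix (Fin T) (Fin r) ℝ) :
    annihilator (P.Fmat T ω) * F = F - P.Fmat T ω * P.rot T ω F := by
  rw [annihilator, rot, Matrix.sub_mul, Matrix.one_mul]
  simp only [Matrix.mul_assoc]

lemma sqrt_inv_mul_frobNorm (T : ℕ) (ω : Ω) (F : Matrix (Fin T) (Fin r) ℝ) :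
    (Real.sqrt T)⁻¹ * frobNorm (F - P.Fmat T ω * P.rot T ω F)
      = Real.sqrt (P.factorDist T ω F) := by
  rw [factorDist, Real.sqrt_mul (by positivity), Real.sqrt_inv, ← annihilator_mul_eq_sub_rot,
    frobNorm_eq]

lemma sqNorm_sub_rot_mulVec_le (T : ℕ) (ω : Ω) (F : Matrix (Fin T) (Fin r) ℝ) (w : Fin r → ℝ) :
    (T : ℝ)⁻¹ * sqNorm ((annihilator (P.Fmat T ω) * F) *ᵥ w) ≤ P.factorDist T ω F * sqNorm w := by
  rw [factorDist, mul_assoc]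
  exact mul_le_mul_of_nonneg_left (sqNorm_mulVec_le _ _) (by positivity)

/-- A null vector `v` of `G` would give `M_{F⁰} F v = F v`, of squared norm `T ‖v‖²`, which a
distance below one excludes. -/
lemma isUnit_det_rot {T : ℕ} (hT : 0 < T) {ω : Ω} {F : Matrix (Fin T) (Fin r) ℝ}
    (hF : IsNormalized F) (h : P.factorDist T ω F < 1) : IsUnit (P.rot T ω F).det := by
  have hT' : (T : ℝ) ≠ 0 := by positivity
  by_contra hdet
  rw [isUnit_iff_ne_zero, not_not] at hdet
  obtain ⟨v, hv, hv0⟩ := Matrix.exists_mulVec_eq_zero_iff.mpr hdet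
  have h1 : (annihilator (P.Fmat T ω) * F) *ᵥ v = F *ᵥ v := by
    rw [annihilator_mul_eq_sub_rot, Matrix.sub_mulVec, ← Matrix.mulVec_mulVec, hv0,
      Matrix.mulVec_zero, sub_zero]
  have h2 := P.sqNorm_sub_rot_mulVec_le T ω F v
  rw [h1, hF.sqNorm_mulVec, ← mul_assoc, inv_mul_cancel₀ hT', one_mul] at h2
  have h3 : 0 < sqNorm v := (sqNorm_nonneg v).lt_of_ne fun h => hv (sqNorm_eq_zero.mp h.symm)
  nlinarith

lemma sqNorm_Xmat_mulVec_le {T i : ℕ} (hT : 0 < T) {ω : Ω} {C : ℝ}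
    (hC : (T : ℝ)⁻¹ * ∑ t : Fin T, sqNorm (P.X i t ω) ^ 2 ≤ C) (v : Fin d → ℝ) :
    (T : ℝ)⁻¹ * sqNorm (P.Xmat T i ω *ᵥ v) ≤ (1 + C) * sqNorm v := by
  have hT' : (0 : ℝ) < T := by exact_mod_cast hT
  have h1 : frobSq (P.Xmat T i ω) ≤ ∑ t : Fin T, (1 + sqNorm (P.X i t ω) ^ 2) := by
    refine Finset.sum_le_sum fun t _ => ?_
    change sqNorm (P.X i t ω) ≤ _
    nlinarith [sq_nonneg (sqNorm (P.X i t ω) - 1), sq_nonneg (sqNorm (P.X i t ω))]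
  rw [Finset.sum_add_distrib] at h1
  simp only [Finset.sum_const, Finset.card_univ, Fintype.card_fin, nsmul_eq_mul, mul_one] at h1
  have h2 : (T : ℝ)⁻¹ * frobSq (P.Xmat T i ω) ≤ 1 + C := by
    refine (mul_le_mul_of_nonneg_left h1 (inv_nonneg.mpr hT'.le)).trans ?_
    rw [mul_add, inv_mul_cancel₀ hT'.ne']
    linarith
  refine (mul_le_mul_of_nonneg_left (sqNorm_mulVec_le _ v) (inv_nonneg.mpr hT'.le)).trans ?_
  rw [← mul_assoc]
  exact mul_le_mul_of_nonneg_right h2 (sqNorm_nonneg _)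

/-- Mean squared error of the slopes. -/
lemma slope_loss_le {N T : ℕ} (hN : 0 < N) (hT : 0 < T) {ω : Ω} {F : Matrix (Fin T) (Fin r) ℝ}
    (hF : IsNormalized F) (hF0 : IsUnit ((P.Fmat T ω)ᵀ * P.Fmat T ω).det) {c C L : ℝ} (hc : 0 < c)
    (hA : ∀ i < N, ∀ v, c * sqNorm v ≤ v ⬝ᵥ (P.Amat T i ω (P.Fmat T ω) *ᵥ v))
    (hC : ∀ i < N, (T : ℝ)⁻¹ * ∑ t : Fin T, sqNorm (P.X i t ω) ^ 2 ≤ C)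
    (hL : ∀ i, sqNorm (P.lam i) ≤ L)
    (hdist : 4 * (1 + C) * P.factorDist T ω F ≤ c) (b : Fin N → (Fin d → ℝ)) :
    (N : ℝ)⁻¹ * ∑ i : Fin N, sqNorm (b i - P.β i) ≤ 8 / c * (P.signalLoss N T ω b F
      + L * ((T : ℝ)⁻¹ * frobSq (annihilator F * P.Fmat T ω))) := by
  have hT' : (0 : ℝ) < T := by exact_mod_cast hT
  have hN' : (0 : ℝ) < N := by exact_mod_cast hN
  set g := (T : ℝ)⁻¹ * frobSq (annihilator F * P.Fmat T ω) with hg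
  have hg0 : 0 ≤ g := mul_nonneg (by positivity) (frobSq_nonneg _)
  have hpt : ∀ i : Fin N, c / 8 * sqNorm (b i - P.β i) ≤
      (T : ℝ)⁻¹ * sqNorm (annihilator F *ᵥ P.signal T i ω (b i)) + L * g := by
    intro i
    set x := P.β i - b i with hx
    have hx' : sqNorm (b i - P.β i) = sqNorm x := by rw [hx, ← sqNorm_neg, neg_sub]
    set u := P.Xmat T i ω *ᵥ x with hu
    have h1 := hA i i.2 x
    rw [P.dotProduct_Amat_mulVec T i ω hF0] at h1
    -- The eigenvalue bound concerns `M_{F⁰}`, the signal bound `M_F`. The exchange costs a multiple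
    -- of the distance, and `hdist` lets half of the left side absorb it.
    have h2 := mul_le_mul_of_nonneg_left (sqNorm_annihilator_mulVec_le_add hT hF hF0 u)
      (inv_nonneg.mpr hT'.le)
    have h3 := P.sqNorm_Xmat_mulVec_le hT (hC i i.2) x
    have h4 : P.factorDist T ω F * ((T : ℝ)⁻¹ * sqNorm u)
        ≤ P.factorDist T ω F * ((1 + C) * sqNorm x) :=
      mul_le_mul_of_nonneg_left h3 (P.factorDist_nonneg T ω F)
    have h5 := mul_le_mul_of_nonneg_right hdist (sqNorm_nonneg x)
    have h6 : annihilator F *ᵥ u = annihilator F *ᵥ P.signal T i ω (b i)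
        - (annihilator F * P.Fmat T ω) *ᵥ P.lam i := by
      rw [signal, Matrix.mulVec_add, ← Matrix.mulVec_mulVec (P.lam i), add_sub_cancel_right]
    have h7 := sqNorm_sub_le (annihilator F *ᵥ P.signal T i ω (b i))
      ((annihilator F * P.Fmat T ω) *ᵥ P.lam i)
    rw [← h6] at h7
    have h8 := (sqNorm_mulVec_le (annihilator F * P.Fmat T ω) (P.lam i)).trans
      (mul_le_mul_of_nonneg_left (hL i) (frobSq_nonneg _))
    have h9 := mul_le_mul_of_nonneg_left (h7.trans (add_le_add le_rfl
      (mul_le_mul_of_nonneg_left h8 (by norm_num)))) (inv_nonneg.mpr hT'.le)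
    have e1 : (T : ℝ)⁻¹ * (2 * sqNorm (annihilator F *ᵥ u)
        + 2 * ((T : ℝ)⁻¹ * frobSq (annihilator (P.Fmat T ω) * F)) * sqNorm u)
        = 2 * ((T : ℝ)⁻¹ * sqNorm (annihilator F *ᵥ u))
          + 2 * (P.factorDist T ω F * ((T : ℝ)⁻¹ * sqNorm u)) := by
      rw [factorDist]; ring
    have e2 : (T : ℝ)⁻¹ * (2 * sqNorm (annihilator F *ᵥ P.signal T i ω (b i))
        + 2 * (frobSq (annihilator F * P.Fmat T ω) * L))
        = 2 * ((T : ℝ)⁻¹ * sqNorm (annihilator F *ᵥ P.signal T i ω (b i))) + 2 * (L * g) := by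
      rw [hg]; ring
    rw [e1] at h2
    rw [e2] at h9
    rw [hx']
    linarith
  have hsum := Finset.sum_le_sum fun i (_ : i ∈ Finset.univ) => hpt i
  simp only [Finset.sum_add_distrib, ← Finset.mul_sum, Finset.sum_const, Finset.card_univ,
    Fintype.card_fin, nsmul_eq_mul] at hsum
  rw [inv_mul_le_iff₀ hN', signalLoss]
  have e : N * (8 / c * (((N : ℝ) * T)⁻¹ * (∑ i : Fin N, sqNorm (annihilator F *ᵥ P.signal T i ω (b i)))
      + L * g)) = 8 / c * ((T : ℝ)⁻¹ * (∑ i : Fin N, sqNorm (annihilator F *ᵥ P.signal T i ω (b i)))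
      + N * (L * g)) := by field_simp
  have e' : L * (N * g) = N * (L * g) := by ring
  rw [e'] at hsum
  rw [e]
  calc ∑ i : Fin N, sqNorm (b i - P.β i)
      = 8 / c * (c / 8 * ∑ i : Fin N, sqNorm (b i - P.β i)) := by field_simp
    _ ≤ _ := mul_le_mul_of_nonneg_left hsum (by positivity)

/-- Mean squared error of the loadings, in the rotated coordinates. -/
lemma loading_loss_le {N T : ℕ} (hN : 0 < N) (hT : 0 < T) {ω : Ω} {F : Matrix (Fin T) (Fin r) ℝ}
    (hF : IsNormalized F) {C L KF : ℝ}
    (hC : ∀ i < N, (T : ℝ)⁻¹ * ∑ t : Fin T, sqNorm (P.X i t ω) ^ 2 ≤ C)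
    (hL : ∀ i, sqNorm (P.lam i) ≤ L) (hKF : (T : ℝ)⁻¹ * frobSq (P.Fmat T ω) ≤ KF)
    (hdist : 4 * P.factorDist T ω F ≤ 1) (a : ℕ → (Fin d → ℝ)) (b : Fin N → (Fin d → ℝ)) :
    (N : ℝ)⁻¹ * ∑ i : Fin N, sqNorm (P.lamEst T i (a i) ω (b i) F - (P.rot T ω F)⁻¹ *ᵥ P.lam i)
      ≤ 4 * (1 + C) * ((N : ℝ)⁻¹ * ∑ i : Fin N, sqNorm (b i - P.β i))
        + 16 * KF * L * P.factorDist T ω F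
        + 4 * (r * P.errGram N T ω) + 4 * P.firstStepLoss N T ω a := by
  have hT' : (0 : ℝ) < T := by exact_mod_cast hT
  have hN' : (0 : ℝ) < N := by exact_mod_cast hN
  have hdet : IsUnit (P.rot T ω F).det := P.isUnit_det_rot hT hF (by linarith)
  have hf0 := P.factorDist_nonneg T ω F
  have hproj : ∀ y : Fin T → ℝ, sqNorm ((T : ℝ)⁻¹ • (Fᵀ *ᵥ y)) ≤ (T : ℝ)⁻¹ * sqNorm y := by
    intro y
    rw [sqNorm_smul, sq, mul_assoc]
    exact mul_le_mul_of_nonneg_left (hF.sqNorm_transpose_mulVec_le hT y) (by positivity)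
  have hpt : ∀ i : Fin N, sqNorm (P.lamEst T i (a i) ω (b i) F - (P.rot T ω F)⁻¹ *ᵥ P.lam i)
      ≤ 4 * (1 + C) * sqNorm (b i - P.β i) + 16 * KF * L * P.factorDist T ω F
        + 4 * ((T : ℝ)⁻¹ * ((T : ℝ)⁻¹ * sqNorm (Fᵀ *ᵥ P.errVec T i ω)))
        + 4 * ((T : ℝ)⁻¹ * sqNorm (P.firstStepErr T i (a i) ω)) := by
    intro i
    set w := (P.rot T ω F)⁻¹ *ᵥ P.lam i with hw
    set x := P.β i - b i with hx
    have hx' : sqNorm (b i - P.β i) = sqNorm x := by rw [hx, ← sqNorm_neg, neg_sub]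
    set D := (annihilator (P.Fmat T ω) * F) *ᵥ w with hD
    have hlam : P.rot T ω F *ᵥ w = P.lam i := by
      rw [hw, Matrix.mulVec_mulVec, Matrix.mul_nonsing_inv _ hdet, Matrix.one_mulVec]
    -- `F⁰ λ_i = F⁰ G w` is `F w` up to the component `D` of `F w` orthogonal to `F⁰`.
    have hF0lam : P.Fmat T ω *ᵥ P.lam i = F *ᵥ w - D := by
      rw [hD, annihilator_mul_eq_sub_rot, Matrix.sub_mulVec, ← Matrix.mulVec_mulVec, hlam]
      abel
    have hFw : (T : ℝ)⁻¹ • (Fᵀ *ᵥ (F *ᵥ w)) = w := by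
      rw [Matrix.mulVec_mulVec, hF, Matrix.smul_mulVec, Matrix.one_mulVec, smul_smul,
        inv_mul_cancel₀ hT'.ne', one_smul]
    have e1 : P.lamEst T i (a i) ω (b i) F - w
        = ((T : ℝ)⁻¹ • (Fᵀ *ᵥ (P.Xmat T i ω *ᵥ x)) - (T : ℝ)⁻¹ • (Fᵀ *ᵥ D))
          + ((T : ℝ)⁻¹ • (Fᵀ *ᵥ P.errVec T i ω) + (T : ℝ)⁻¹ • (Fᵀ *ᵥ P.firstStepErr T i (a i) ω)) := by
      rw [lamEst, P.residual_eq, signal, hF0lam]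
      simp only [Matrix.mulVec_add, Matrix.mulVec_sub Fᵀ, smul_add, smul_sub, hFw]
      abel
    have hD1 : (T : ℝ)⁻¹ * sqNorm D ≤ P.factorDist T ω F * sqNorm w :=
      P.sqNorm_sub_rot_mulVec_le T ω F w
    -- No bound for `G⁻¹` is at hand. Instead `‖w‖² = T⁻¹ ‖F w‖²` is bounded through `F⁰ λ_i` and
    -- `D`, and the share of `D` is at most half of `‖w‖²`.
    have hw1 : sqNorm w ≤ 4 * KF * L := by
      have h1 : sqNorm w = (T : ℝ)⁻¹ * sqNorm (P.Fmat T ω *ᵥ P.lam i + D) := by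
        rw [hF0lam, sub_add_cancel, hF.sqNorm_mulVec, ← mul_assoc, inv_mul_cancel₀ hT'.ne', one_mul]
      have h2 := mul_le_mul_of_nonneg_left (sqNorm_add_le (P.Fmat T ω *ᵥ P.lam i) D)
        (inv_nonneg.mpr hT'.le)
      have h3 : (T : ℝ)⁻¹ * sqNorm (P.Fmat T ω *ᵥ P.lam i) ≤ KF * L := by
        have h4 := mul_le_mul_of_nonneg_left (sqNorm_mulVec_le (P.Fmat T ω) (P.lam i))
          (inv_nonneg.mpr hT'.le)
        rw [← mul_assoc] at h4
        refine h4.trans (mul_le_mul hKF (hL i) (sqNorm_nonneg _) ?_)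
        exact (mul_nonneg (by positivity) (frobSq_nonneg _)).trans hKF
      have h5 := mul_le_mul_of_nonneg_right hdist (sqNorm_nonneg w)
      linarith
    have h2 := P.sqNorm_Xmat_mulVec_le hT (hC i i.2) x
    have h3 := sqNorm_add_le ((T : ℝ)⁻¹ • (Fᵀ *ᵥ (P.Xmat T i ω *ᵥ x)) - (T : ℝ)⁻¹ • (Fᵀ *ᵥ D))
      ((T : ℝ)⁻¹ • (Fᵀ *ᵥ P.errVec T i ω) + (T : ℝ)⁻¹ • (Fᵀ *ᵥ P.firstStepErr T i (a i) ω))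
    have h4 := sqNorm_sub_le ((T : ℝ)⁻¹ • (Fᵀ *ᵥ (P.Xmat T i ω *ᵥ x))) ((T : ℝ)⁻¹ • (Fᵀ *ᵥ D))
    have h5 := sqNorm_add_le ((T : ℝ)⁻¹ • (Fᵀ *ᵥ P.errVec T i ω))
      ((T : ℝ)⁻¹ • (Fᵀ *ᵥ P.firstStepErr T i (a i) ω))
    have h6 := hproj (P.Xmat T i ω *ᵥ x)
    have h7 := hproj D
    have h8 := hproj (P.firstStepErr T i (a i) ω)
    have h9 : sqNorm ((T : ℝ)⁻¹ • (Fᵀ *ᵥ P.errVec T i ω))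
        = (T : ℝ)⁻¹ * ((T : ℝ)⁻¹ * sqNorm (Fᵀ *ᵥ P.errVec T i ω)) := by
      rw [sqNorm_smul, sq, mul_assoc]
    have h10 := mul_le_mul_of_nonneg_left hw1 hf0
    rw [e1, hx']
    linarith
  have hsum := Finset.sum_le_sum fun i (_ : i ∈ Finset.univ) => hpt i
  simp only [Finset.sum_add_distrib, ← Finset.mul_sum, Finset.sum_const, Finset.card_univ,
    Fintype.card_fin, nsmul_eq_mul] at hsum
  have h4 := P.sum_sqNorm_transpose_mulVec_errVec_le (N := N) hT ω hF
  have h5 := mul_le_mul_of_nonneg_left hsum (inv_nonneg.mpr hN'.le)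
  refine h5.trans ?_
  rw [firstStepLoss]
  rw [← Finset.mul_sum, mul_inv, mul_assoc] at h4
  have e : (N : ℝ)⁻¹ * (4 * (1 + C) * (∑ i : Fin N, sqNorm (b i - P.β i))
      + 16 * KF * L * (N * P.factorDist T ω F)
      + 4 * ((T : ℝ)⁻¹ * ((T : ℝ)⁻¹ * ∑ i : Fin N, sqNorm (Fᵀ *ᵥ P.errVec T i ω)))
      + 4 * ((T : ℝ)⁻¹ * ∑ i : Fin N, sqNorm (P.firstStepErr T i (a i) ω)))
      = 4 * (1 + C) * ((N : ℝ)⁻¹ * ∑ i : Fin N, sqNorm (b i - P.β i))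
        + 16 * KF * L * P.factorDist T ω F
        + 4 * ((N : ℝ)⁻¹ * ((T : ℝ)⁻¹ * ((T : ℝ)⁻¹ * ∑ i : Fin N, sqNorm (Fᵀ *ᵥ P.errVec T i ω))))
        + 4 * (((N : ℝ) * T)⁻¹ * ∑ i : Fin N, sqNorm (P.firstStepErr T i (a i) ω)) := by
    field_simp
  rw [e]
  linarith

end Panel

/-! ### Conditional second moments along random directions -/

/-- Conditional moments require directions that are measurable functions of regressors and factors.
Gram-Schmidt provides them by an explicit formula. -/
lemma measurable_gramSchmidt {Ω : Type*} {m : MeasurableSpace Ω} {T k : ℕ} {W : Fin k → Ω → EuclideanSpace ℝ (Fin T)}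
    (hW : ∀ j, Measurable (W j)) (n : Fin k) :
    Measurable fun ω => InnerProductSpace.gramSchmidt ℝ (fun j => W j ω) n := by
  induction n using WellFoundedLT.induction with
  | ind n ih =>
    simp only [InnerProductSpace.gramSchmidt_def ℝ _ n, Submodule.starProjection_singleton]
    refine (hW n).sub (Finset.measurable_sum _ fun i hi => ?_)
    have h1 := ih i (Finset.mem_Iio.mp hi)
    exact ((h1.inner (hW n)).div (h1.norm.pow_const 2)).smul h1

lemma measurable_gramSchmidtNormed {Ω : Type*} {m : MeasurableSpace Ω} {T k : ℕ}
    {W : Fin k → Ω → EuclideanSpace ℝ (Fin T)} (hW : ∀ j, Measurable (W j)) (n : Fin k) :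
    Measurable fun ω => InnerProductSpace.gramSchmidtNormed ℝ (fun j => W j ω) n := by
  have h1 := measurable_gramSchmidt hW n
  exact (h1.norm.inv).smul h1

section RandomDirections

variable {Ω : Type*} {m m0 : MeasurableSpace Ω} {μ : Measure Ω} [IsProbabilityMeasure μ]

/-- A bound for the conditional covariance matrix of `ε` given `m` bounds the second moment of
`⟨e, ε⟩` for every `m`-measurable random vector `e` in the unit ball. -/
lemma integral_dotProduct_sq_le (hm : m ≤ m0) {T : ℕ} {ε : Fin T → Ω → ℝ}
    (hε : ∀ t, MemLp (ε t) 2 μ) {M : ℝ} (hM : 0 ≤ M)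
    (hcond : ∀ v : Fin T → ℝ,
      μ[fun ω => (∑ t, v t * ε t ω) ^ 2 | m] ≤ᵐ[μ] fun _ => M * sqNorm v)
    {e : Fin T → Ω → ℝ} (he : ∀ t, Measurable[m] (e t)) (he1 : ∀ ω, sqNorm (fun t => e t ω) ≤ 1) :
    Integrable (fun ω => (∑ t, e t ω * ε t ω) ^ 2) μ ∧
      ∫ ω, (∑ t, e t ω * ε t ω) ^ 2 ∂μ ≤ M := by
  have hint : ∀ t s, Integrable (fun ω => ε t ω * ε s ω) μ := fun t s =>
    (hε t).integrable_mul (hε s)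
  have hebd : ∀ t ω, |e t ω| ≤ 1 := by
    intro t ω
    rw [← sq_le_one_iff_abs_le_one]
    refine le_trans ?_ (he1 ω)
    exact Finset.single_le_sum (f := fun t => e t ω ^ 2) (fun _ _ => sq_nonneg _) (Finset.mem_univ t)
  have hsq : ∀ (x y : Fin T → ℝ), (∑ t, x t * y t) ^ 2
      = ∑ t, ∑ s, x t * x s * (y t * y s) := by
    intro x y
    rw [sq, Finset.sum_mul_sum]
    exact Finset.sum_congr rfl fun t _ => Finset.sum_congr rfl fun s _ => by ring
  have hprod : ∀ t s, Integrable ((fun ω => e t ω * e s ω) * fun ω => ε t ω * ε s ω) μ := by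
    intro t s
    refine (hint t s).bdd_mul (c := 1) (((he t).mul (he s)).mono hm le_rfl).aestronglyMeasurable
      (Eventually.of_forall fun ω => ?_)
    rw [Real.norm_eq_abs, abs_mul]
    exact mul_le_one₀ (hebd t ω) (abs_nonneg _) (hebd s ω)
  have hpull : ∀ t s, μ[(fun ω => e t ω * e s ω) * fun ω => ε t ω * ε s ω | m]
      =ᵐ[μ] (fun ω => e t ω * e s ω) * μ[fun ω => ε t ω * ε s ω | m] := fun t s =>
    condExp_mul_of_stronglyMeasurable_left ((he t).mul (he s)).stronglyMeasurable (hprod t s)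
      (hint t s)
  have hquad : ∀ v : Fin T → ℝ, μ[fun ω => (∑ t, v t * ε t ω) ^ 2 | m]
      =ᵐ[μ] fun ω => ∑ t, ∑ s, v t * v s * μ[fun ω => ε t ω * ε s ω | m] ω := by
    intro v
    have e1 : (fun ω => (∑ t, v t * ε t ω) ^ 2)
        = ∑ x : Fin T × Fin T, (v x.1 * v x.2) • fun ω => ε x.1 ω * ε x.2 ω := by
      ext ω
      rw [hsq v fun t => ε t ω, Finset.sum_apply, Fintype.sum_prod_type]
      rfl
    rw [e1]
    have h1 := condExp_finsetSum (μ := μ) (s := (Finset.univ : Finset (Fin T × Fin T)))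
      (f := fun x => (v x.1 * v x.2) • fun ω => ε x.1 ω * ε x.2 ω)
      (fun x _ => (hint x.1 x.2).smul (v x.1 * v x.2)) m
    have h2 : ∀ᵐ ω ∂μ, ∀ x : Fin T × Fin T,
        (μ[(v x.1 * v x.2) • fun ω => ε x.1 ω * ε x.2 ω | m]) ω
          = (v x.1 * v x.2) * (μ[fun ω => ε x.1 ω * ε x.2 ω | m]) ω :=
      ae_all_iff.mpr fun x => condExp_smul (v x.1 * v x.2) (fun ω => ε x.1 ω * ε x.2 ω) m
    filter_upwards [h1, h2] with ω h1 h2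
    rw [h1, Finset.sum_apply, Fintype.sum_prod_type]
    exact Finset.sum_congr rfl fun t _ => Finset.sum_congr rfl fun s _ => h2 (t, s)
  -- The null set in `hcond` depends on `v`. A countable dense set of directions and continuity in
  -- `v` yield one null set for all `v`, so that the random vector `e ω` may be inserted.
  have hall : ∀ᵐ ω ∂μ, ∀ v : Fin T → ℝ,
      ∑ t, ∑ s, v t * v s * μ[fun ω => ε t ω * ε s ω | m] ω ≤ M * sqNorm v := by
    have h1 : ∀ᵐ ω ∂μ, ∀ n : ℕ, ∑ t, ∑ s, TopologicalSpace.denseSeq (Fin T → ℝ) n t *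
        TopologicalSpace.denseSeq (Fin T → ℝ) n s * μ[fun ω => ε t ω * ε s ω | m] ω
          ≤ M * sqNorm (TopologicalSpace.denseSeq (Fin T → ℝ) n) := by
      rw [ae_all_iff]
      intro n
      filter_upwards [hquad (TopologicalSpace.denseSeq (Fin T → ℝ) n),
        hcond (TopologicalSpace.denseSeq (Fin T → ℝ) n)] with ω h1 h2
      rwa [h1] at h2
    filter_upwards [h1] with ω h1 v
    refine (TopologicalSpace.denseRange_denseSeq (Fin T → ℝ)).induction_on
      (p := fun v : Fin T → ℝ => ∑ t, ∑ s, v t * v s * μ[fun ω => ε t ω * ε s ω | m] ω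
        ≤ M * sqNorm v) v (isClosed_le ?_ ?_) h1
    · fun_prop
    · unfold sqNorm; fun_prop
  have e2 : (fun ω => (∑ t, e t ω * ε t ω) ^ 2)
      = fun ω => ∑ t, ∑ s, ((fun ω => e t ω * e s ω) * fun ω => ε t ω * ε s ω) ω := by
    ext ω
    exact hsq (fun t => e t ω) fun t => ε t ω
  refine ⟨?_, ?_⟩
  · rw [e2]
    exact integrable_finsetSum _ fun t _ => integrable_finsetSum _ fun s _ => hprod t s
  · have h3 : ∫ ω, (∑ t, e t ω * ε t ω) ^ 2 ∂μ
        = ∫ ω, ∑ t, ∑ s, e t ω * e s ω * μ[fun ω => ε t ω * ε s ω | m] ω ∂μ := by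
      rw [e2, integral_finsetSum _ fun t _ => integrable_finsetSum _ fun s _ => hprod t s]
      have hprod' : ∀ t s, Integrable
          (fun ω => e t ω * e s ω * μ[fun ω => ε t ω * ε s ω | m] ω) μ := fun t s =>
        (integrable_condExp (m := m) (f := (fun ω => e t ω * e s ω) * fun ω => ε t ω * ε s ω)).congr
          (hpull t s)
      rw [integral_finsetSum _ fun t _ => integrable_finsetSum _ fun s _ => hprod' t s]
      refine Finset.sum_congr rfl fun t _ => ?_
      rw [integral_finsetSum _ fun s _ => hprod t s, integral_finsetSum _ fun s _ => hprod' t s]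
      refine Finset.sum_congr rfl fun s _ => ?_
      rw [← integral_condExp hm]
      exact integral_congr_ae (hpull t s)
    rw [h3]
    have h4 : (∫ _ : Ω, M ∂μ) = M := by simp
    by_cases hI : Integrable
        (fun ω => ∑ t, ∑ s, e t ω * e s ω * μ[fun ω => ε t ω * ε s ω | m] ω) μ
    · rw [← h4]
      refine integral_mono_ae hI (integrable_const _) ?_
      filter_upwards [hall] with ω h
      refine (h fun t => e t ω).trans ?_
      exact mul_le_of_le_one_right hM (he1 ω)
    -- A nonintegrable function would have integral `0` by convention, and `0 ≤ M` closes this case.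
    · rw [integral_undef hI]
      exact hM

/-- The squared norm of the projection of `ε` on the span of `k` random vectors that are
`m`-measurable has expectation at most `k M`. -/
lemma exists_projection_bound (hm : m ≤ m0) {T : ℕ} {ε : Fin T → Ω → ℝ}
    (hε : ∀ t, MemLp (ε t) 2 μ) {M : ℝ} (hM : 0 ≤ M)
    (hcond : ∀ v : Fin T → ℝ,
      μ[fun ω => (∑ t, v t * ε t ω) ^ 2 | m] ≤ᵐ[μ] fun _ => M * sqNorm v)
    {ι : Type*} [Fintype ι] {W : ι → Ω → (Fin T → ℝ)} (hW : ∀ j, Measurable[m] (W j)) :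
    ∃ p : Ω → ℝ, (∀ ω, 0 ≤ p ω) ∧ Integrable p μ ∧ ∫ ω, p ω ∂μ ≤ Fintype.card ι * M ∧
      ∀ ω, ∀ y ∈ Submodule.span ℝ (Set.range fun j => W j ω),
        (y ⬝ᵥ fun t => ε t ω) ^ 2 ≤ sqNorm y * p ω := by
  let σ := (Fintype.equivFin ι).symm
  let W' : Fin (Fintype.card ι) → Ω → EuclideanSpace ℝ (Fin T) := fun j ω => WithLp.toLp 2 (W (σ j) ω)
  have hW' : ∀ j, Measurable[m] (W' j) := fun j =>
    (WithLp.measurable_toLp 2 (Fin T → ℝ)).comp (hW (σ j))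
  let E : Fin (Fintype.card ι) → Ω → EuclideanSpace ℝ (Fin T) := fun j ω =>
    InnerProductSpace.gramSchmidtNormed ℝ (fun j => W' j ω) j
  have hE : ∀ j, Measurable[m] (E j) := by
    exact fun j => measurable_gramSchmidtNormed hW' j
  -- Normalized Gram-Schmidt returns `0` at a vector dependent on its predecessors, so the norm is
  -- at most one rather than equal to one.
  have hE1 : ∀ j ω, ‖E j ω‖ ≤ 1 := by
    intro j ω
    by_cases h : E j ω = 0
    · simp [h]
    · exact (InnerProductSpace.gramSchmidtNormed_unit_length' h).le
  have hEt : ∀ j t, Measurable[m] fun ω => E j ω t := by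
    intro j t
    exact ((measurable_pi_apply t).comp (WithLp.measurable_ofLp 2 (Fin T → ℝ))).comp (hE j)
  have key := fun j => integral_dotProduct_sq_le hm hε hM hcond (e := fun t ω => E j ω t)
    (hEt j) (fun ω => by
      have : sqNorm (fun t => E j ω t) = ‖E j ω‖ ^ 2 := sqNorm_eq_norm_sq _
      rw [this]
      exact pow_le_one₀ (norm_nonneg _) (hE1 j ω))
  refine ⟨fun ω => ∑ j, (∑ t, E j ω t * ε t ω) ^ 2,
    fun ω => Finset.sum_nonneg fun _ _ => sq_nonneg _,
    integrable_finsetSum _ fun j _ => (key j).1, ?_, ?_⟩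
  · rw [integral_finsetSum _ fun j _ => (key j).1]
    refine (Finset.sum_le_sum fun j _ => (key j).2).trans ?_
    simp
  · intro ω y hy
    -- Discarding the zero vectors leaves an orthonormal family with the same span.
    have hsp : Submodule.span ℝ (Set.range fun j : {j // E j ω ≠ 0} => E j ω)
        = Submodule.span ℝ (Set.range fun j => W' j ω) := by
      rw [← InnerProductSpace.span_gramSchmidt ℝ (fun j => W' j ω),
        ← InnerProductSpace.span_gramSchmidtNormed_range]
      refine le_antisymm (Submodule.span_mono ?_) (Submodule.span_le.mpr ?_)
      · rintro _ ⟨j, rfl⟩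
        exact ⟨j, rfl⟩
      · rintro _ ⟨j, rfl⟩
        by_cases h : E j ω = 0
        · change E j ω ∈ _
          rw [h]
          exact Submodule.zero_mem _
        · exact Submodule.subset_span ⟨⟨j, h⟩, rfl⟩
    have hy' : (WithLp.toLp 2 y : EuclideanSpace ℝ (Fin T)) ∈
        Submodule.span ℝ (Set.range fun j => W' j ω) := by
      obtain ⟨c, rfl⟩ := (Submodule.mem_span_range_iff_exists_fun ℝ).mp hy
      refine (Submodule.mem_span_range_iff_exists_fun ℝ).mpr ⟨fun j => c (σ j), ?_⟩
      rw [← σ.sum_comp]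
      simp [W', WithLp.toLp_sum]
    have hon : Orthonormal ℝ fun j : {j // E j ω ≠ 0} => E j ω :=
      InnerProductSpace.gramSchmidtNormed_orthonormal' fun j => W' j ω
    rw [← hsp] at hy'
    classical
    have h1 := Orthonormal.inner_sq_le hon hy' (WithLp.toLp 2 fun t => ε t ω)
    rw [dotProduct_eq_inner, sqNorm_eq_norm_sq]
    refine h1.trans (mul_le_mul_of_nonneg_left ?_ (sq_nonneg _))
    have e1 : ∀ j, (∑ t, E j ω t * ε t ω)
        = inner ℝ (E j ω) (WithLp.toLp 2 fun t => ε t ω : EuclideanSpace ℝ (Fin T)) := fun j =>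
      dotProduct_eq_inner (WithLp.ofLp (E j ω)) fun t => ε t ω
    simp only [e1]
    rw [← Finset.sum_subtype (Finset.univ.filter fun j => E j ω ≠ 0) (by simp) fun j =>
      inner ℝ (E j ω) (WithLp.toLp 2 fun t => ε t ω : EuclideanSpace ℝ (Fin T)) ^ 2]
    exact Finset.sum_le_univ_sum_of_nonneg fun _ => sq_nonneg _

end RandomDirections

/-! ### Events of probability tending to one -/

section WithProb

variable {Ω ι : Type*} [MeasurableSpace Ω] {μ : Measure Ω} {l : Filter ι}

lemma WithProbTendingToOne.mono {S S' : ι → Ω → Prop} (h : WithProbTendingToOne μ l S)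
    (hS : ∀ᶠ n in l, ∀ ω, S n ω → S' n ω) : WithProbTendingToOne μ l S' := by
  refine tendsto_of_tendsto_of_tendsto_of_le_of_le' tendsto_const_nhds h
    (Eventually.of_forall fun _ => zero_le) ?_
  filter_upwards [hS] with n hn
  exact measure_mono fun ω hω hω' => hω (hn ω hω')

lemma WithProbTendingToOne.and {S S' : ι → Ω → Prop} (h : WithProbTendingToOne μ l S)
    (h' : WithProbTendingToOne μ l S') :
    WithProbTendingToOne μ l fun n ω => S n ω ∧ S' n ω := by
  have h2 := Tendsto.add h h'
  rw [add_zero] at h2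
  refine tendsto_of_tendsto_of_tendsto_of_le_of_le tendsto_const_nhds h2
    (fun _ => zero_le) fun n => ?_
  refine (measure_mono ?_).trans (measure_union_le _ _)
  intro ω hω
  by_cases h1 : S n ω
  · exact Or.inr fun h2 => hω ⟨h1, h2⟩
  · exact Or.inl h1

/-- It suffices to find, for every `ζ > 0`, events of probability tending to one that imply the
given ones outside sets of probability at most `ζ`. -/
lemma WithProbTendingToOne.of_forall_le {S : ι → Ω → Prop}
    (h : ∀ ζ : ℝ, 0 < ζ → ∃ E B : ι → Ω → Prop, WithProbTendingToOne μ l E ∧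
      (∀ᶠ n in l, μ {ω | ¬ B n ω} ≤ ENNReal.ofReal ζ) ∧
      ∀ᶠ n in l, ∀ ω, E n ω → B n ω → S n ω) : WithProbTendingToOne μ l S := by
  rw [WithProbTendingToOne, ENNReal.tendsto_nhds_zero]
  intro δ hδ
  obtain ⟨ζ, hζ0, hζ⟩ : ∃ ζ : ℝ, 0 < ζ ∧ ENNReal.ofReal ζ + ENNReal.ofReal ζ ≤ δ := by
    by_cases hd : δ = ⊤
    · exact ⟨1, one_pos, by simp [hd]⟩
    · refine ⟨δ.toReal / 2, half_pos (ENNReal.toReal_pos hδ.ne' hd), ?_⟩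
      have := ENNReal.toReal_pos hδ.ne' hd
      rw [← ENNReal.ofReal_add (by positivity) (by positivity), add_halves, ENNReal.ofReal_toReal hd]
  obtain ⟨E, B, hE, hB, hEB⟩ := h ζ hζ0
  rw [WithProbTendingToOne, ENNReal.tendsto_nhds_zero] at hE
  filter_upwards [hE _ (ENNReal.ofReal_pos.mpr hζ0), hB, hEB] with n h1 h2 h3
  refine le_trans ?_ ((add_le_add h1 h2).trans hζ)
  refine (measure_mono ?_).trans (measure_union_le _ _)
  intro ω hω
  by_cases h4 : E n ω
  · exact Or.inr fun h5 => hω (h3 ω h4 h5)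
  · exact Or.inl h4

lemma measure_not_le_le [IsProbabilityMeasure μ] {g : Ω → ℝ} (hg : ∀ ω, 0 ≤ g ω)
    (hi : Integrable g μ) {c K : ℝ} (hc : ∫ ω, g ω ∂μ ≤ c) (hK : 0 < K) :
    μ {ω | ¬ g ω ≤ K} ≤ ENNReal.ofReal (c / K) := by
  have h1 := mul_meas_ge_le_integral_of_nonneg (Eventually.of_forall hg) hi K
  have h2 : μ.real {ω | K ≤ g ω} ≤ c / K := by
    rw [le_div_iff₀ hK, mul_comm]
    exact h1.trans hc
  refine (measure_mono (t := {ω | K ≤ g ω}) fun ω hω => (not_le.mp hω).le).trans ?_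
  rw [← ofReal_measureReal]
  exact ENNReal.ofReal_le_ofReal h2

lemma WithProbTendingToOne.of_integral_le [IsProbabilityMeasure μ] {g : ι → Ω → ℝ} {c : ι → ℝ}
    (h : ∀ᶠ n in l, (∀ ω, 0 ≤ g n ω) ∧ Integrable (g n) μ ∧ ∫ ω, g n ω ∂μ ≤ c n)
    (hc : Tendsto c l (𝓝 0)) {η : ℝ} (hη : 0 < η) :
    WithProbTendingToOne μ l fun n ω => g n ω ≤ η := by
  have h1 : Tendsto (fun n => ENNReal.ofReal (c n / η)) l (𝓝 0) := by
    have := (ENNReal.continuous_ofReal.tendsto _).comp (hc.div_const η)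
    rwa [zero_div, ENNReal.ofReal_zero] at this
  refine tendsto_of_tendsto_of_tendsto_of_le_of_le' tendsto_const_nhds h1
    (Eventually.of_forall fun _ => zero_le) ?_
  filter_upwards [h] with n hn
  exact measure_not_le_le hn.1 hn.2.1 hn.2.2 hη

lemma tendstoInMeasure_zero_of_forall {g : ι → Ω → ℝ} (hg : ∀ᶠ n in l, ∀ ω, 0 ≤ g n ω)
    (h : ∀ η : ℝ, 0 < η → WithProbTendingToOne μ l fun n ω => g n ω ≤ η) :
    TendstoInMeasure μ g l fun _ => 0 := by
  rw [tendstoInMeasure_iff_dist]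
  intro η hη
  refine tendsto_of_tendsto_of_tendsto_of_le_of_le' tendsto_const_nhds (h (η / 2) (half_pos hη))
    (Eventually.of_forall fun _ => zero_le) ?_
  filter_upwards [hg] with n hn
  refine measure_mono fun ω hω => ?_
  simp only [Set.mem_ofPred_eq, Real.dist_eq, sub_zero, abs_of_nonneg (hn ω)] at hω ⊢
  linarith

end WithProb

/-! ### The expected shortfall errors -/

namespace Panel

section SigmaXF

variable {Ω : Type*} {d r : ℕ} (P : Panel Ω d r)

lemma measurable_sigmaXF_X (i t : ℕ) : Measurable[P.sigmaXF] (P.X i t) :=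
  Measurable.of_comap_le (le_sup_of_le_left (le_iSup₂_of_le i t le_rfl))

lemma measurable_sigmaXF_f (t : ℕ) : Measurable[P.sigmaXF] (P.f t) :=
  Measurable.of_comap_le (le_sup_of_le_right (le_iSup_of_le t le_rfl))

lemma measurable_sigmaXF_Xmat_col (T i : ℕ) (a : Fin d) :
    Measurable[P.sigmaXF] fun ω => (P.Xmat T i ω)ᵀ a := by
  let _ := P.sigmaXF
  exact measurable_pi_lambda _ fun t => (measurable_pi_apply a).comp (P.measurable_sigmaXF_X i t)

lemma measurable_sigmaXF_Fmat_col (T : ℕ) (k : Fin r) :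
    Measurable[P.sigmaXF] fun ω => (P.Fmat T ω)ᵀ k := by
  let _ := P.sigmaXF
  exact measurable_pi_lambda _ fun t => (measurable_pi_apply k).comp (P.measurable_sigmaXF_f t)

end SigmaXF

variable {Ω : Type*} [MeasurableSpace Ω] {d r : ℕ} {P : Panel Ω d r} {μ : Measure Ω}
  [IsProbabilityMeasure μ]

lemma measurable_X_dotProduct (h : ModelAssumption P μ) (i t : ℕ) (a : Fin d → ℝ) :
    Measurable fun ω => P.X i t ω ⬝ᵥ a :=
  Finset.measurable_sum _ fun j _ => ((measurable_pi_apply j).comp (h.measurable_X i t)).mul_const _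

lemma measurable_qErr (h : ModelAssumption P μ) (i t : ℕ) : Measurable (P.qErr i t) :=
  (h.measurable_Y i t).sub (measurable_X_dotProduct h i t _)

lemma measurable_esErr (h : ModelAssumption P μ) (i t : ℕ) : Measurable (P.esErr i t) := by
  have h1 := measurable_X_dotProduct h i t (P.α i)
  have h2 : Measurable fun ω => P.lam i ⬝ᵥ P.f t ω :=
    Finset.measurable_sum _ fun j _ => ((measurable_pi_apply j).comp (h.measurable_f t)).const_mul _
  unfold esErr Zstar
  refine ((Measurable.const_mul (((h.measurable_Y i t).sub h1).mul ?_ |>.add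
    (h1.const_mul _)) _).sub (measurable_X_dotProduct h i t _)).sub h2
  exact Measurable.ite (measurableSet_le (h.measurable_Y i t) h1) measurable_const measurable_const

lemma sigmaXF_le (h : ModelAssumption P μ) : P.sigmaXF ≤ ‹MeasurableSpace Ω› :=
  sup_le (iSup_le fun i => iSup_le fun t => (h.measurable_X i t).comap_le)
    (iSup_le fun t => (h.measurable_f t).comap_le)

/-- Numerical bounds for the expected shortfall errors, with one common constant. -/
structure ErrorBound (P : Panel Ω d r) (μ : Measure Ω) [IsProbabilityMeasure μ] (M : ℝ) :
    Prop where
  one_le : 1 ≤ M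
  measurable : ∀ i t, Measurable (P.esErr i t)
  integrable_pow_four : ∀ i t, Integrable (fun ω => P.esErr i t ω ^ 4) μ
  pow_four : ∀ i t, ∫ ω, P.esErr i t ω ^ 4 ∂μ ≤ M
  eigen : ∀ (i T : ℕ) (v : Fin T → ℝ),
    μ[fun ω => (∑ t : Fin T, v t * P.esErr i t ω) ^ 2 | P.sigmaXF] ≤ᵐ[μ] fun _ => M * sqNorm v
  cov : ∀ N T : ℕ,
    ∑ t : Fin T, ∑ s : Fin T, ∑ u : Fin T, ∑ v : Fin T, ∑ k : Fin N, ∑ m : Fin N,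
      |covariance (fun ω => P.esErr k t ω * P.esErr k s ω)
        (fun ω => P.esErr m u ω * P.esErr m v ω) μ| ≤ M * (T : ℝ) ^ 2 * N

lemma exists_errorBound (h : ModelAssumption P μ) (he : ErrorAssumption P μ) :
    ∃ M, ErrorBound P μ M := by
  obtain ⟨M1, h1⟩ := he.moments
  obtain ⟨M2, h2⟩ := he.eigen
  obtain ⟨M3, h3⟩ := he.cov
  refine ⟨max 1 (max M1 (max M2 M3)), le_max_left _ _, measurable_esErr h, fun i t => (h1 i t).1,
    fun i t => (h1 i t).2.trans (by simp), fun i T v => (h2 i T v).trans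
      (Eventually.of_forall fun _ => ?_), fun N T => (h3 N T).trans ?_⟩
  · exact mul_le_mul_of_nonneg_right (by simp) (sqNorm_nonneg v)
  · rw [mul_assoc, mul_assoc]
    exact mul_le_mul_of_nonneg_right (by simp) (by positivity)

namespace ErrorBound

variable {M : ℝ} (h : ErrorBound P μ M)

lemma memLp_two (h : ErrorBound P μ M) (i t : ℕ) : MemLp (P.esErr i t) 2 μ := by
  rw [memLp_two_iff_integrable_sq (h.measurable i t).aestronglyMeasurable]
  refine Integrable.mono' ((integrable_const (1 : ℝ)).add (h.integrable_pow_four i t))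
    ((h.measurable i t).pow_const 2).aestronglyMeasurable (Eventually.of_forall fun ω => ?_)
  simp only [Real.norm_eq_abs, abs_pow, sq_abs, Pi.add_apply]
  nlinarith [sq_nonneg (P.esErr i t ω ^ 2 - 1), sq_nonneg (P.esErr i t ω ^ 2)]

lemma memLp_two_mul (h : ErrorBound P μ M) (i t s : ℕ) : MemLp (fun ω => P.esErr i t ω * P.esErr i s ω) 2 μ := by
  refine (memLp_two_iff_integrable_sq
    ((h.measurable i t).mul (h.measurable i s)).aestronglyMeasurable).mpr ?_
  refine Integrable.mono' ((h.integrable_pow_four i t).add (h.integrable_pow_four i s))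
    (((h.measurable i t).mul (h.measurable i s)).pow_const 2).aestronglyMeasurable
    (Eventually.of_forall fun ω => ?_)
  simp only [Real.norm_eq_abs, abs_pow, sq_abs, Pi.add_apply, Pi.mul_apply]
  nlinarith [sq_nonneg (P.esErr i t ω ^ 2 - P.esErr i s ω ^ 2),
    sq_nonneg (P.esErr i t ω ^ 2 + P.esErr i s ω ^ 2), sq_nonneg (P.esErr i t ω ^ 2),
    sq_nonneg (P.esErr i s ω ^ 2)]

lemma integrable_mul (h : ErrorBound P μ M) (i t s : ℕ) : Integrable (fun ω => P.esErr i t ω * P.esErr i s ω) μ :=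
  (h.memLp_two i t).integrable_mul (h.memLp_two i s)

lemma integral_linear_sq_le (h : ErrorBound P μ M) (hm : P.sigmaXF ≤ ‹MeasurableSpace Ω›) (i T : ℕ) (v : Fin T → ℝ) :
    ∫ ω, (∑ t : Fin T, v t * P.esErr i t ω) ^ 2 ∂μ ≤ M * sqNorm v := by
  rw [← integral_condExp hm]
  refine (integral_mono_ae integrable_condExp (integrable_const _) (h.eigen i T v)).trans ?_
  simp

/-- The rows of the covariance matrix of `ε_i` are bounded. -/
lemma sum_integral_mul_sq_le (h : ErrorBound P μ M) (hm : P.sigmaXF ≤ ‹MeasurableSpace Ω›) (i T : ℕ) (t : Fin T) :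
    ∑ s : Fin T, (∫ ω, P.esErr i t ω * P.esErr i s ω ∂μ) ^ 2 ≤ M ^ 2 := by
  have hM : 0 < M := one_pos.trans_le h.one_le
  set w : Fin T → ℝ := fun s => ∫ ω, P.esErr i t ω * P.esErr i s ω ∂μ with hw
  have hlin : ∀ v : Fin T → ℝ, MemLp (fun ω => ∑ s : Fin T, v s * P.esErr i s ω) 2 μ := fun v =>
    memLp_finsetSum _ fun s _ => (h.memLp_two i s).const_mul (v s)
  have hsq : ∀ v : Fin T → ℝ, Integrable (fun ω => (∑ s : Fin T, v s * P.esErr i s ω) ^ 2) μ :=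
    fun v => (hlin v).integrable_sq
  have h1 : ∫ ω, P.esErr i t ω * (∑ s : Fin T, w s * P.esErr i s ω) ∂μ = sqNorm w := by
    have e : ∀ ω, P.esErr i t ω * (∑ s : Fin T, w s * P.esErr i s ω)
        = ∑ s : Fin T, w s * (P.esErr i t ω * P.esErr i s ω) := by
      intro ω
      rw [Finset.mul_sum]
      exact Finset.sum_congr rfl fun s _ => by ring
    simp only [e]
    rw [integral_finsetSum _ fun (s : Fin T) _ => (h.integrable_mul i t s).const_mul (w s), sqNorm]
    refine Finset.sum_congr rfl fun s _ => ?_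
    rw [integral_const_mul, sq]
  have h2 := h.integral_linear_sq_le hm i T w
  have h3 : ∫ ω, P.esErr i t ω ^ 2 ∂μ ≤ M := by
    have := h.integral_linear_sq_le hm i T (Pi.single t 1)
    have e : sqNorm (Pi.single t 1 : Fin T → ℝ) = 1 := by
      rw [sqNorm_eq_dotProduct]; simp
    simpa [e, Pi.single_apply] using this
  -- With `w` the row of covariances, expanding this square and bounding both quadratic forms gives
  -- `0 ≤ M³ - 2M ‖w‖² + M ‖w‖²`.
  have h4 : 0 ≤ ∫ ω, (M * P.esErr i t ω - ∑ s : Fin T, w s * P.esErr i s ω) ^ 2 ∂μ :=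
    integral_nonneg fun ω => sq_nonneg _
  have e : ∀ ω, (M * P.esErr i t ω - ∑ s : Fin T, w s * P.esErr i s ω) ^ 2
      = M ^ 2 * P.esErr i t ω ^ 2 - 2 * M * (P.esErr i t ω * (∑ s : Fin T, w s * P.esErr i s ω))
        + (∑ s : Fin T, w s * P.esErr i s ω) ^ 2 := fun ω => by ring
  have hi1 : Integrable (fun ω => M ^ 2 * P.esErr i t ω ^ 2) μ :=
    ((h.memLp_two i t).integrable_sq).const_mul (M ^ 2)
  have hi2 : Integrable (fun ω => 2 * M * (P.esErr i t ω * (∑ s : Fin T, w s * P.esErr i s ω))) μ :=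
    ((h.memLp_two i t).integrable_mul (hlin w)).const_mul (2 * M)
  simp only [e] at h4
  have h7 : Integrable (fun ω => M ^ 2 * P.esErr i t ω ^ 2
      - 2 * M * (P.esErr i t ω * (∑ s : Fin T, w s * P.esErr i s ω))) μ := hi1.sub hi2
  rw [integral_add h7 (hsq w), integral_sub hi1 hi2, integral_const_mul, integral_const_mul,
    h1] at h4
  have h5 : M ^ 2 * ∫ ω, P.esErr i t ω ^ 2 ∂μ ≤ M ^ 2 * M := mul_le_mul_of_nonneg_left h3 (by positivity)
  have h6 : M * sqNorm w ≤ M * M ^ 2 := by nlinarith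
  exact le_of_mul_le_mul_left h6 hM

/-- Second moment of the entries of `∑ i, ε_i ε_iᵀ`. -/
lemma integral_gram_sq_le (h : ErrorBound P μ M) (hm : P.sigmaXF ≤ ‹MeasurableSpace Ω›) (N T : ℕ) :
    Integrable (fun ω => ∑ t : Fin T, ∑ s : Fin T,
      (∑ i : Fin N, P.errVec T i ω t * P.errVec T i ω s) ^ 2) μ ∧
    ∫ ω, ∑ t : Fin T, ∑ s : Fin T, (∑ i : Fin N, P.errVec T i ω t * P.errVec T i ω s) ^ 2 ∂μ
      ≤ M * (T : ℝ) ^ 2 * N + (N : ℝ) ^ 2 * (T * M ^ 2) := by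
  have hL : ∀ t s : Fin T, MemLp (fun ω => ∑ i : Fin N, P.errVec T i ω t * P.errVec T i ω s) 2 μ :=
    fun t s => memLp_finsetSum _ fun i _ => h.memLp_two_mul i t s
  refine ⟨integrable_finsetSum _ fun t _ => integrable_finsetSum _ fun s _ =>
    (hL t s).integrable_sq, ?_⟩
  rw [integral_finsetSum _ fun t _ => integrable_finsetSum _ fun s _ => (hL t s).integrable_sq]
  simp only [integral_finsetSum _ fun s _ => (hL _ s).integrable_sq]
  set κ : Fin T → Fin T → Fin N → Fin N → ℝ := fun t s k m =>
    |covariance (fun ω => P.esErr k t ω * P.esErr k s ω)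
        (fun ω => P.esErr m t ω * P.esErr m s ω) μ| with hκ
  -- Each second moment is a covariance plus a product of means; Cauchy-Schwarz over units reduces
  -- the means to rows of covariance matrices.
  have h1 : ∀ t s : Fin T, ∫ ω, (∑ i : Fin N, P.errVec T i ω t * P.errVec T i ω s) ^ 2 ∂μ
      ≤ ∑ k, ∑ m, κ t s k m + N * ∑ i : Fin N, (∫ ω, P.esErr i t ω * P.esErr i s ω ∂μ) ^ 2 := by
    intro t s
    have hint : ∀ k m : Fin N, Integrable ((fun ω => P.esErr k t ω * P.esErr k s ω) *
        (fun ω => P.esErr m t ω * P.esErr m s ω)) μ := fun k m =>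
      (h.memLp_two_mul k t s).integrable_mul (h.memLp_two_mul m t s)
    have e1 : ∫ ω, (∑ i : Fin N, P.errVec T i ω t * P.errVec T i ω s) ^ 2 ∂μ
        = ∑ k : Fin N, ∑ m : Fin N, ∫ ω, ((fun ω => P.esErr k t ω * P.esErr k s ω) *
          (fun ω => P.esErr m t ω * P.esErr m s ω)) ω ∂μ := by
      have e2 : ∀ ω, (∑ i : Fin N, P.errVec T i ω t * P.errVec T i ω s) ^ 2
          = ∑ k : Fin N, ∑ m : Fin N, ((fun ω => P.esErr k t ω * P.esErr k s ω) *
          (fun ω => P.esErr m t ω * P.esErr m s ω)) ω := by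
        intro ω
        rw [sq, Finset.sum_mul_sum]
        rfl
      simp only [e2]
      rw [integral_finsetSum _ fun k _ => integrable_finsetSum _ fun m _ => hint k m]
      exact Finset.sum_congr rfl fun k _ => integral_finsetSum _ fun m _ => hint k m
    have e3 : ∀ k m : Fin N, ∫ ω, ((fun ω => P.esErr k t ω * P.esErr k s ω) *
          (fun ω => P.esErr m t ω * P.esErr m s ω)) ω ∂μ ≤ κ t s k m +
          (∫ ω, P.esErr k t ω * P.esErr k s ω ∂μ) * (∫ ω, P.esErr m t ω * P.esErr m s ω ∂μ) := by
      intro k m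
      have := covariance_eq_sub (h.memLp_two_mul k t s) (h.memLp_two_mul m t s)
      have h2 := le_abs_self (covariance (fun ω => P.esErr k t ω * P.esErr k s ω)
        (fun ω => P.esErr m t ω * P.esErr m s ω) μ)
      simp only [hκ]
      linarith
    rw [e1]
    refine (Finset.sum_le_sum fun k _ => Finset.sum_le_sum fun m _ => e3 k m).trans ?_
    simp only [Finset.sum_add_distrib]
    gcongr
    rw [← Finset.sum_mul_sum, ← sq]
    refine sq_sum_le_card_mul_sum_sq.trans ?_
    simp
  refine (Finset.sum_le_sum fun t _ => Finset.sum_le_sum fun s _ => h1 t s).trans ?_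
  simp only [Finset.sum_add_distrib, ← Finset.mul_sum]
  refine add_le_add ?_ ?_
  -- Only the terms `u = t`, `v = s` of the covariance condition enter.
  · refine le_trans ?_ (h.cov N T)
    refine Finset.sum_le_sum fun t _ => Finset.sum_le_sum fun s _ => ?_
    refine le_trans ?_ (Finset.single_le_sum (f := fun u : Fin T => ∑ v : Fin T, ∑ k : Fin N,
      ∑ m : Fin N, |covariance (fun ω => P.esErr k t ω * P.esErr k s ω)
        (fun ω => P.esErr m u ω * P.esErr m v ω) μ|) (fun u _ => by positivity) (Finset.mem_univ t))
    exact Finset.single_le_sum (f := fun v : Fin T => ∑ k : Fin N,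
      ∑ m : Fin N, |covariance (fun ω => P.esErr k t ω * P.esErr k s ω)
        (fun ω => P.esErr m t ω * P.esErr m v ω) μ|) (fun u _ => by positivity) (Finset.mem_univ s)
  · have h2 : ∑ t : Fin T, ∑ s : Fin T, ∑ i : Fin N, (∫ ω, P.esErr i t ω * P.esErr i s ω ∂μ) ^ 2
        ≤ N * (T * M ^ 2) := by
      have e : ∑ t : Fin T, ∑ s : Fin T, ∑ i : Fin N, (∫ ω, P.esErr i t ω * P.esErr i s ω ∂μ) ^ 2
          = ∑ i : Fin N, ∑ t : Fin T, ∑ s : Fin T,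
            (∫ ω, P.esErr i t ω * P.esErr i s ω ∂μ) ^ 2 := by
        rw [Finset.sum_comm (s := (Finset.univ : Finset (Fin N)))]
        exact Finset.sum_congr rfl fun t _ => Finset.sum_comm
      rw [e]
      refine (Finset.sum_le_sum fun (i : Fin N) _ => Finset.sum_le_sum fun (t : Fin T) _ =>
        h.sum_integral_mul_sq_le hm (i : ℕ) T t).trans ?_
      simp
    calc (N : ℝ) * ∑ t : Fin T, ∑ s : Fin T, ∑ i : Fin N, (∫ ω, P.esErr i t ω * P.esErr i s ω ∂μ) ^ 2
        ≤ N * (N * (T * M ^ 2)) := mul_le_mul_of_nonneg_left h2 (by positivity)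
      _ = _ := by ring

/-- `(NT)⁻¹ ∑ i, ε_i ε_iᵀ` tends to zero in Frobenius norm. -/
lemma errGram_le (h : ErrorBound P μ M) (hm : P.sigmaXF ≤ ‹MeasurableSpace Ω›) {l : Filter (ℕ × ℕ)}
    (hl : l ≤ atTop ×ˢ atTop) {η : ℝ} (hη : 0 < η) :
    WithProbTendingToOne μ l fun n ω => P.errGram n.1 n.2 ω ≤ η := by
  have hN : Tendsto (fun n : ℕ × ℕ => n.1) l atTop := tendsto_fst.mono_left hl
  have hT : Tendsto (fun n : ℕ × ℕ => n.2) l atTop := tendsto_snd.mono_left hl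
  -- This is `(NT)⁻²` times the second-moment bound; it vanishes without any rate between `N` and
  -- `T`.
  have hc : Tendsto (fun n : ℕ × ℕ => M * (n.1 : ℝ)⁻¹ + M ^ 2 * (n.2 : ℝ)⁻¹) l (𝓝 0) := by
    have h1 := (tendsto_inv_atTop_nhds_zero_nat (𝕜 := ℝ)).comp hN
    have h2 := (tendsto_inv_atTop_nhds_zero_nat (𝕜 := ℝ)).comp hT
    have := (h1.const_mul M).add (h2.const_mul (M ^ 2))
    simpa using this
  have key := WithProbTendingToOne.of_integral_le (μ := μ) (l := l)
    (g := fun n ω => (((n.1 : ℝ) * n.2)⁻¹) ^ 2 * ∑ t : Fin n.2, ∑ s : Fin n.2,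
      (∑ i : Fin n.1, P.errVec n.2 i ω t * P.errVec n.2 i ω s) ^ 2) ?_ hc (η := η ^ 2) (by positivity)
  · refine key.mono (Eventually.of_forall fun n ω hω => ?_)
    rw [errGram]
    refine abs_le_of_sq_le_sq' ?_ hη.le |>.2
    rw [mul_pow, Real.sq_sqrt (by positivity)]
    exact hω
  · filter_upwards [hN.eventually_gt_atTop 0, hT.eventually_gt_atTop 0] with n hn1 hn2
    obtain ⟨h1, h2⟩ := h.integral_gram_sq_le hm n.1 n.2
    have hn1' : (0 : ℝ) < n.1 := by exact_mod_cast hn1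
    have hn2' : (0 : ℝ) < n.2 := by exact_mod_cast hn2
    refine ⟨fun ω => by positivity, h1.const_mul _, ?_⟩
    rw [integral_const_mul]
    refine (mul_le_mul_of_nonneg_left h2 (by positivity)).trans (le_of_eq ?_)
    field_simp

lemma sqNorm_errVec_sq_le (h : ErrorBound P μ M) {T : ℕ} (hT : 0 < T) (i : ℕ) :
    Integrable (fun ω => (sqNorm (P.errVec T i ω) / T) ^ 2) μ ∧
      ∫ ω, (sqNorm (P.errVec T i ω) / T) ^ 2 ∂μ ≤ M := by
  have hT' : (0 : ℝ) < T := by exact_mod_cast hT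
  have hpt : ∀ ω, (sqNorm (P.errVec T i ω) / T) ^ 2 ≤ (T : ℝ)⁻¹ * ∑ t : Fin T, P.esErr i t ω ^ 4 := by
    intro ω
    have h1 : sqNorm (P.errVec T i ω) ^ 2 ≤ T * ∑ t : Fin T, (P.errVec T i ω t ^ 2) ^ 2 := by
      have := sq_sum_le_card_mul_sum_sq (s := Finset.univ) (f := fun t : Fin T => P.errVec T i ω t ^ 2)
      simpa [sqNorm] using this
    rw [div_pow, div_le_iff₀ (by positivity)]
    have h2 : ∑ t : Fin T, (P.errVec T i ω t ^ 2) ^ 2 = ∑ t : Fin T, P.esErr i t ω ^ 4 :=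
      Finset.sum_congr rfl fun t _ => by rw [← pow_mul]; rfl
    rw [h2] at h1
    refine h1.trans (le_of_eq ?_)
    rw [inv_mul_eq_div, div_mul_eq_mul_div, eq_div_iff hT'.ne']
    ring
  have hint : Integrable (fun ω => (T : ℝ)⁻¹ * ∑ t : Fin T, P.esErr i t ω ^ 4) μ :=
    (integrable_finsetSum _ fun (t : Fin T) _ => h.integrable_pow_four i t).const_mul _
  have hmeas1 : Measurable fun ω => ∑ t : Fin T, P.esErr i t ω ^ 2 :=
    Finset.measurable_sum _ fun t _ => (h.measurable i t).pow_const 2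
  have hmeas : Measurable fun ω => (sqNorm (P.errVec T i ω) / T) ^ 2 :=
    (hmeas1.div_const (T : ℝ)).pow_const 2
  have hI : Integrable (fun ω => (sqNorm (P.errVec T i ω) / T) ^ 2) μ := by
    refine hint.mono' hmeas.aestronglyMeasurable (Eventually.of_forall fun ω => ?_)
    rw [Real.norm_eq_abs, abs_of_nonneg (sq_nonneg _)]
    exact hpt ω
  refine ⟨hI, (integral_mono hI hint hpt).trans ?_⟩
  rw [integral_const_mul, integral_finsetSum _ fun (t : Fin T) _ => h.integrable_pow_four i t,
    inv_mul_le_iff₀ hT']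
  refine (Finset.sum_le_sum fun (t : Fin T) _ => h.pow_four i t).trans ?_
  simp

/-- Fourth moments bound this average in probability but do not make it vanish. Hence `K` must be
fixed in advance and an exceptional set of small probability tolerated. -/
lemma measure_errVec_le (h : ErrorBound P μ M) {N T : ℕ} (hN : 0 < N) (hT : 0 < T) {K : ℝ} (hK : 0 < K) :
    μ {ω | ¬ (N : ℝ)⁻¹ * ∑ i : Fin N, (sqNorm (P.errVec T i ω) / T) ^ 2 ≤ K}
      ≤ ENNReal.ofReal (M / K) := by
  have hN' : (0 : ℝ) < N := by exact_mod_cast hN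
  refine measure_not_le_le (fun ω => by positivity)
    ((integrable_finsetSum _ fun (i : Fin N) _ => (h.sqNorm_errVec_sq_le hT i).1).const_mul _) ?_ hK
  rw [integral_const_mul, integral_finsetSum _ fun (i : Fin N) _ => (h.sqNorm_errVec_sq_le hT i).1,
    inv_mul_le_iff₀ hN']
  refine (Finset.sum_le_sum fun (i : Fin N) _ => (h.sqNorm_errVec_sq_le hT (i : ℕ)).2).trans ?_
  simp

/-- The squared projections of the error vectors on spans of regressors and factors. -/
lemma exists_designSpan_bound (h : ErrorBound P μ M) (hm : P.sigmaXF ≤ ‹MeasurableSpace Ω›) (T i : ℕ) {m : ℕ}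
    (I : Fin m → ℕ) :
    ∃ p : Ω → ℝ, (∀ ω, 0 ≤ p ω) ∧ Integrable p μ ∧ ∫ ω, p ω ∂μ ≤ ((m + 1) * d + r : ℕ) * M ∧
      ∀ ω, ∀ y ∈ P.designSpan T i ω I, (y ⬝ᵥ P.errVec T i ω) ^ 2 ≤ sqNorm y * p ω := by
  obtain ⟨p, h0, h1, h2, h3⟩ := exists_projection_bound (μ := μ) hm
    (ε := fun (t : Fin T) ω => P.esErr i t ω) (fun t => h.memLp_two i t)
    (zero_le_one.trans h.one_le) (h.eigen i T)
    (W := Sum.elim (fun (x : Option (Fin m) × Fin d) ω => (P.Xmat T (x.1.elim i I) ω)ᵀ x.2)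
      fun (k : Fin r) ω => (P.Fmat T ω)ᵀ k) (by
      rintro (⟨x, a⟩ | k)
      · exact P.measurable_sigmaXF_Xmat_col T (x.elim i I) a
      · exact P.measurable_sigmaXF_Fmat_col T k)
  refine ⟨p, h0, h1, h2.trans (le_of_eq ?_), fun ω y hy => h3 ω y ?_⟩
  · simp
  · have e : (fun j => Sum.elim (fun (x : Option (Fin m) × Fin d) ω => (P.Xmat T (x.1.elim i I) ω)ᵀ x.2)
      (fun (k : Fin r) ω => (P.Fmat T ω)ᵀ k) j ω) = Sum.elim (fun x : Option (Fin m) × Fin d =>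
      (P.Xmat T (x.1.elim i I) ω)ᵀ x.2) fun k : Fin r => (P.Fmat T ω)ᵀ k := by
      ext (j | j) <;> rfl
    rw [e]
    exact hy

end ErrorBound

end Panel

/-! ### The check loss -/

section CheckLoss

open Panel

variable {τ : ℝ}

lemma checkLoss_eq_max (u : ℝ) : checkLoss τ u = max (τ * u) ((τ - 1) * u) := by
  unfold checkLoss
  split_ifs with h
  · rw [max_eq_right (by nlinarith)]; ring
  · rw [max_eq_left (by nlinarith)]; ring

lemma measurable_checkLoss : Measurable (checkLoss τ) := by
  have : checkLoss τ = fun u => max (τ * u) ((τ - 1) * u) := funext checkLoss_eq_max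
  rw [this]
  exact (measurable_const_mul τ).max (measurable_const_mul (τ - 1))

lemma abs_checkLoss_sub_le (h0 : 0 < τ) (h1 : τ < 1) (u v : ℝ) :
    |checkLoss τ u - checkLoss τ v| ≤ |u - v| := by
  rw [checkLoss_eq_max, checkLoss_eq_max]
  refine (abs_max_sub_max_le_max _ _ _ _).trans (max_le ?_ ?_)
  · rw [← mul_sub, abs_mul, abs_of_pos h0]
    exact mul_le_of_le_one_left (abs_nonneg _) h1.le
  · rw [← mul_sub, abs_mul, abs_of_neg (by linarith)]
    exact mul_le_of_le_one_left (abs_nonneg _) (by linarith)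

lemma checkLoss_convex {s : ℝ} (hs0 : 0 ≤ s) (hs1 : s ≤ 1) (u v : ℝ) :
    checkLoss τ (s * u + (1 - s) * v) ≤ s * checkLoss τ u + (1 - s) * checkLoss τ v := by
  simp only [checkLoss_eq_max]
  have h1 : 0 ≤ 1 - s := by linarith
  refine max_le ?_ ?_
  · have := mul_le_mul_of_nonneg_left (le_max_left (τ * u) ((τ - 1) * u)) hs0
    have := mul_le_mul_of_nonneg_left (le_max_left (τ * v) ((τ - 1) * v)) h1
    linarith
  · have := mul_le_mul_of_nonneg_left (le_max_right (τ * u) ((τ - 1) * u)) hs0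
    have := mul_le_mul_of_nonneg_left (le_max_right (τ * v) ((τ - 1) * v)) h1
    linarith

lemma min_mul_abs_le_checkLoss (u : ℝ) : min τ (1 - τ) * |u| ≤ checkLoss τ u := by
  unfold checkLoss
  split_ifs with h
  · rw [abs_of_neg h]
    have := mul_le_mul_of_nonneg_right (min_le_right τ (1 - τ)) (neg_nonneg.mpr h.le)
    linarith
  · have := mul_le_mul_of_nonneg_right (min_le_left τ (1 - τ)) (not_lt.mp h)
    rw [abs_of_nonneg (not_lt.mp h)]
    linarith

lemma checkLoss_le_abs (h0 : 0 < τ) (h1 : τ < 1) (u : ℝ) : checkLoss τ u ≤ |u| := by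
  have := abs_checkLoss_sub_le h0 h1 u 0
  have h2 : checkLoss τ 0 = 0 := by simp [checkLoss]
  rw [h2, sub_zero, sub_zero] at this
  exact (le_abs_self _).trans this

/-- Half-open interval on which the quantile loss has a strict gain at displacement `w`. -/
def gainSet (s w : ℝ) : Set ℝ :=
  if 0 ≤ w then Set.Ioc 0 (min |w| s / 2) else Set.Ioc (-(min |w| s / 2)) 0

lemma measurableSet_gainSet (s w : ℝ) : MeasurableSet (gainSet s w) := by
  unfold gainSet
  split_ifs <;> exact measurableSet_Ioc

/-- Lower bound for the increment of the check loss (Knight's identity). -/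
lemma checkLoss_sub_ge {s : ℝ} (hs : 0 < s) (e w : ℝ) :
    -w * (τ - (Set.Iic (0 : ℝ)).indicator 1 e) + min |w| s / 2 * (gainSet s w).indicator 1 e
      ≤ checkLoss τ (e - w) - checkLoss τ e := by
  have h1 : min |w| s ≤ |w| := min_le_left _ _
  have h2 : 0 ≤ min |w| s := le_min (abs_nonneg _) hs.le
  -- The excess over the linear part is nonnegative, and it equals `|w| - |e|` when `e` lies between
  -- `0` and `w`; on the gain set this is at least `|w| / 2`.
  unfold gainSet checkLoss
  by_cases hw : 0 ≤ w
  · rw [if_pos hw]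
    rw [abs_of_nonneg hw] at h1 h2 ⊢
    simp only [Set.indicator_apply, Set.mem_Iic, Set.mem_Ioc, Pi.one_apply]
    split_ifs <;> grind
  · rw [if_neg hw]
    rw [abs_of_neg (not_le.mp hw)] at h1 h2 ⊢
    simp only [Set.indicator_apply, Set.mem_Iic, Set.mem_Ioc, Pi.one_apply]
    split_ifs <;> grind

/-- Expected increment of the check loss when `0` is the `τ`-quantile and the distribution has
mass at least `κ (b - a)` on the intervals `(a, b]` near `0`. -/
lemma integral_checkLoss_sub_ge (h0 : 0 < τ) (h1 : τ < 1) {ν : Measure ℝ} [IsProbabilityMeasure ν]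
    (hq : ν (Set.Iic 0) = ENNReal.ofReal τ) {κ s : ℝ} (hs : 0 < s)
    (hd : ∀ a b : ℝ, -s ≤ a → a ≤ b → b ≤ s → ENNReal.ofReal (κ * (b - a)) ≤ ν (Set.Ioc a b))
    (w : ℝ) :
    κ / 4 * min |w| s ^ 2 ≤ ∫ e, checkLoss τ (e - w) - checkLoss τ e ∂ν := by
  set u := min |w| s with hu
  have hu0 : 0 ≤ u := le_min (abs_nonneg _) hs.le
  have hus : u ≤ s := min_le_right _ _
  have hmeas : Measurable fun e => checkLoss τ (e - w) - checkLoss τ e :=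
    (measurable_checkLoss.comp (measurable_id.sub_const w)).sub measurable_checkLoss
  have hint : Integrable (fun e => checkLoss τ (e - w) - checkLoss τ e) ν := by
    refine (integrable_const |w|).mono' hmeas.aestronglyMeasurable (Eventually.of_forall fun e => ?_)
    refine (abs_checkLoss_sub_le h0 h1 _ _).trans (le_of_eq ?_)
    rw [sub_sub_cancel_left, abs_neg]
  have hJ : κ * (u / 2) ≤ ν.real (gainSet s w) := by
    have : ENNReal.ofReal (κ * (u / 2)) ≤ ν (gainSet s w) := by
      unfold gainSet
      split_ifs
      · refine le_trans (le_of_eq ?_) (hd 0 (u / 2) (by linarith) (by linarith) (by linarith))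
        rw [sub_zero]
      · refine le_trans (le_of_eq ?_) (hd (-(u / 2)) 0 (by linarith) (by linarith) hs.le)
        rw [zero_sub, neg_neg]
    rw [Measure.real]
    exact (ENNReal.ofReal_le_iff_le_toReal (measure_ne_top _ _)).mp this
  have hq' : ν.real (Set.Iic 0) = τ := by
    rw [Measure.real, hq, ENNReal.toReal_ofReal h0.le]
  have hi1 : Integrable (fun e => -w * (τ - (Set.Iic (0 : ℝ)).indicator 1 e)) ν :=
    ((integrable_const τ).sub ((integrable_const 1).indicator measurableSet_Iic)).const_mul _
  have hi2 : Integrable (fun e => u / 2 * (gainSet s w).indicator 1 e) ν :=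
    ((integrable_const 1).indicator (measurableSet_gainSet s w)).const_mul _
  have hmono := integral_mono (hi1.add hi2) hint fun e => checkLoss_sub_ge hs e w
  refine le_trans ?_ hmono
  have hi3 : Integrable ((Set.Iic (0 : ℝ)).indicator (1 : ℝ → ℝ)) ν :=
    (integrable_const 1).indicator measurableSet_Iic
  -- The quantile condition makes the linear part vanish in mean, leaving `u / 2` times a mass of at
  -- least `κ u / 2`.
  have e : ∫ e, ((fun e => -w * (τ - (Set.Iic (0 : ℝ)).indicator 1 e)) +
      fun e => u / 2 * (gainSet s w).indicator 1 e) e ∂ν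
      = u / 2 * ν.real (gainSet s w) := by
    rw [integral_add' hi1 hi2, integral_const_mul, integral_const_mul,
      integral_sub (integrable_const τ) hi3, integral_indicator_one measurableSet_Iic,
      integral_indicator_one (measurableSet_gainSet s w), hq']
    simp
  rw [e]
  have := mul_le_mul_of_nonneg_left hJ ((by linarith : (0:ℝ) ≤ u / 2))
  linarith

end CheckLoss

/-! ### Covariances under strong mixing -/

section Mixing

variable {Ω : Type*} {m0 : MeasurableSpace Ω} {μ : Measure Ω} [IsProbabilityMeasure μ]

/-- The covariance of a bounded `m`-measurable variable with `g` is controlled by the covariance of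
`g` with the indicator of an event in `m`. -/
lemma exists_abs_cov_le {m : MeasurableSpace Ω} (hm : m ≤ m0) {f g : Ω → ℝ} (hf : Measurable[m] f)
    {H : ℝ} (hH : 0 ≤ H) (hfH : ∀ ω, |f ω| ≤ H) (hg : Integrable g μ) :
    ∃ A : Set Ω, MeasurableSet[m] A ∧
      |∫ ω, f ω * g ω ∂μ - (∫ ω, f ω ∂μ) * ∫ ω, g ω ∂μ|
        ≤ 2 * H * |∫ ω in A, g ω ∂μ - μ.real A * ∫ ω, g ω ∂μ| := by
  set G := ∫ ω, g ω ∂μ with hG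
  set c : Ω → ℝ := fun ω => (μ[g | m]) ω - G with hc
  have hcm : Measurable[m] c := (stronglyMeasurable_condExp.measurable).sub_const G
  have hci : Integrable c μ := integrable_condExp.sub (integrable_const G)
  -- Since `c` has mean zero, `E|c|` is twice its integral over the event where it is nonnegative;
  -- this event replaces `f`.
  set A : Set Ω := {ω | 0 ≤ c ω} with hA
  have hAm : MeasurableSet[m] A := measurableSet_le measurable_const hcm
  have hAm0 : MeasurableSet[m0] A := hm _ hAm
  have hfm0 : AEStronglyMeasurable[m0] f μ := (hf.mono hm le_rfl).aestronglyMeasurable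
  have hfi : Integrable f μ := (integrable_const H).mono' hfm0 (Eventually.of_forall hfH)
  have hfg : Integrable (f * g) μ := hg.bdd_mul (c := H) hfm0 (Eventually.of_forall hfH)
  have hfc : Integrable (fun ω => f ω * c ω) μ := hci.bdd_mul (c := H) hfm0 (Eventually.of_forall hfH)
  have e1 : ∫ ω, f ω * g ω ∂μ - (∫ ω, f ω ∂μ) * G = ∫ ω, f ω * c ω ∂μ := by
    have h1 : ∫ ω, f ω * g ω ∂μ = ∫ ω, f ω * (μ[g | m]) ω ∂μ := by
      rw [← integral_condExp hm (f := fun ω => f ω * g ω)]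
      exact integral_congr_ae (condExp_mul_of_stronglyMeasurable_left hf.stronglyMeasurable hfg hg)
    have hfi2 : Integrable (fun ω => f ω * (μ[g | m]) ω) μ :=
      integrable_condExp.bdd_mul (c := H) hfm0 (Eventually.of_forall hfH)
    simp only [hc, mul_sub]
    rw [integral_sub hfi2 (hfi.mul_const G), integral_mul_const, h1]
  have e2 : ∫ ω in A, c ω ∂μ = ∫ ω in A, g ω ∂μ - μ.real A * G := by
    simp only [hc]
    rw [integral_sub integrable_condExp.integrableOn (integrable_const G).integrableOn,
      setIntegral_condExp hm hg hAm, setIntegral_const, smul_eq_mul]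
  have e3 : ∫ ω, c ω ∂μ = 0 := by
    simp only [hc]
    rw [integral_sub integrable_condExp (integrable_const G), integral_condExp hm]
    simp [hG]
  have e4 : ∫ ω, |c ω| ∂μ = 2 * ∫ ω in A, c ω ∂μ := by
    have h1 := integral_add_compl hAm0 hci
    have h2 := integral_add_compl hAm0 hci.abs
    have h3 : ∫ ω in A, |c ω| ∂μ = ∫ ω in A, c ω ∂μ :=
      setIntegral_congr_fun hAm0 fun ω hω => abs_of_nonneg hω
    have h4 : ∫ ω in Aᶜ, |c ω| ∂μ = - ∫ ω in Aᶜ, c ω ∂μ := by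
      rw [← integral_neg]
      exact setIntegral_congr_fun hAm0.compl fun ω hω => abs_of_neg (not_le.mp hω)
    linarith
  refine ⟨A, hAm, ?_⟩
  rw [e1, ← e2]
  calc |∫ ω, f ω * c ω ∂μ| ≤ ∫ ω, |f ω * c ω| ∂μ := abs_integral_le_integral_abs
    _ ≤ ∫ ω, H * |c ω| ∂μ := by
      refine integral_mono hfc.abs (hci.abs.const_mul H) fun ω => ?_
      rw [abs_mul]
      exact mul_le_mul_of_nonneg_right (hfH ω) (abs_nonneg _)
    _ = 2 * H * ∫ ω in A, c ω ∂μ := by rw [integral_const_mul, e4]; ring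
    _ ≤ _ := mul_le_mul_of_nonneg_left (le_abs_self _) (by positivity)

/-- The reduction to an indicator is made twice, first for `f` and then for `g` against the
indicator obtained; each costs a factor `2H`. -/
lemma abs_cov_le_of_mixing {m m' : MeasurableSpace Ω} (hm : m ≤ m0) (hm' : m' ≤ m0) {a : ℝ}
    (hmix : ∀ A B : Set Ω, MeasurableSet[m] A → MeasurableSet[m'] B →
      |μ.real (A ∩ B) - μ.real A * μ.real B| ≤ a)
    {f g : Ω → ℝ} (hf : Measurable[m] f) (hg : Measurable[m'] g) {H : ℝ} (hH : 0 ≤ H)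
    (hfH : ∀ ω, |f ω| ≤ H) (hgH : ∀ ω, |g ω| ≤ H) :
    |∫ ω, f ω * g ω ∂μ - (∫ ω, f ω ∂μ) * ∫ ω, g ω ∂μ| ≤ 4 * H ^ 2 * a := by
  have hgm0 : AEStronglyMeasurable[m0] g μ := (hg.mono hm' le_rfl).aestronglyMeasurable
  have hgi : Integrable g μ := (integrable_const H).mono' hgm0 (Eventually.of_forall hgH)
  obtain ⟨A, hA, h1⟩ := exists_abs_cov_le hm hf hH hfH hgi
  have hA0 := hm _ hA
  obtain ⟨B, hB, h2⟩ := exists_abs_cov_le hm' hg hH hgH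
    ((integrable_const (1 : ℝ)).indicator hA0 : Integrable (A.indicator fun _ => (1 : ℝ)) μ)
  have hB0 := hm' _ hB
  have e1 : ∫ ω, g ω * A.indicator (fun _ => (1 : ℝ)) ω ∂μ = ∫ ω in A, g ω ∂μ := by
    rw [← integral_indicator hA0]
    refine integral_congr_ae (Eventually.of_forall fun ω => ?_)
    by_cases h : ω ∈ A <;> simp [h]
  have e2 : ∫ ω, A.indicator (fun _ => (1 : ℝ)) ω ∂μ = μ.real A := by
    rw [integral_indicator hA0]; simp
  have e3 : ∫ ω in B, A.indicator (fun _ => (1 : ℝ)) ω ∂μ = μ.real (A ∩ B) := by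
    rw [integral_indicator hA0, Measure.restrict_restrict hA0]
    simp
  rw [e1, e2, e3] at h2
  rw [mul_comm (∫ ω, g ω ∂μ), mul_comm (μ.real B)] at h2
  have h3 := h2.trans (mul_le_mul_of_nonneg_left (hmix A B hA hB) (by positivity))
  refine h1.trans ((mul_le_mul_of_nonneg_left h3 (by positivity)).trans (le_of_eq ?_))
  ring

/-- Each lag occurs at most once on either side of `t`. -/
lemma sum_dist_le_tsum {a : ℕ → ℝ} (ha : Summable a) (h0 : ∀ h, 0 ≤ a h) (T t : ℕ) :
    ∑ s ∈ Finset.range T, a (if t ≤ s then s - t else t - s) ≤ 2 * ∑' h, a h := by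
  rw [← Finset.sum_filter_add_sum_filter_not (Finset.range T) fun s => t ≤ s, two_mul]
  refine add_le_add ?_ ?_
  · have e : ∑ s ∈ (Finset.range T).filter fun s => t ≤ s, a (if t ≤ s then s - t else t - s)
        = ∑ h ∈ ((Finset.range T).filter fun s => t ≤ s).image fun s => s - t, a h := by
      rw [Finset.sum_image]
      · exact Finset.sum_congr rfl fun s hs => by rw [if_pos (Finset.mem_filter.mp hs).2]
      · intro x hx y hy hxy
        have h1 := (Finset.mem_filter.mp hx).2
        have h2 := (Finset.mem_filter.mp hy).2
        simp only at hxy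
        omega
    rw [e]
    exact ha.sum_le_tsum _ fun h _ => h0 h
  · have e : ∑ s ∈ (Finset.range T).filter fun s => ¬ t ≤ s, a (if t ≤ s then s - t else t - s)
        = ∑ h ∈ ((Finset.range T).filter fun s => ¬ t ≤ s).image fun s => t - s, a h := by
      rw [Finset.sum_image]
      · exact Finset.sum_congr rfl fun s hs => by rw [if_neg (Finset.mem_filter.mp hs).2]
      · intro x hx y hy hxy
        have h1 := (Finset.mem_filter.mp hx).2
        have h2 := (Finset.mem_filter.mp hy).2
        simp only at hxy
        omega
    rw [e]
    exact ha.sum_le_tsum _ fun h _ => h0 h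

lemma IsAlphaMixing.nonneg {μ : Measure Ω} {S : Type*} [MeasurableSpace S] {Z : ℕ → Ω → S} {a : ℕ → ℝ}
    (hmix : IsAlphaMixing μ Z a) (h : ℕ) : 0 ≤ a h :=
  (abs_nonneg _).trans (hmix 0 h ∅ ∅
    (@MeasurableSet.empty _ (⨆ s ∈ Set.Iic 0, MeasurableSpace.comap (Z s) inferInstance))
    (@MeasurableSet.empty _ (⨆ s ∈ Set.Ici (0 + h), MeasurableSpace.comap (Z s) inferInstance)))

lemma IsAlphaMixing.abs_cov_le {S : Type*} [MeasurableSpace S] {Z : ℕ → Ω → S} {a : ℕ → ℝ}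
    (hmix : IsAlphaMixing μ Z a) (hZ : ∀ t, Measurable (Z t)) {φ : S → ℝ} (hφ : Measurable φ)
    {H : ℝ} (hH : 0 ≤ H) (hφH : ∀ z, |φ z| ≤ H) {t s : ℕ} (hts : t ≤ s) :
    |∫ ω, φ (Z t ω) * φ (Z s ω) ∂μ - (∫ ω, φ (Z t ω) ∂μ) * ∫ ω, φ (Z s ω) ∂μ|
      ≤ 4 * H ^ 2 * a (s - t) := by
  refine abs_cov_le_of_mixing
    (m := ⨆ s ∈ Set.Iic t, MeasurableSpace.comap (Z s) inferInstance)
    (m' := ⨆ s' ∈ Set.Ici (t + (s - t)), MeasurableSpace.comap (Z s') inferInstance)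
    (iSup₂_le fun t _ => (hZ t).comap_le) (iSup₂_le fun t _ => (hZ t).comap_le)
    (hmix t (s - t)) ?_ ?_ hH (fun ω => hφH _) fun ω => hφH _
  · exact hφ.comp (Measurable.of_comap_le (le_iSup₂_of_le t (Set.mem_Iic.mpr le_rfl) le_rfl))
  · exact hφ.comp (Measurable.of_comap_le
      (le_iSup₂_of_le s (Set.mem_Ici.mpr (by omega)) le_rfl))

/-- Under summable mixing, averages of a bounded function with nonnegative means are
asymptotically nonnegative, with a rate that depends only on the bounds. -/
lemma IsAlphaMixing.measure_average_le {S : Type*} [MeasurableSpace S] {Z : ℕ → Ω → S} {a : ℕ → ℝ}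
    (hmix : IsAlphaMixing μ Z a) (ha : Summable a) (hZ : ∀ t, Measurable (Z t)) {φ : S → ℝ}
    (hφ : Measurable φ) {H : ℝ} (hH : 0 ≤ H) (hφH : ∀ z, |φ z| ≤ H)
    (hmean : ∀ t, 0 ≤ ∫ ω, φ (Z t ω) ∂μ) {η : ℝ} (hη : 0 < η) {T : ℕ} (hT : 0 < T) :
    μ.real {ω | (T : ℝ)⁻¹ * ∑ t ∈ Finset.range T, φ (Z t ω) ≤ -η}
      ≤ 8 * H ^ 2 * (∑' h, a h) / (T * η ^ 2) := by
  have hT' : (0 : ℝ) < T := by exact_mod_cast hT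
  set e : ℕ → ℝ := fun t => ∫ ω, φ (Z t ω) ∂μ with he
  set x : ℕ → Ω → ℝ := fun t ω => φ (Z t ω) - e t with hx
  have hmeas : ∀ t, Measurable fun ω => φ (Z t ω) := fun t => hφ.comp (hZ t)
  have hφi : ∀ t, Integrable (fun ω => φ (Z t ω)) μ := fun t =>
    (integrable_const H).mono' (hmeas t).aestronglyMeasurable (Eventually.of_forall fun ω => hφH _)
  have hφφ : ∀ t s, Integrable (fun ω => φ (Z t ω) * φ (Z s ω)) μ := fun t s =>
    (hφi s).bdd_mul (c := H) (hmeas t).aestronglyMeasurable (Eventually.of_forall fun ω => hφH _)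
  have hexp : ∀ t s ω, x t ω * x s ω
      = φ (Z t ω) * φ (Z s ω) - e s * φ (Z t ω) - e t * φ (Z s ω) + e t * e s := by
    intro t s ω
    simp only [hx]; ring
  have hi1 : ∀ t s, Integrable (fun ω => φ (Z t ω) * φ (Z s ω) - e s * φ (Z t ω)) μ :=
    fun t s => (hφφ t s).sub ((hφi t).const_mul _)
  have hi2 : ∀ t s, Integrable
      (fun ω => φ (Z t ω) * φ (Z s ω) - e s * φ (Z t ω) - e t * φ (Z s ω)) μ :=
    fun t s => (hi1 t s).sub ((hφi s).const_mul _)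
  have hxx : ∀ t s, Integrable (fun ω => x t ω * x s ω) μ := by
    intro t s
    simp only [hexp]
    exact (hi2 t s).add (integrable_const _)
  have hcov : ∀ t s, ∫ ω, x t ω * x s ω ∂μ
      = ∫ ω, φ (Z t ω) * φ (Z s ω) ∂μ - e t * e s := by
    intro t s
    simp only [hexp]
    rw [integral_add (hi2 t s) (integrable_const _), integral_sub (hi1 t s) ((hφi s).const_mul _),
      integral_sub (hφφ t s) ((hφi t).const_mul _), integral_const_mul, integral_const_mul]
    simp [he]
    ring
  have hbound : ∀ t s, ∫ ω, x t ω * x s ω ∂μ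
      ≤ 4 * H ^ 2 * a (if t ≤ s then s - t else t - s) := by
    intro t s
    rw [hcov]
    split_ifs with h
    · exact (le_abs_self _).trans (hmix.abs_cov_le hZ hφ hH hφH h)
    · have := (le_abs_self _).trans (hmix.abs_cov_le hZ hφ hH hφH (not_le.mp h).le)
      rw [mul_comm (e t)]
      simpa only [mul_comm (φ (Z s _))] using this
  set Sx : Ω → ℝ := fun ω => ∑ t ∈ Finset.range T, x t ω with hSx
  have hSq : ∀ ω, Sx ω ^ 2 = ∑ t ∈ Finset.range T, ∑ s ∈ Finset.range T, x t ω * x s ω := by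
    intro ω
    rw [sq, Finset.sum_mul_sum]
  have hSi : Integrable (fun ω => Sx ω ^ 2) μ := by
    simp only [hSq]
    exact integrable_finsetSum _ fun t _ => integrable_finsetSum _ fun s _ => hxx t s
  have hvar : ∫ ω, Sx ω ^ 2 ∂μ ≤ T * (8 * H ^ 2 * ∑' h, a h) := by
    simp only [hSq]
    rw [integral_finsetSum _ fun t _ => integrable_finsetSum _ fun s _ => hxx t s]
    have h1 : ∀ t ∈ Finset.range T, ∫ ω, ∑ s ∈ Finset.range T, x t ω * x s ω ∂μ
        ≤ 8 * H ^ 2 * ∑' h, a h := by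
      intro t _
      rw [integral_finsetSum _ fun s _ => hxx t s]
      refine (Finset.sum_le_sum fun s _ => hbound t s).trans ?_
      rw [← Finset.mul_sum]
      have := mul_le_mul_of_nonneg_left (sum_dist_le_tsum ha hmix.nonneg T t)
        (by positivity : 0 ≤ 4 * H ^ 2)
      linarith
    refine (Finset.sum_le_sum h1).trans ?_
    simp
  have hcheb := mul_meas_ge_le_integral_of_nonneg
    (Eventually.of_forall fun ω => sq_nonneg (Sx ω)) hSi ((T * η) ^ 2)
  -- The means are nonnegative, so a negative average forces an even larger negative deviation of
  -- the centered sum, and Chebyshev applies with variance `O(T)`.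
  have hsub : {ω | (T : ℝ)⁻¹ * ∑ t ∈ Finset.range T, φ (Z t ω) ≤ -η}
      ⊆ {ω | (T * η) ^ 2 ≤ Sx ω ^ 2} := by
    intro ω hω
    simp only [Set.mem_ofPred_eq] at hω ⊢
    rw [inv_mul_le_iff₀ hT'] at hω
    have h1 : Sx ω ≤ -(T * η) := by
      simp only [hSx, hx, Finset.sum_sub_distrib]
      have : 0 ≤ ∑ t ∈ Finset.range T, e t := Finset.sum_nonneg fun t _ => hmean t
      linarith
    have h2 : 0 < T * η := by positivity
    nlinarith
  have h3 : μ.real {ω | (T : ℝ)⁻¹ * ∑ t ∈ Finset.range T, φ (Z t ω) ≤ -η}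
      ≤ μ.real {ω | (T * η) ^ 2 ≤ Sx ω ^ 2} := measureReal_mono hsub
  refine h3.trans ?_
  rw [le_div_iff₀ (by positivity)]
  have h4 := hcheb.trans hvar
  have h5 : T * (μ.real {ω | (T * η) ^ 2 ≤ Sx ω ^ 2} * (T * η ^ 2))
      ≤ T * (8 * H ^ 2 * ∑' h, a h) := by
    refine le_trans (le_of_eq ?_) h4
    ring
  exact le_of_mul_le_mul_left h5 hT'

end Mixing

/-! ### Deterministic bounds for quantile regression -/

/-- Truncation of a real number to `[-m, m]`. -/
def clip (m u : ℝ) : ℝ := max (-m) (min m u)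

lemma abs_clip_le {m : ℝ} (hm : 0 ≤ m) (u : ℝ) : |clip m u| ≤ m := by
  unfold clip
  rw [abs_le]
  exact ⟨le_max_left _ _, max_le (by linarith) (min_le_left _ _)⟩

lemma clip_of_abs_le {m u : ℝ} (h : |u| ≤ m) : clip m u = u := by
  obtain ⟨h1, h2⟩ := abs_le.mp h
  rw [clip, min_eq_right h2, max_eq_right h1]

/-- The truncation error is expressed by the fourth power, for which sample moments of the
regressors are bounded. -/
lemma abs_sub_clip_le {m : ℝ} (hm : 0 < m) (u : ℝ) : |u - clip m u| ≤ u ^ 4 / m ^ 3 := by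
  by_cases h : |u| ≤ m
  · rw [clip_of_abs_le h, sub_self, abs_zero]
    positivity
  · push Not at h
    have h1 : |u - clip m u| ≤ |u| := by
      unfold clip
      grind
    have h2 : |u| * m ^ 3 ≤ u ^ 4 := by
      calc |u| * m ^ 3 ≤ |u| * |u| ^ 3 := by gcongr
        _ = u ^ 4 := by rw [← pow_succ', Even.pow_abs (by decide)]
    exact h1.trans ((le_div_iff₀ (by positivity)).mpr h2)

lemma min_abs_clip {m s : ℝ} (hs : 0 < s) (hsm : s ≤ m) (u : ℝ) :
    min |clip m u| s = min |u| s := by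
  unfold clip
  grind

/-- For `|u| ≥ s` the left side is `s² - (s - b u²/(2s))²`. The capped quadratic gain is thus traded
for second and fourth moments, the latter with the small weight `b²`. -/
lemma min_abs_sq_ge {b s : ℝ} (hs : 0 < s) (hb1 : b ≤ 1) (u : ℝ) :
    b * u ^ 2 - b ^ 2 * u ^ 4 / (4 * s ^ 2) ≤ min |u| s ^ 2 := by
  rcases le_total |u| s with h | h
  · rw [min_eq_left h, sq_abs]
    have : 0 ≤ b ^ 2 * u ^ 4 / (4 * s ^ 2) := by positivity
    nlinarith [sq_nonneg u]
  · rw [min_eq_right h]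
    have h1 : b * u ^ 2 - b ^ 2 * u ^ 4 / (4 * s ^ 2) = s ^ 2 - (s - b * u ^ 2 / (2 * s)) ^ 2 := by
      field_simp
      ring
    rw [h1]
    nlinarith [sq_nonneg (s - b * u ^ 2 / (2 * s))]

section Deterministic

open Panel

variable {τ : ℝ} {d T : ℕ} {x : Fin T → Fin d → ℝ} {e : Fin T → ℝ}

lemma abs_dotProduct_le_of_sqNorm_le {v δ : Fin d → ℝ} {ρ : ℝ} (hρ : 0 ≤ ρ) (h : sqNorm δ ≤ ρ ^ 2) :
    |v ⬝ᵥ δ| ≤ ρ * (1 + sqNorm v ^ 2) := by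
  have h1 := dotProduct_sq_le v δ
  have h0 := sqNorm_nonneg v
  refine abs_le_of_sq_le_sq ?_ (by positivity)
  calc (v ⬝ᵥ δ) ^ 2 ≤ sqNorm v * ρ ^ 2 := h1.trans (mul_le_mul_of_nonneg_left h h0)
    _ ≤ (1 + sqNorm v ^ 2) ^ 2 * ρ ^ 2 := by
      refine mul_le_mul_of_nonneg_right ?_ (sq_nonneg _)
      nlinarith [sq_nonneg (sqNorm v - 1), sq_nonneg (sqNorm v ^ 2)]
    _ = (ρ * (1 + sqNorm v ^ 2)) ^ 2 := by ring

lemma dotProduct_pow_four_le (v δ : Fin d → ℝ) : (v ⬝ᵥ δ) ^ 4 ≤ sqNorm v ^ 2 * sqNorm δ ^ 2 := by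
  have h1 := pow_le_pow_left₀ (sq_nonneg _) (dotProduct_sq_le v δ) 2
  calc (v ⬝ᵥ δ) ^ 4 = ((v ⬝ᵥ δ) ^ 2) ^ 2 := by ring
    _ ≤ _ := h1
    _ = _ := by ring

lemma average_dotProduct_pow_four_le {C : ℝ} (hC : (T : ℝ)⁻¹ * ∑ t, sqNorm (x t) ^ 2 ≤ C)
    (δ : Fin d → ℝ) : (T : ℝ)⁻¹ * ∑ t, (x t ⬝ᵥ δ) ^ 4 ≤ C * sqNorm δ ^ 2 := by
  refine le_trans ?_ (mul_le_mul_of_nonneg_right hC (sq_nonneg _))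
  rw [mul_assoc, Finset.sum_mul]
  exact mul_le_mul_of_nonneg_left (Finset.sum_le_sum fun t _ => dotProduct_pow_four_le _ _)
    (by positivity)

/-- By convexity, a quantile regression estimate outside a ball forces a point of the sphere where
the loss does not exceed the loss at the center. -/
lemma exists_sphere_point {θ : ℝ} (hθ : 0 < θ) {δ : Fin d → ℝ} (hδ : θ ^ 2 < sqNorm δ)
    (hmin : (T : ℝ)⁻¹ * ∑ t, (checkLoss τ (e t - x t ⬝ᵥ δ) - checkLoss τ (e t)) ≤ 0) :
    ∃ δ', sqNorm δ' = θ ^ 2 ∧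
      (T : ℝ)⁻¹ * ∑ t, (checkLoss τ (e t - x t ⬝ᵥ δ') - checkLoss τ (e t)) ≤ 0 := by
  have hn : 0 < sqNorm δ := lt_trans (by positivity) hδ
  set s := θ / √(sqNorm δ) with hs
  have hsq : s ^ 2 * sqNorm δ = θ ^ 2 := by
    rw [hs, div_pow, Real.sq_sqrt hn.le, div_mul_cancel₀ _ hn.ne']
  have hs0 : 0 ≤ s := by positivity
  have hs1 : s ≤ 1 := by
    rw [hs, div_le_one (Real.sqrt_pos.mpr hn)]
    exact Real.le_sqrt_of_sq_le hδ.le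
  refine ⟨s • δ, by rw [sqNorm_smul, hsq], ?_⟩
  refine le_trans ?_ (mul_nonpos_of_nonneg_of_nonpos hs0 hmin)
  rw [mul_left_comm s, Finset.mul_sum _ _ s]
  refine mul_le_mul_of_nonneg_left (Finset.sum_le_sum fun t _ => ?_)
    (inv_nonneg.mpr (Nat.cast_nonneg (α := ℝ) T))
  have := checkLoss_convex (τ := τ) hs0 hs1 (e t - x t ⬝ᵥ δ) (e t)
  have h2 : e t - x t ⬝ᵥ (s • δ) = s * (e t - x t ⬝ᵥ δ) + (1 - s) * e t := by
    rw [dotProduct_smul, smul_eq_mul]; ring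
  rw [h2]
  linarith

/-- The truncated increment of the quantile loss minus a lower bound of its conditional mean. -/
def truncIncr (τ κ s m : ℝ) (δ v : Fin d → ℝ) (e : ℝ) : ℝ :=
  checkLoss τ (e - clip m (v ⬝ᵥ δ)) - checkLoss τ e - κ / 4 * min |clip m (v ⬝ᵥ δ)| s ^ 2

/-- A point of the sphere whose loss does not exceed that at the center drives the truncated average
at a nearby net point below zero. Of the quadratic gain `κbcθ²/4` the fourth moments take half, and
discretization and truncation take `κbcθ²/32` each. -/
lemma average_truncIncr_le (h0 : 0 < τ) (h1 : τ < 1) (hT : 0 < T) {κ s m c C θ ρ b : ℝ}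
    (hκ : 0 < κ) (hs : 0 < s) (hsm : s ≤ m) (hc : 0 < c) (hθ : 0 < θ) (hρ : 0 ≤ ρ)
    (hb0 : 0 < b) (hb1 : b ≤ 1) (hb : b * (C * θ ^ 2) ≤ 2 * c * s ^ 2)
    (hρ' : ρ * (1 + C) ≤ κ * b * c * θ ^ 2 / 32)
    (hm : C * θ ^ 4 / m ^ 3 ≤ κ * b * c * θ ^ 2 / 32)
    (hC : (T : ℝ)⁻¹ * ∑ t, sqNorm (x t) ^ 2 ≤ C) {δ δ' : Fin d → ℝ}
    (hδ : (T : ℝ)⁻¹ * ∑ t, (checkLoss τ (e t - x t ⬝ᵥ δ) - checkLoss τ (e t)) ≤ 0)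
    (hδ' : sqNorm δ' = θ ^ 2) (hdist : sqNorm (δ - δ') ≤ ρ ^ 2)
    (hA : c * sqNorm δ' ≤ (T : ℝ)⁻¹ * ∑ t, (x t ⬝ᵥ δ') ^ 2) :
    (T : ℝ)⁻¹ * ∑ t, truncIncr τ κ s m δ' (x t) (e t) ≤ -(κ * b * c * θ ^ 2 / 16) := by
  have hT' : (0 : ℝ) < T := by exact_mod_cast hT
  have hm0 : 0 < m := hs.trans_le hsm
  have hpt : ∀ t, truncIncr τ κ s m δ' (x t) (e t)
      ≤ (checkLoss τ (e t - x t ⬝ᵥ δ) - checkLoss τ (e t)) + ρ * (1 + sqNorm (x t) ^ 2)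
        + (m ^ 3)⁻¹ * (x t ⬝ᵥ δ') ^ 4 - κ / 4 * b * (x t ⬝ᵥ δ') ^ 2
        + κ / 4 * b ^ 2 / (4 * s ^ 2) * (x t ⬝ᵥ δ') ^ 4 := by
    intro t
    unfold truncIncr
    rw [min_abs_clip hs hsm]
    have a1 := mul_le_mul_of_nonneg_left (min_abs_sq_ge hs hb1 (x t ⬝ᵥ δ'))
      (by positivity : 0 ≤ κ / 4)
    have a2 := (le_abs_self _).trans
      (abs_checkLoss_sub_le h0 h1 (e t - clip m (x t ⬝ᵥ δ')) (e t - x t ⬝ᵥ δ'))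
    have a3 := (le_abs_self _).trans
      (abs_checkLoss_sub_le h0 h1 (e t - x t ⬝ᵥ δ') (e t - x t ⬝ᵥ δ))
    rw [sub_sub_sub_cancel_left] at a2 a3
    rw [← dotProduct_sub] at a3
    have a4 := abs_sub_clip_le hm0 (x t ⬝ᵥ δ')
    have a5 := abs_dotProduct_le_of_sqNorm_le (v := x t) hρ hdist
    have a6 : (x t ⬝ᵥ δ') ^ 4 / m ^ 3 = (m ^ 3)⁻¹ * (x t ⬝ᵥ δ') ^ 4 := by ring
    have a7 : κ / 4 * (b * (x t ⬝ᵥ δ') ^ 2 - b ^ 2 * (x t ⬝ᵥ δ') ^ 4 / (4 * s ^ 2))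
      = κ / 4 * b * (x t ⬝ᵥ δ') ^ 2 - κ / 4 * b ^ 2 / (4 * s ^ 2) * (x t ⬝ᵥ δ') ^ 4 := by ring
    linarith
  have hsum := mul_le_mul_of_nonneg_left (Finset.sum_le_sum fun t (_ : t ∈ Finset.univ) => hpt t)
    (inv_nonneg.mpr hT'.le)
  simp only [Finset.sum_add_distrib, Finset.sum_sub_distrib, ← Finset.mul_sum, mul_add, mul_sub]
    at hsum hδ
  have q4 := average_dotProduct_pow_four_le hC δ'
  rw [hδ'] at q4 hA
  have e1 : (T : ℝ)⁻¹ * ∑ _t : Fin T, (1 : ℝ) = 1 := by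
    simp [hT'.ne']
  have b1 : (T : ℝ)⁻¹ * (ρ * ∑ _t : Fin T, (1 : ℝ)) + (T : ℝ)⁻¹ * (ρ * ∑ t, sqNorm (x t) ^ 2)
      ≤ ρ * (1 + C) := by
    rw [mul_left_comm, e1, mul_left_comm, ← mul_add]
    exact mul_le_mul_of_nonneg_left (by linarith) hρ
  have b2 : (T : ℝ)⁻¹ * ((m ^ 3)⁻¹ * ∑ t, (x t ⬝ᵥ δ') ^ 4) ≤ C * θ ^ 4 / m ^ 3 := by
    rw [mul_left_comm]
    refine (mul_le_mul_of_nonneg_left q4 (by positivity)).trans (le_of_eq ?_)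
    ring
  have b3 : κ / 4 * b * (c * θ ^ 2) ≤ (T : ℝ)⁻¹ * (κ / 4 * b * ∑ t, (x t ⬝ᵥ δ') ^ 2) := by
    rw [mul_left_comm (T : ℝ)⁻¹]
    exact mul_le_mul_of_nonneg_left hA (by positivity)
  have b4 : (T : ℝ)⁻¹ * (κ / 4 * b ^ 2 / (4 * s ^ 2) * ∑ t, (x t ⬝ᵥ δ') ^ 4)
      ≤ κ / 4 * b * (c * θ ^ 2) / 2 := by
    rw [mul_left_comm]
    refine (mul_le_mul_of_nonneg_left q4 (by positivity)).trans ?_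
    have e2 : κ / 4 * b ^ 2 / (4 * s ^ 2) * (C * (θ ^ 2) ^ 2)
        = κ / 4 * b * θ ^ 2 / (4 * s ^ 2) * (b * (C * θ ^ 2)) := by ring
    rw [e2]
    refine (mul_le_mul_of_nonneg_left hb (by positivity)).trans (le_of_eq ?_)
    field_simp
    ring
  linarith

/-- A crude bound for the quantile regression estimate. -/
lemma sqNorm_le_of_quantLoss_le (h0 : 0 < τ) (h1 : τ < 1) (hT : 0 < T) {c C : ℝ}
    (hc : 0 < c) (hC0 : 0 < C) (hC : (T : ℝ)⁻¹ * ∑ t, sqNorm (x t) ^ 2 ≤ C) {δ : Fin d → ℝ}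
    (hδ : (T : ℝ)⁻¹ * ∑ t, (checkLoss τ (e t - x t ⬝ᵥ δ) - checkLoss τ (e t)) ≤ 0)
    (hA : c * sqNorm δ ≤ (T : ℝ)⁻¹ * ∑ t, (x t ⬝ᵥ δ) ^ 2) :
    sqNorm δ ≤ 32 * C / (c ^ 3 * min τ (1 - τ) ^ 2) * ((T : ℝ)⁻¹ * ∑ t, e t ^ 2) := by
  have hT' : (0 : ℝ) < T := by exact_mod_cast hT
  set τ0 := min τ (1 - τ) with hτ0
  have hτ0p : 0 < τ0 := lt_min h0 (by linarith)
  have hτ01 : τ0 ≤ 1 := (min_le_left _ _).trans h1.le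
  have hV : 0 ≤ (T : ℝ)⁻¹ * ∑ t, e t ^ 2 :=
    mul_nonneg (by positivity) (Finset.sum_nonneg fun t _ => sq_nonneg _)
  rcases (sqNorm_nonneg δ).eq_or_lt with hz | hn
  · rw [← hz]; positivity
  set n := √(sqNorm δ) with hndef
  have hn0 : 0 < n := Real.sqrt_pos.mpr hn
  have hn2 : n ^ 2 = sqNorm δ := Real.sq_sqrt hn.le
  set K := √(2 * C / c) with hK
  have hK0 : 0 < K := Real.sqrt_pos.mpr (by positivity)
  have hK2 : K ^ 2 = 2 * C / c := Real.sq_sqrt (by positivity)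
  have hlow : n * (c / (2 * K)) ≤ (T : ℝ)⁻¹ * ∑ t, |x t ⬝ᵥ δ| := by
    -- This is `u² - u⁴ ≤ u` for `u ≥ 0`, rescaled: second and fourth moments bound the first from
    -- below. The value `K² = 2C/c` makes the fourth-moment term half of the second-moment term.
    have hpt : ∀ t, (K * n)⁻¹ * (x t ⬝ᵥ δ) ^ 2 - ((K * n) ^ 3)⁻¹ * (x t ⬝ᵥ δ) ^ 4 ≤ |x t ⬝ᵥ δ| := by
      intro t
      have hp : 0 < K * n := by positivity
      set u := |x t ⬝ᵥ δ| / (K * n) with hu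
      have hu0 : 0 ≤ u := by positivity
      have e1 : |x t ⬝ᵥ δ| = K * n * u := by rw [hu]; field_simp
      have e2 : (x t ⬝ᵥ δ) ^ 2 = (K * n * u) ^ 2 := by rw [← e1, sq_abs]
      have e4 : (x t ⬝ᵥ δ) ^ 4 = (K * n * u) ^ 4 := by rw [← e1, Even.pow_abs (by decide)]
      rw [e1, e2, e4]
      have e5 : (K * n)⁻¹ * (K * n * u) ^ 2 - ((K * n) ^ 3)⁻¹ * (K * n * u) ^ 4
          = K * n * (u ^ 2 - u ^ 4) := by field_simp
      rw [e5]
      refine mul_le_mul_of_nonneg_left ?_ hp.le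
      have : 0 ≤ u * (1 - u + u ^ 3) := by
        refine mul_nonneg hu0 ?_
        rcases le_total u 1 with h | h
        · have := pow_nonneg hu0 3; linarith
        · nlinarith [mul_nonneg hu0 (by nlinarith : 0 ≤ u ^ 2 - 1)]
      nlinarith
    have hsum := mul_le_mul_of_nonneg_left
      (Finset.sum_le_sum fun t (_ : t ∈ Finset.univ) => hpt t) (inv_nonneg.mpr hT'.le)
    simp only [Finset.sum_sub_distrib, ← Finset.mul_sum, mul_sub] at hsum
    have q4 := average_dotProduct_pow_four_le hC δ
    rw [mul_left_comm, mul_left_comm _ (((K * n) ^ 3)⁻¹)] at hsum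
    have b1 := mul_le_mul_of_nonneg_left hA (by positivity : 0 ≤ (K * n)⁻¹)
    have b2 := mul_le_mul_of_nonneg_left q4 (by positivity : 0 ≤ ((K * n) ^ 3)⁻¹)
    rw [← hn2] at b1 b2
    have e3 : (K * n)⁻¹ * (c * n ^ 2) - ((K * n) ^ 3)⁻¹ * (C * (n ^ 2) ^ 2) = n * (c / (2 * K)) := by
      have hCe : C = c * K ^ 2 / 2 := by rw [hK2]; field_simp
      rw [hCe]
      field_simp
      ring
    linarith
  -- The check loss dominates `min τ (1 - τ)` times the absolute value, so a loss no larger than at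
  -- the truth bounds the mean of `|xᵀδ|` by that of `|e|`.
  have hup : τ0 * ((T : ℝ)⁻¹ * ∑ t, |x t ⬝ᵥ δ|) ≤ 2 * ((T : ℝ)⁻¹ * ∑ t, |e t|) := by
    have hpt : ∀ t, τ0 * |x t ⬝ᵥ δ| - 2 * |e t|
        ≤ checkLoss τ (e t - x t ⬝ᵥ δ) - checkLoss τ (e t) := by
      intro t
      have a1 := min_mul_abs_le_checkLoss (τ := τ) (e t - x t ⬝ᵥ δ)
      have a2 := checkLoss_le_abs h0 h1 (e t)
      have a3 : |x t ⬝ᵥ δ| ≤ |e t - x t ⬝ᵥ δ| + |e t| := by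
        have := abs_sub_abs_le_abs_sub (x t ⬝ᵥ δ) (e t)
        rw [abs_sub_comm] at this
        linarith
      have a4 := mul_le_mul_of_nonneg_left a3 hτ0p.le
      have a5 := mul_le_of_le_one_left (abs_nonneg (e t)) hτ01
      linarith
    have hsum := mul_le_mul_of_nonneg_left
      (Finset.sum_le_sum fun t (_ : t ∈ Finset.univ) => hpt t) (inv_nonneg.mpr hT'.le)
    have hsum := hsum.trans hδ
    rw [Finset.sum_sub_distrib, ← Finset.mul_sum, ← Finset.mul_sum, mul_sub] at hsum
    linarith
  have hjensen : ((T : ℝ)⁻¹ * ∑ t, |e t|) ^ 2 ≤ (T : ℝ)⁻¹ * ∑ t, e t ^ 2 := by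
    have := sq_sum_le_card_mul_sum_sq (s := Finset.univ) (f := fun t => |e t|)
    simp only [sq_abs, Finset.card_univ, Fintype.card_fin] at this
    rw [mul_pow]
    refine (mul_le_mul_of_nonneg_left this (by positivity)).trans (le_of_eq ?_)
    field_simp
  have h3 : n ≤ 4 * K / (c * τ0) * ((T : ℝ)⁻¹ * ∑ t, |e t|) := by
    have := (mul_le_mul_of_nonneg_left hlow hτ0p.le).trans hup
    rw [div_mul_eq_mul_div, le_div_iff₀ (by positivity)]
    have h4 : n * (c * τ0) = 2 * K * (τ0 * (n * (c / (2 * K)))) := by field_simp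
    rw [h4]
    refine (mul_le_mul_of_nonneg_left this (by positivity)).trans (le_of_eq ?_)
    ring
  rw [← hn2]
  refine (pow_le_pow_left₀ hn0.le h3 2).trans ?_
  rw [mul_pow]
  refine (mul_le_mul_of_nonneg_left hjensen (by positivity)).trans (le_of_eq ?_)
  congr 1
  rw [div_pow, mul_pow, hK2]
  field_simp
  ring

end Deterministic

/-! ### Large deviations of the quantile regression estimates -/

lemma measurable_clip (m : ℝ) : Measurable (clip m) :=
  measurable_const.max (measurable_const.min measurable_id)

lemma measurable_truncIncr {d : ℕ} (τ κ s m : ℝ) (δ : Fin d → ℝ) :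
    Measurable fun z : (Fin d → ℝ) × ℝ => truncIncr τ κ s m δ z.1 z.2 := by
  have h0 : Measurable fun v : Fin d → ℝ => v ⬝ᵥ δ :=
    Finset.measurable_fun_sum _ fun j _ => (measurable_pi_apply j).mul_const _
  have h1 : Measurable fun z : (Fin d → ℝ) × ℝ => clip m (z.1 ⬝ᵥ δ) :=
    (measurable_clip m).comp (h0.comp measurable_fst)
  unfold truncIncr
  refine ((measurable_checkLoss.comp (measurable_snd.sub h1)).sub
    (measurable_checkLoss.comp measurable_snd)).sub (Measurable.const_mul ?_ _)
  exact ((measurable_norm.comp h1).min measurable_const).pow_const 2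

lemma abs_truncIncr_le {d : ℕ} {τ κ s m : ℝ} (h0 : 0 < τ) (h1 : τ < 1) (hκ : 0 ≤ κ) (hs : 0 ≤ s)
    (hm : 0 ≤ m) (δ v : Fin d → ℝ) (e : ℝ) : |truncIncr τ κ s m δ v e| ≤ m + κ / 4 * s ^ 2 := by
  unfold truncIncr
  refine (abs_sub _ _).trans (add_le_add ?_ ?_)
  · refine (abs_checkLoss_sub_le h0 h1 _ _).trans ?_
    rw [sub_sub_cancel_left, abs_neg]
    exact abs_clip_le hm _
  · have h2 : 0 ≤ min |clip m (v ⬝ᵥ δ)| s := le_min (abs_nonneg _) hs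
    rw [abs_of_nonneg (by positivity)]
    exact mul_le_mul_of_nonneg_left (pow_le_pow_left₀ h2 (min_le_right _ _) 2) (by positivity)

lemma continuous_sqNorm {d : ℕ} : Continuous (sqNorm : (Fin d → ℝ) → ℝ) := by
  unfold sqNorm; fun_prop

lemma isCompact_setOf_sqNorm_eq (d : ℕ) (c : ℝ) : IsCompact {v : Fin d → ℝ | sqNorm v = c} := by
  refine (isCompact_univ_pi fun _ : Fin d => isCompact_Icc (a := -√c) (b := √c)).of_isClosed_subset
    (isClosed_eq continuous_sqNorm continuous_const) fun v hv => ?_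
  refine Set.mem_univ_pi.mpr fun j => abs_le.mp (Real.abs_le_sqrt ?_)
  rw [← show sqNorm v = c from hv]
  exact Finset.single_le_sum (f := fun j => v j ^ 2) (fun j _ => sq_nonneg _) (Finset.mem_univ j)

/-- Spheres have finite nets. -/
lemma exists_finite_net (d : ℕ) (θ : ℝ) {ρ : ℝ} (hρ : 0 < ρ) :
    ∃ S : Finset (Fin d → ℝ), (∀ δ' ∈ S, sqNorm δ' = θ ^ 2) ∧
      ∀ δ, sqNorm δ = θ ^ 2 → ∃ δ' ∈ S, sqNorm (δ - δ') ≤ ρ ^ 2 := by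
  obtain ⟨S, hS, hcov⟩ := (isCompact_setOf_sqNorm_eq d (θ ^ 2)).elim_nhds_subcover
    (fun δ' => {δ | sqNorm (δ - δ') < ρ ^ 2}) fun δ' _ => by
      refine (isOpen_lt (continuous_sqNorm.comp (continuous_id.sub continuous_const))
        continuous_const).mem_nhds ?_
      show sqNorm (δ' - δ') < ρ ^ 2
      rw [sub_self, sqNorm_zero]
      positivity
  refine ⟨S, hS, fun δ hδ => ?_⟩
  obtain ⟨δ', h1, h2⟩ := Set.mem_iUnion₂.mp (hcov hδ)
  exact ⟨δ', h1, le_of_lt h2⟩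

namespace Panel

variable {Ω : Type*} [MeasurableSpace Ω] {d r : ℕ} {P : Panel Ω d r} {μ : Measure Ω}
  [IsProbabilityMeasure μ]

/-- Given `X_{it}` the clipped index is a constant shift, so the bound for the expected loss
increment applies conditionally and is then integrated. -/
lemma integral_truncIncr_nonneg (hmodel : ModelAssumption P μ) {κ s m : ℝ} (hκ : 0 < κ)
    (hs : 0 < s) (hm : 0 ≤ m) {i t : ℕ}
    (hdens : ∀ᵐ x ∂(μ.map (P.X i t)), ∀ a b : ℝ, -s ≤ a → a ≤ b → b ≤ s →
      ENNReal.ofReal (κ * (b - a)) ≤ condDistrib (P.qErr i t) (P.X i t) μ x (Set.Ioc a b))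
    (δ : Fin d → ℝ) :
    0 ≤ ∫ ω, truncIncr P.τ κ s m δ (P.X i t ω) (P.qErr i t ω) ∂μ := by
  have hX := hmodel.measurable_X i t
  have hq := measurable_qErr hmodel i t
  have hφ := measurable_truncIncr P.τ κ s m δ
  have hbd := fun v e => abs_truncIncr_le hmodel.tau_pos hmodel.tau_lt_one hκ.le hs.le hm δ v e
  have : IsProbabilityMeasure (μ.map (P.X i t)) := Measure.isProbabilityMeasure_map hX.aemeasurable
  have e1 : ∫ ω, truncIncr P.τ κ s m δ (P.X i t ω) (P.qErr i t ω) ∂μ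
      = ∫ z, truncIncr P.τ κ s m δ z.1 z.2 ∂(μ.map fun ω => (P.X i t ω, P.qErr i t ω)) := by
    rw [integral_map (hX.prodMk hq).aemeasurable hφ.aestronglyMeasurable]
  rw [e1, ← compProd_map_condDistrib hq.aemeasurable, Measure.integral_compProd]
  · refine integral_nonneg_of_ae ?_
    filter_upwards [hmodel.quantile i t, hdens] with v h1 h2
    have h3 := integral_checkLoss_sub_ge hmodel.tau_pos hmodel.tau_lt_one h1 hs h2 (clip m (v ⬝ᵥ δ))
    have hi : Integrable (fun e => checkLoss P.τ (e - clip m (v ⬝ᵥ δ)) - checkLoss P.τ e)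
        (condDistrib (P.qErr i t) (P.X i t) μ v) := by
      refine (integrable_const m).mono' (Measurable.aestronglyMeasurable ?_)
        (Eventually.of_forall fun e => ?_)
      · exact (measurable_checkLoss.comp (measurable_id.sub_const _)).sub measurable_checkLoss
      · refine (abs_checkLoss_sub_le hmodel.tau_pos hmodel.tau_lt_one _ _).trans ?_
        rw [sub_sub_cancel_left, abs_neg]
        exact abs_clip_le hm _
    simp only [truncIncr, Pi.zero_apply]
    rw [integral_sub hi (integrable_const _)]
    simp only [integral_const, probReal_univ, one_smul]
    linarith
  · exact (integrable_const (m + κ / 4 * s ^ 2)).mono' hφ.aestronglyMeasurable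
      (Eventually.of_forall fun z => hbd _ _)

/-- Outside the stated events, whose probabilities are `O(1 / T)` uniformly over units, a quantile
regression estimate based on a well-behaved design is within `θ` of the truth. -/
lemma exists_quantile_event (hmodel : ModelAssumption P μ) {κ s : ℝ} (hκ : 0 < κ) (hs : 0 < s)
    (hdens : ∀ i t, ∀ᵐ x ∂(μ.map (P.X i t)), ∀ a b : ℝ, -s ≤ a → a ≤ b → b ≤ s →
      ENNReal.ofReal (κ * (b - a)) ≤ condDistrib (P.qErr i t) (P.X i t) μ x (Set.Ioc a b))
    (hweak : WeakDependenceAssumption P μ) {θ c C : ℝ} (hθ : 0 < θ) (hc : 0 < c) (hC0 : 0 < C) :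
    ∃ (ψ : ℝ) (B : ℕ → ℕ → Set Ω), 0 ≤ ψ ∧ (∀ T i, MeasurableSet (B T i)) ∧
      (∀ T i : ℕ, 0 < T → μ.real (B T i) ≤ ψ / T) ∧
      ∀ (T i : ℕ) (ω : Ω) (δ : Fin d → ℝ), 0 < T →
        (T : ℝ)⁻¹ * ∑ t : Fin T, sqNorm (P.X i t ω) ^ 2 ≤ C →
        (∀ v, c * sqNorm v ≤ (T : ℝ)⁻¹ * ∑ t : Fin T, (P.X i t ω ⬝ᵥ v) ^ 2) →
        (T : ℝ)⁻¹ * ∑ t : Fin T, (checkLoss P.τ (P.qErr i t ω - P.X i t ω ⬝ᵥ δ)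
          - checkLoss P.τ (P.qErr i t ω)) ≤ 0 →
        θ ^ 2 < sqNorm δ → ω ∈ B T i := by
  obtain ⟨a, ha, hmix⟩ := hweak
  -- In units of `q` the quadratic gain is `8q`. The choice of `b` lets the fourth moments take at
  -- most `4q`, `ρ` and `m` limit discretization and truncation to `q` each, and a deviation of `2q`
  -- is left.
  set b := min 1 (2 * c * s ^ 2 / (C * θ ^ 2)) with hb
  have hb0 : 0 < b := lt_min one_pos (by positivity)
  have hb1 : b ≤ 1 := min_le_left _ _
  have hbC : b * (C * θ ^ 2) ≤ 2 * c * s ^ 2 := by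
    rw [← le_div_iff₀ (by positivity)]; exact min_le_right _ _
  set q := κ * b * c * θ ^ 2 / 32 with hq
  have hq0 : 0 < q := by positivity
  set ρ := q / (1 + C) with hρ
  have hρ0 : 0 < ρ := by positivity
  set m := max (max s 1) (C * θ ^ 4 / q) with hm
  have hsm : s ≤ m := (le_max_left _ _).trans (le_max_left _ _)
  have h1m : 1 ≤ m := (le_max_right _ _).trans (le_max_left _ _)
  have hm0 : 0 < m := by linarith
  have hmq : C * θ ^ 4 / m ^ 3 ≤ q := by
    have h1 : C * θ ^ 4 ≤ m * q := by rw [← div_le_iff₀ hq0]; exact le_max_right _ _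
    rw [div_le_iff₀ (by positivity)]
    have h2 : m ≤ m ^ 3 := le_self_pow₀ h1m (by norm_num)
    nlinarith
  obtain ⟨S, hS, hnet⟩ := exists_finite_net d θ hρ0
  set H := m + κ / 4 * s ^ 2 with hH
  have hH0 : 0 ≤ H := by positivity
  set φ : ℕ → (Fin d → ℝ) → (Fin d → ℝ) × ℝ → ℝ :=
    fun i δ z => truncIncr P.τ κ s m δ z.1 (z.2 - z.1 ⬝ᵥ P.α i) with hφ
  have hφm : ∀ i δ, Measurable (φ i δ) := by
    intro i δ
    have h0 : Measurable fun v : Fin d → ℝ => v ⬝ᵥ P.α i :=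
      Finset.measurable_fun_sum _ fun j _ => (measurable_pi_apply j).mul_const _
    exact (measurable_truncIncr P.τ κ s m δ).comp
      (measurable_fst.prodMk (measurable_snd.sub (h0.comp measurable_fst)))
  have hZ : ∀ i t, Measurable fun ω => (P.X i t ω, P.Y i t ω) := fun i t =>
    (hmodel.measurable_X i t).prodMk (hmodel.measurable_Y i t)
  -- The event is a union over the net, built from the data and not from the estimator. Net, bound
  -- `H` and mixing sequence are common to all units, so `ψ` is as well.
  refine ⟨S.card * (8 * H ^ 2 * (∑' h, a h) / (2 * q) ^ 2), fun T i => ⋃ δ ∈ S,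
    {ω | (T : ℝ)⁻¹ * ∑ t ∈ Finset.range T, φ i δ (P.X i t ω, P.Y i t ω) ≤ -(2 * q)}, ?_, ?_, ?_, ?_⟩
  · have : 0 ≤ ∑' h, a h := tsum_nonneg (hmix 0).nonneg
    positivity
  · intro T i
    refine Finset.measurableSet_biUnion _ fun δ _ => measurableSet_le ?_ measurable_const
    exact (Finset.measurable_fun_sum _ fun t _ => (hφm i δ).comp (hZ i t)).const_mul _
  · intro T i hT
    refine (measureReal_biUnion_finset_le _ _).trans ?_
    refine (Finset.sum_le_card_nsmul _ _ (8 * H ^ 2 * (∑' h, a h) / (T * (2 * q) ^ 2))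
      fun δ _ => ?_).trans (le_of_eq ?_)
    · exact (hmix i).measure_average_le ha (hZ i) (hφm i δ) hH0
        (fun z => abs_truncIncr_le hmodel.tau_pos hmodel.tau_lt_one hκ.le hs.le hm0.le _ _ _)
        (fun t => integral_truncIncr_nonneg hmodel hκ hs hm0.le (hdens i t) δ) (by positivity) hT
    · rw [nsmul_eq_mul]
      ring
  · intro T i ω δ hT h1 h2 h3 h4
    obtain ⟨δ₁, hδ₁, h5⟩ := exists_sphere_point hθ h4 h3
    obtain ⟨δ₂, hδ₂, h6⟩ := hnet δ₁ hδ₁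
    refine Set.mem_iUnion₂.mpr ⟨δ₂, hδ₂, ?_⟩
    have h7 := average_truncIncr_le (e := fun t => P.qErr i t ω) hmodel.tau_pos hmodel.tau_lt_one hT
      hκ hs hsm hc hθ hρ0.le hb0 hb1 hbC (le_of_eq (div_mul_cancel₀ q (by positivity))) hmq h1 h5 (hS _ hδ₂) h6
      (h2 δ₂)
    simp only [Set.mem_ofPred_eq, hφ]
    rw [← Fin.sum_univ_eq_sum_range (fun t => truncIncr P.τ κ s m δ₂ (P.X i t ω)
      (P.Y i t ω - P.X i t ω ⬝ᵥ P.α i))]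
    refine le_trans h7 (le_of_eq ?_)
    rw [hq]
    ring

end Panel

/-! ### Average consistency of the first step -/

namespace Panel

section Deterministic

variable {Ω : Type*} {d r : ℕ} {P : Panel Ω d r}

/-- Good design of unit `i`: bounded sample fourth moment and well-conditioned second moments. -/
def IsGoodDesign (P : Panel Ω d r) (c C : ℝ) (T i : ℕ) (ω : Ω) : Prop :=
  (T : ℝ)⁻¹ * ∑ t : Fin T, sqNorm (P.X i t ω) ^ 2 ≤ C ∧
    ∀ v : Fin d → ℝ, c * sqNorm v ≤ (T : ℝ)⁻¹ * ∑ t : Fin T, (P.X i t ω ⬝ᵥ v) ^ 2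

lemma IsQuantileEstimator.average_sub_le {αhat : ℕ → ℕ → Ω → (Fin d → ℝ)}
    (hα : P.IsQuantileEstimator αhat) (T i : ℕ) (ω : Ω) :
    (T : ℝ)⁻¹ * ∑ t : Fin T, (checkLoss P.τ (P.qErr i t ω - P.X i t ω ⬝ᵥ (αhat T i ω - P.α i))
      - checkLoss P.τ (P.qErr i t ω)) ≤ 0 := by
  have h : P.quantLoss T i ω (αhat T i ω) ≤ P.quantLoss T i ω (P.α i) :=
    isMinOn_iff.mp (hα T i ω) _ (Set.mem_univ _)
  rw [Finset.sum_sub_distrib, mul_sub]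
  have e : ∀ t, P.qErr i t ω - P.X i t ω ⬝ᵥ (αhat T i ω - P.α i)
      = P.Y i t ω - P.X i t ω ⬝ᵥ αhat T i ω := by
    intro t
    rw [qErr, dotProduct_sub]; ring
  simp only [e]
  unfold quantLoss at h
  unfold qErr
  linarith

/-- As a function of the index `u`, `τ Z*` is `min (y - u) 0 + τ u`, whose slopes are `τ` and `τ -
1`. -/
lemma abs_Zstar_sub_le (hτ : 0 < P.τ) (hτ1 : P.τ < 1) (i t : ℕ) (a : Fin d → ℝ) (ω : Ω) :
    |P.Zstar i t a ω - P.Zstar i t (P.α i) ω| ≤ P.τ⁻¹ * |P.X i t ω ⬝ᵥ (a - P.α i)| := by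
  unfold Zstar
  rw [← mul_sub, abs_mul, abs_of_pos (inv_pos.mpr hτ), dotProduct_sub]
  refine mul_le_mul_of_nonneg_left ?_ (inv_nonneg.mpr hτ.le)
  generalize P.X i t ω ⬝ᵥ a = u
  generalize P.X i t ω ⬝ᵥ P.α i = v
  generalize P.Y i t ω = y
  have h1 : ∀ u, (y - u) * (if y ≤ u then 1 else 0) = min (y - u) 0 := by
    intro u
    split_ifs with h
    · rw [mul_one, min_eq_left (by linarith)]
    · rw [mul_zero, min_eq_right (by linarith)]
  rw [h1, h1, abs_le]
  rcases le_total u v with h | h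
  · have := mul_le_mul_of_nonneg_right hτ1.le (sub_nonneg.mpr h)
    have := mul_nonneg hτ.le (sub_nonneg.mpr h)
    rw [abs_of_nonpos (by linarith : u - v ≤ 0)]
    constructor <;> rcases min_cases (y - u) 0 with h2 | h2 <;>
      rcases min_cases (y - v) 0 with h3 | h3 <;> nlinarith
  · have := mul_le_mul_of_nonneg_right hτ1.le (sub_nonneg.mpr h)
    have := mul_nonneg hτ.le (sub_nonneg.mpr h)
    rw [abs_of_nonneg (by linarith : 0 ≤ u - v)]
    constructor <;> rcases min_cases (y - u) 0 with h2 | h2 <;>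
      rcases min_cases (y - v) 0 with h3 | h3 <;> nlinarith

lemma firstStepLoss_le (hτ : 0 < P.τ) (hτ1 : P.τ < 1) {N T : ℕ} (hT : 0 < T) {C : ℝ} {ω : Ω}
    (hC : ∀ i < N, (T : ℝ)⁻¹ * ∑ t : Fin T, sqNorm (P.X i t ω) ^ 2 ≤ C) (a : ℕ → (Fin d → ℝ)) :
    P.firstStepLoss N T ω a
      ≤ (P.τ ^ 2)⁻¹ * (1 + C) * ((N : ℝ)⁻¹ * ∑ i : Fin N, sqNorm (a i - P.α i)) := by
  have hpt : ∀ i : Fin N, (T : ℝ)⁻¹ * sqNorm (P.firstStepErr T i (a i) ω)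
      ≤ (P.τ ^ 2)⁻¹ * (1 + C) * sqNorm (a i - P.α i) := by
    intro i
    have h1 : sqNorm (P.firstStepErr T i (a i) ω)
        ≤ (P.τ ^ 2)⁻¹ * sqNorm (P.Xmat T i ω *ᵥ (a i - P.α i)) := by
      rw [sqNorm, sqNorm, Finset.mul_sum]
      refine Finset.sum_le_sum fun t _ => ?_
      have h2 := pow_le_pow_left₀ (abs_nonneg _) (abs_Zstar_sub_le hτ hτ1 i t (a i) ω) 2
      rwa [sq_abs, mul_pow, sq_abs, inv_pow] at h2
    have h3 := P.sqNorm_Xmat_mulVec_le hT (hC i i.2) (a i - P.α i)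
    calc (T : ℝ)⁻¹ * sqNorm (P.firstStepErr T i (a i) ω)
        ≤ (T : ℝ)⁻¹ * ((P.τ ^ 2)⁻¹ * sqNorm (P.Xmat T i ω *ᵥ (a i - P.α i))) := by gcongr
      _ = (P.τ ^ 2)⁻¹ * ((T : ℝ)⁻¹ * sqNorm (P.Xmat T i ω *ᵥ (a i - P.α i))) := by ring
      _ ≤ (P.τ ^ 2)⁻¹ * ((1 + C) * sqNorm (a i - P.α i)) := by gcongr
      _ = _ := by ring
  rw [firstStepLoss, mul_inv, mul_assoc, mul_left_comm _ (N : ℝ)⁻¹,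
    Finset.mul_sum _ _ (T : ℝ)⁻¹, Finset.mul_sum _ _ ((P.τ ^ 2)⁻¹ * (1 + C))]
  exact mul_le_mul_of_nonneg_left (Finset.sum_le_sum fun i _ => hpt i) (by positivity)

end Deterministic

variable {Ω : Type*} [MeasurableSpace Ω] {d r : ℕ} {P : Panel Ω d r} {μ : Measure Ω}
  [IsProbabilityMeasure μ] {l : Filter (ℕ × ℕ)}

lemma eventually_pos (hl : l ≤ atTop ×ˢ atTop) : ∀ᶠ n in l, 0 < n.1 ∧ 0 < n.2 := by
  have h1 : Tendsto Prod.fst l (atTop : Filter ℕ) := tendsto_fst.mono_left hl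
  have h2 : Tendsto Prod.snd l (atTop : Filter ℕ) := tendsto_snd.mono_left hl
  exact (h1.eventually_gt_atTop 0).and (h2.eventually_gt_atTop 0)

/-- Average consistency of the first step. -/
lemma quantile_estimator_consistent (hl : l ≤ atTop ×ˢ atTop) (hmodel : ModelAssumption P μ)
    (hdesign : DesignAssumption P μ l) (hweak : WeakDependenceAssumption P μ)
    {αhat : ℕ → ℕ → Ω → (Fin d → ℝ)} (hα : P.IsQuantileEstimator αhat) {c C : ℝ} (hc : 0 < c)
    (hC : 0 < C) (hgood : WithProbTendingToOne μ l fun n ω => ∀ i < n.1, P.IsGoodDesign c C n.2 i ω)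
    {η : ℝ} (hη : 0 < η) :
    WithProbTendingToOne μ l fun n ω =>
      (n.1 : ℝ)⁻¹ * ∑ i : Fin n.1, sqNorm (αhat n.2 i ω - P.α i) ≤ η := by
  obtain ⟨κ, s, hκ, hs, hdens⟩ := hdesign.density
  obtain ⟨M, hM⟩ := hdesign.moments
  obtain ⟨ψ, B, hψ, hBm, hB, hev⟩ := exists_quantile_event hmodel hκ hs hdens hweak
    (θ := √(η / 2)) (Real.sqrt_pos.mpr (half_pos hη)) hc hC
  have hθ : √(η / 2) ^ 2 = η / 2 := Real.sq_sqrt (half_pos hη).le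
  set D := 32 * C / (c ^ 3 * min P.τ (1 - P.τ) ^ 2) with hD
  have hτ0 : 0 < min P.τ (1 - P.τ) := lt_min hmodel.tau_pos (by linarith [hmodel.tau_lt_one])
  have hD0 : 0 < D := by positivity
  -- Units outside `B` err by at most `η / 2`. Inside `B` the crude bound is a multiple of `V ≤
  -- T^{-1/2} V² + T^{1/2}`: the first term is small by fourth moments, the second because `B` has
  -- probability `O(1/T)`.
  set g : ℕ × ℕ → Ω → ℝ := fun n ω => (n.1 : ℝ)⁻¹ * ∑ i : Fin n.1,
    ((√n.2)⁻¹ * ((n.2 : ℝ)⁻¹ * ∑ t : Fin n.2, P.qErr i t ω ^ 4)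
      + √n.2 * (B n.2 i).indicator 1 ω) with hg
  have hpos := eventually_pos hl
  have hgsmall : WithProbTendingToOne μ l fun n ω => g n ω ≤ η / (2 * D) := by
    refine WithProbTendingToOne.of_integral_le (c := fun n => (√n.2)⁻¹ * (M + ψ)) ?_ ?_
      (by positivity)
    · filter_upwards [hpos] with n hn
      have hN : (0 : ℝ) < n.1 := by exact_mod_cast hn.1
      have hT : (0 : ℝ) < n.2 := by exact_mod_cast hn.2
      have hi1 : ∀ i : ℕ, Integrable (fun ω => (√n.2)⁻¹ *
          ((n.2 : ℝ)⁻¹ * ∑ t : Fin n.2, P.qErr i t ω ^ 4)) μ := fun i =>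
        ((integrable_finsetSum _ fun (t : Fin n.2) _ => (hM i t).2.1).const_mul _).const_mul _
      have hi2 : ∀ i : ℕ, Integrable (fun ω => √n.2 * (B n.2 i).indicator (1 : Ω → ℝ) ω) μ :=
        fun i => ((integrable_const (1 : ℝ)).indicator (hBm n.2 i)).const_mul _
      have hi : ∀ i : ℕ, Integrable (fun ω => (√n.2)⁻¹ *
          ((n.2 : ℝ)⁻¹ * ∑ t : Fin n.2, P.qErr i t ω ^ 4)
          + √n.2 * (B n.2 i).indicator (1 : Ω → ℝ) ω) μ := fun i => (hi1 i).add (hi2 i)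
      refine ⟨fun ω => ?_, (integrable_finsetSum _ fun (i : Fin n.1) _ => hi i).const_mul _, ?_⟩
      · refine mul_nonneg (by positivity) (Finset.sum_nonneg fun i _ => ?_)
        have : (0 : ℝ) ≤ (B n.2 i).indicator 1 ω := Set.indicator_nonneg (fun _ _ => zero_le_one) _
        have : (0 : ℝ) ≤ ∑ t : Fin n.2, P.qErr i t ω ^ 4 :=
          Finset.sum_nonneg fun t _ => by positivity
        positivity
      · rw [integral_const_mul, integral_finsetSum _ fun (i : Fin n.1) _ => hi i]
        have hb : ∀ i : Fin n.1, ∫ ω, ((√n.2)⁻¹ * ((n.2 : ℝ)⁻¹ * ∑ t : Fin n.2, P.qErr i t ω ^ 4)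
            + √n.2 * (B n.2 i).indicator (1 : Ω → ℝ) ω) ∂μ ≤ (√n.2)⁻¹ * (M + ψ) := by
          intro i
          rw [integral_add (hi1 i) (hi2 i), integral_const_mul, integral_const_mul,
            integral_const_mul, integral_finsetSum _ fun (t : Fin n.2) _ => (hM i t).2.1,
            integral_indicator_one (hBm n.2 i), mul_add]
          refine add_le_add (mul_le_mul_of_nonneg_left ?_ (by positivity)) ?_
          · rw [inv_mul_le_iff₀ hT]
            refine (Finset.sum_le_card_nsmul Finset.univ _ M fun (t : Fin n.2) _ => (hM i t).2.2).trans (le_of_eq ?_)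
            simp
          · refine (mul_le_mul_of_nonneg_left (hB n.2 i hn.2) (by positivity)).trans (le_of_eq ?_)
            have h1 := Real.sq_sqrt hT.le
            have h2 := Real.sqrt_pos.mpr hT
            field_simp
            rw [h1, mul_comm]
        rw [inv_mul_le_iff₀ hN]
        refine (Finset.sum_le_card_nsmul _ _ _ fun i _ => hb i).trans (le_of_eq ?_)
        simp
    · have h2 : Tendsto Prod.snd l (atTop : Filter ℕ) := tendsto_snd.mono_left hl
      have h3 : Tendsto (fun n : ℕ × ℕ => √(n.2 : ℝ)) l atTop :=
        Real.tendsto_sqrt_atTop.comp (tendsto_natCast_atTop_atTop.comp h2)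
      simpa using h3.inv_tendsto_atTop.mul_const (M + ψ)
  refine (hgood.and hgsmall).mono ?_
  filter_upwards [hpos] with n hn ω hω
  have hN : (0 : ℝ) < n.1 := by exact_mod_cast hn.1
  have hT : (0 : ℝ) < n.2 := by exact_mod_cast hn.2
  have hpt : ∀ i : Fin n.1, sqNorm (αhat n.2 i ω - P.α i) ≤ η / 2
      + D * ((√n.2)⁻¹ * ((n.2 : ℝ)⁻¹ * ∑ t : Fin n.2, P.qErr i t ω ^ 4)
        + √n.2 * (B n.2 i).indicator 1 ω) := by
    intro i
    obtain ⟨h1, h2⟩ := hω.1 i i.2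
    have h3 := hα.average_sub_le n.2 i ω
    set V := (n.2 : ℝ)⁻¹ * ∑ t : Fin n.2, P.qErr i t ω ^ 2 with hV
    have hV2 : V ^ 2 ≤ (n.2 : ℝ)⁻¹ * ∑ t : Fin n.2, P.qErr i t ω ^ 4 := by
      have := sq_sum_le_card_mul_sum_sq (s := Finset.univ)
        (f := fun t : Fin n.2 => P.qErr i t ω ^ 2)
      simp only [← pow_mul, Finset.card_univ, Fintype.card_fin] at this
      rw [hV, mul_pow]
      refine (mul_le_mul_of_nonneg_left this (by positivity)).trans (le_of_eq ?_)
      field_simp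
    have hq4 : 0 ≤ (n.2 : ℝ)⁻¹ * ∑ t : Fin n.2, P.qErr i t ω ^ 4 := (sq_nonneg V).trans hV2
    by_cases hb : ω ∈ B n.2 i
    · have h4 := sqNorm_le_of_quantLoss_le (e := fun t : Fin n.2 => P.qErr i t ω) hmodel.tau_pos
        hmodel.tau_lt_one hn.2 hc hC h1 h3 (h2 _)
      refine h4.trans ?_
      rw [Set.indicator_of_mem hb, Pi.one_apply, mul_one]
      have h5 : V ≤ (√n.2)⁻¹ * V ^ 2 + √n.2 := by
        have h6 := Real.sqrt_pos.mpr hT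
        have h7 : (√n.2)⁻¹ * V ^ 2 + √n.2 - V = (√n.2)⁻¹ * ((V - √n.2 / 2) ^ 2 + 3 / 4 * √n.2 ^ 2) := by
          field_simp
          ring
        have h8 : 0 ≤ (√n.2)⁻¹ * ((V - √n.2 / 2) ^ 2 + 3 / 4 * √n.2 ^ 2) := by positivity
        linarith
      have h9 := h5.trans (add_le_add_left (mul_le_mul_of_nonneg_left hV2
        (by positivity : 0 ≤ (√n.2)⁻¹)) (√n.2))
      have h10 := mul_le_mul_of_nonneg_left h9 hD0.le
      linarith
    · have h4 : sqNorm (αhat n.2 i ω - P.α i) ≤ η / 2 := by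
        by_contra h5
        push Not at h5
        rw [← hθ] at h5
        exact hb (hev n.2 i ω _ hn.2 h1 h2 h3 h5)
      rw [Set.indicator_of_notMem hb, mul_zero, add_zero]
      have : 0 ≤ D * ((√n.2)⁻¹ * ((n.2 : ℝ)⁻¹ * ∑ t : Fin n.2, P.qErr i t ω ^ 4)) := by positivity
      linarith
  have hsum := mul_le_mul_of_nonneg_left (Finset.sum_le_sum fun i (_ : i ∈ Finset.univ) => hpt i)
    (inv_nonneg.mpr hN.le)
  refine hsum.trans ?_
  rw [Finset.sum_add_distrib, ← Finset.mul_sum, mul_add, mul_left_comm]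
  have e1 : (n.1 : ℝ)⁻¹ * ∑ _i : Fin n.1, η / 2 = η / 2 := by
    simp; field_simp
  have h2 := mul_le_mul_of_nonneg_left hω.2 hD0.le
  have e2 : D * (η / (2 * D)) = η / 2 := by field_simp
  rw [e1]
  simp only [hg] at h2
  linarith

/-- The first step is negligible in the second step. -/
lemma firstStepLoss_consistent (hl : l ≤ atTop ×ˢ atTop) (hmodel : ModelAssumption P μ)
    (hdesign : DesignAssumption P μ l) (hweak : WeakDependenceAssumption P μ)
    {αhat : ℕ → ℕ → Ω → (Fin d → ℝ)} (hα : P.IsQuantileEstimator αhat) {c C : ℝ} (hc : 0 < c)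
    (hC : 0 < C) (hgood : WithProbTendingToOne μ l fun n ω => ∀ i < n.1, P.IsGoodDesign c C n.2 i ω)
    {η : ℝ} (hη : 0 < η) :
    WithProbTendingToOne μ l fun n ω =>
      P.firstStepLoss n.1 n.2 ω (fun i => αhat n.2 i ω) ≤ η := by
  have hτ := hmodel.tau_pos
  have hk : 0 < (P.τ ^ 2)⁻¹ * (1 + C) := by positivity
  refine (hgood.and (quantile_estimator_consistent hl hmodel hdesign hweak hα hc hC hgood
    (div_pos hη hk))).mono ?_
  filter_upwards [eventually_pos hl] with n hn ω hω
  refine (firstStepLoss_le hτ hmodel.tau_lt_one hn.2 (fun i hi => (hω.1 i hi).1) _).trans ?_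
  rw [← le_div_iff₀' hk]
  exact hω.2

end Panel

/-! ### Regular factor matrices -/

lemma WithProbTendingToOne.forall_fintype {Ω ι κ : Type*} [MeasurableSpace Ω] [Fintype κ]
    {μ : Measure Ω} {l : Filter ι} {S : κ → ι → Ω → Prop}
    (h : ∀ k, WithProbTendingToOne μ l (S k)) :
    WithProbTendingToOne μ l fun n ω => ∀ k, S k n ω := by
  have h1 := tendsto_finsetSum Finset.univ fun k _ => h k
  rw [Finset.sum_const_zero] at h1
  refine tendsto_of_tendsto_of_tendsto_of_le_of_le tendsto_const_nhds h1
    (fun _ => zero_le) fun n => ?_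
  have e : {ω | ¬ ∀ k, S k n ω} = ⋃ k ∈ Finset.univ, {ω | ¬ S k n ω} := by
    ext ω; simp
  simp only [e]
  exact measure_biUnion_finset_le _ _

lemma exists_sqNorm_le_of_posDef {r : ℕ} {S : Matrix (Fin r) (Fin r) ℝ} (hS : S.PosDef) :
    ∃ c, 0 < c ∧ ∀ v, c * sqNorm v ≤ v ⬝ᵥ (S *ᵥ v) := by
  obtain ⟨B, hB, e⟩ := exists_eq_transpose_mul_self hS
  have hf := frobSq_nonneg B⁻¹
  refine ⟨(1 + frobSq B⁻¹)⁻¹, by positivity, fun v => ?_⟩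
  have h1 : sqNorm v ≤ frobSq B⁻¹ * sqNorm (B *ᵥ v) := by
    have := sqNorm_mulVec_le B⁻¹ (B *ᵥ v)
    rwa [Matrix.mulVec_mulVec, Matrix.nonsing_inv_mul _ hB, Matrix.one_mulVec] at this
  have h2 : v ⬝ᵥ (S *ᵥ v) = sqNorm (B *ᵥ v) := by
    rw [e, ← Matrix.mulVec_mulVec, dotProduct_transpose_mulVec, sqNorm_eq_dotProduct]
  rw [h2, inv_mul_le_iff₀ (by positivity)]
  linarith [sqNorm_nonneg (B *ᵥ v)]

lemma isUnit_det_of_sqNorm_le {r : ℕ} {A : Matrix (Fin r) (Fin r) ℝ} {c : ℝ} (hc : 0 < c)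
    (h : ∀ v, c * sqNorm v ≤ v ⬝ᵥ (A *ᵥ v)) : IsUnit A.det := by
  by_contra hdet
  rw [isUnit_iff_ne_zero, not_not] at hdet
  obtain ⟨v, hv, hv0⟩ := Matrix.exists_mulVec_eq_zero_iff.mpr hdet
  have h1 := h v
  rw [hv0, dotProduct_zero] at h1
  have h2 : sqNorm v ≠ 0 := fun h3 => hv (sqNorm_eq_zero.mp h3)
  have h3 := (sqNorm_nonneg v).lt_of_ne h2.symm
  nlinarith

lemma abs_dotProduct_mulVec_le {r : ℕ} {A : Matrix (Fin r) (Fin r) ℝ} {ε : ℝ}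
    (h : ∀ j k, |A j k| ≤ ε) (v : Fin r → ℝ) : |v ⬝ᵥ (A *ᵥ v)| ≤ ε * r * sqNorm v := by
  rcases isEmpty_or_nonempty (Fin r) with hr | ⟨⟨j0⟩⟩
  · simp [dotProduct, sqNorm]
  have hε : 0 ≤ ε := (abs_nonneg _).trans (h j0 j0)
  have h1 : |v ⬝ᵥ (A *ᵥ v)| ≤ ∑ j, ∑ k, ε * (|v j| * |v k|) := by
    simp only [dotProduct, Matrix.mulVec, Finset.mul_sum]
    refine (Finset.abs_sum_le_sum_abs _ _).trans (Finset.sum_le_sum fun j _ => ?_)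
    refine (Finset.abs_sum_le_sum_abs _ _).trans (Finset.sum_le_sum fun k _ => ?_)
    rw [abs_mul, abs_mul]
    have := mul_le_mul_of_nonneg_right (h j k) (by positivity : 0 ≤ |v j| * |v k|)
    linarith
  have h2 : ∑ j, ∑ k, ε * (|v j| * |v k|) = ε * (∑ j, |v j|) ^ 2 := by
    rw [sq, Finset.sum_mul_sum, Finset.mul_sum]
    exact Finset.sum_congr rfl fun j _ => by rw [Finset.mul_sum]
  have h3 := sq_sum_le_card_mul_sum_sq (s := Finset.univ) (f := fun j => |v j|)
  simp only [sq_abs, Finset.card_univ, Fintype.card_fin] at h3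
  rw [h2] at h1
  refine h1.trans ?_
  rw [mul_assoc]
  exact mul_le_mul_of_nonneg_left h3 hε

namespace Panel

variable {Ω : Type*} [MeasurableSpace Ω] {d r : ℕ} {P : Panel Ω d r} {μ : Measure Ω}
  {l : Filter (ℕ × ℕ)}

/-- With probability tending to one, the factors have well-conditioned second moments. -/
lemma exists_factor_bounds (hl : l ≤ atTop ×ˢ atTop) (hfactor : FactorAssumption P μ) :
    ∃ c K : ℝ, 0 < c ∧ WithProbTendingToOne μ l fun n ω =>
      (∀ v, c * sqNorm v ≤ (n.2 : ℝ)⁻¹ * sqNorm (P.Fmat n.2 ω *ᵥ v)) ∧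
        (n.2 : ℝ)⁻¹ * frobSq (P.Fmat n.2 ω) ≤ K := by
  obtain ⟨S, hS, hlim⟩ := hfactor.factors
  obtain ⟨c, hc, hcS⟩ := exists_sqNorm_le_of_posDef hS
  -- Entrywise errors up to `ε` change the quadratic form by at most `ε r ‖v‖² ≤ (c/2) ‖v‖²`.
  set ε := c / (2 * (r + 1)) with hε
  have hε0 : 0 < ε := by positivity
  refine ⟨c / 2, ∑ j, (S j j + ε), half_pos hc, ?_⟩
  have h1 : ∀ j k, WithProbTendingToOne μ atTop fun (T : ℕ) ω =>
      |((T : ℝ)⁻¹ • ((P.Fmat T ω)ᵀ * P.Fmat T ω) - S) j k| ≤ ε := by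
    intro j k
    refine tendsto_of_tendsto_of_tendsto_of_le_of_le tendsto_const_nhds
      (tendstoInMeasure_iff_dist.mp (hlim j k) ε hε0) (fun _ => zero_le) fun T => ?_
    exact measure_mono fun ω hω => (not_le.mp hω).le
  have h2 := WithProbTendingToOne.forall_fintype fun j =>
    WithProbTendingToOne.forall_fintype fun k => h1 j k
  have h3 : WithProbTendingToOne μ l fun n ω => ∀ j k,
      |((n.2 : ℝ)⁻¹ • ((P.Fmat n.2 ω)ᵀ * P.Fmat n.2 ω) - S) j k| ≤ ε := by
    unfold WithProbTendingToOne at h2 ⊢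
    exact h2.comp (tendsto_snd.mono_left hl)
  refine h3.mono (Eventually.of_forall fun n ω h => ⟨fun v => ?_, ?_⟩)
  · have h4 := (abs_le.mp (abs_dotProduct_mulVec_le h v)).1
    rw [Matrix.sub_mulVec, dotProduct_sub, Matrix.smul_mulVec, dotProduct_smul, smul_eq_mul,
      ← Matrix.mulVec_mulVec, dotProduct_transpose_mulVec, ← sqNorm_eq_dotProduct] at h4
    have h5 := hcS v
    have h6 : ε * r * sqNorm v ≤ c / 2 * sqNorm v := by
      refine mul_le_mul_of_nonneg_right ?_ (sqNorm_nonneg v)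
      rw [hε, div_mul_eq_mul_div, div_le_div_iff₀ (by positivity) (by positivity)]
      nlinarith
    linarith
  · rw [frobSq_eq_trace, Matrix.trace, Finset.mul_sum]
    refine Finset.sum_le_sum fun j _ => ?_
    have h4 := (abs_le.mp (h j j)).2
    simp only [Matrix.sub_apply, Matrix.smul_apply, smul_eq_mul] at h4
    rw [Matrix.diag_apply]
    linarith

/-- The first step needs the unprojected second moments of the regressors; projection only decreases
them, so the condition on `A_i(F⁰)` suffices. -/
lemma dotProduct_Amat_mulVec_le {Ω : Type*} {P : Panel Ω d r} {T i : ℕ} {ω : Ω} {F : Matrix (Fin T) (Fin r) ℝ}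
    (hF : IsUnit (Fᵀ * F).det) (v : Fin d → ℝ) :
    v ⬝ᵥ (P.Amat T i ω F *ᵥ v) ≤ (T : ℝ)⁻¹ * ∑ t : Fin T, (P.X i t ω ⬝ᵥ v) ^ 2 := by
  rw [P.dotProduct_Amat_mulVec T i ω hF]
  exact mul_le_mul_of_nonneg_left (sqNorm_annihilator_mulVec_le hF _) (by positivity)

variable [IsProbabilityMeasure μ]

/-- The projected signal vanishes in mean square, with probability tending to one. -/
lemma signalLoss_consistent (hl : l ≤ atTop ×ˢ atTop) (hm : P.sigmaXF ≤ ‹MeasurableSpace Ω›)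
    {M : ℝ} (herr : ErrorBound P μ M) {a : ℕ → Ω → ℕ → (Fin d → ℝ)}
    {b : (N T : ℕ) → Ω → Fin N → (Fin d → ℝ)} {F : (N T : ℕ) → Ω → Matrix (Fin T) (Fin r) ℝ}
    (hF0 : WithProbTendingToOne μ l fun n ω => IsUnit ((P.Fmat n.2 ω)ᵀ * P.Fmat n.2 ω).det)
    (hfs : ∀ η : ℝ, 0 < η →
      WithProbTendingToOne μ l fun n ω => P.firstStepLoss n.1 n.2 ω (a n.2 ω) ≤ η)
    (hLS : WithProbTendingToOne μ l fun n ω =>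
      P.IsLSMinimizer n.1 n.2 (a n.2 ω) ω (b n.1 n.2 ω) (F n.1 n.2 ω)) {q : ℝ} (hq : 0 < q) :
    WithProbTendingToOne μ l fun n ω =>
      P.signalLoss n.1 n.2 ω (b n.1 n.2 ω) (F n.1 n.2 ω) ≤ q := by
  have hpos := eventually_pos hl
  have hM : 0 < M := zero_lt_one.trans_le herr.one_le
  refine WithProbTendingToOne.of_forall_le fun ζ hζ => ?_
  -- The order of choices matters: `K` bounds the fourth moments outside probability `ζ`, then `λ`
  -- makes the term in `K / λ` equal to `q/4`, then `m` brings the exceptional share to `q/4`. With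
  -- `m` fixed the other terms vanish, and `η` fits them into the last `q/2`.
  set K := M / ζ with hK
  have hK0 : 0 < K := by positivity
  set lam := 16 * K / q with hlam
  have hlam0 : 0 < lam := by positivity
  obtain ⟨m, hmr⟩ := exists_nat_ge (16 * lam * r / q)
  set A : ℝ := 8 * (12 + 8 * (m : ℝ) ^ 2) with hA
  have hA0 : 0 < A := by positivity
  set η := q / (2 * (A * (1 + (m + r : ℕ)) + 4 * r + 12)) with hη
  have hη0 : 0 < η := by positivity
  choose p hp0 hpi hpm hpb using fun (T i : ℕ) (I : Fin m → ℕ) =>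
    herr.exists_designSpan_bound hm T i I
  set D : ℝ := ((m + 1) * d + r : ℕ) * M with hD
  -- The projections have expected square at most dimension times `M`, independently of `T`, so
  -- division by `T` makes their average vanish.
  have hpsmall : WithProbTendingToOne μ l fun n ω => ((n.1 : ℝ) ^ (m + 1) * n.2)⁻¹ *
      ∑ i : Fin n.1, ∑ I : Fin m → Fin n.1, p n.2 i (fun k => (I k : ℕ)) ω ≤ η := by
    refine WithProbTendingToOne.of_integral_le (c := fun n => D * (n.2 : ℝ)⁻¹) ?_ ?_ hη0
    · filter_upwards [hpos] with n hn
      have hN : (0 : ℝ) < n.1 := by exact_mod_cast hn.1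
      have hT : (0 : ℝ) < n.2 := by exact_mod_cast hn.2
      have hi1 : ∀ i : Fin n.1, Integrable (fun ω => ∑ I : Fin m → Fin n.1,
          p n.2 i (fun k => (I k : ℕ)) ω) μ := fun i => integrable_finsetSum _ fun I _ => hpi _ _ _
      refine ⟨fun ω => ?_, (integrable_finsetSum _ fun i _ => hi1 i).const_mul _, ?_⟩
      · exact mul_nonneg (by positivity) (Finset.sum_nonneg fun i _ =>
          Finset.sum_nonneg fun I _ => hp0 _ _ _ _)
      · rw [integral_const_mul, integral_finsetSum _ fun i _ => hi1 i]
        have hb : ∀ i : Fin n.1, ∫ ω, ∑ I : Fin m → Fin n.1, p n.2 i (fun k => (I k : ℕ)) ω ∂μ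
            ≤ (n.1 : ℝ) ^ m * D := by
          intro i
          rw [integral_finsetSum _ fun (I : Fin m → Fin n.1) _ => hpi _ _ _]
          refine (Finset.sum_le_card_nsmul _ _ D fun I _ => hpm _ _ _).trans (le_of_eq ?_)
          simp
        refine (mul_le_mul_of_nonneg_left (Finset.sum_le_sum fun i _ => hb i)
          (by positivity)).trans (le_of_eq ?_)
        rw [Finset.sum_const, Finset.card_univ, Fintype.card_fin, nsmul_eq_mul]
        field_simp
        ring
    · have h2 : Tendsto Prod.snd l (atTop : Filter ℕ) := tendsto_snd.mono_left hl
      simpa using ((tendsto_inv_atTop_nhds_zero_nat (𝕜 := ℝ)).comp h2).const_mul D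
  refine ⟨_, fun n ω => (n.1 : ℝ)⁻¹ * ∑ i : Fin n.1, (sqNorm (P.errVec n.2 i ω) / n.2) ^ 2 ≤ K,
    ((hF0.and hLS).and (hfs η hη0)).and (hpsmall.and (herr.errGram_le hm hl hη0)), ?_, ?_⟩
  · filter_upwards [hpos] with n hn
    refine (herr.measure_errVec_le hn.1 hn.2 hK0).trans (ENNReal.ofReal_le_ofReal (le_of_eq ?_))
    rw [hK]; field_simp
  · filter_upwards [hpos] with n hn ω hE hB
    obtain ⟨⟨⟨h1, h2⟩, h3⟩, h4, h5⟩ := hE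
    have h6 := P.signalLoss_le hn.1 hn.2 h1 h2 (fun i I => p n.2 i (fun k => (I k : ℕ)) ω)
      (fun i I => hp0 _ _ _ _) (fun i I y hy => hpb _ _ _ ω y hy) hlam0 hB
    refine h6.trans ?_
    have g1 : 4 * lam * (r / (m + 1)) ≤ q / 4 := by
      rw [div_le_iff₀ hq] at hmr
      have : (0 : ℝ) < m + 1 := by positivity
      rw [mul_div_assoc', div_le_div_iff₀ this (by norm_num)]
      nlinarith
    have g2 : 4 * K / lam = q / 4 := by
      rw [hlam]; field_simp; norm_num
    have g3 : (A * (1 + (m + r : ℕ)) + 4 * r + 12) * η = q / 2 := by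
      rw [hη]; field_simp
    have hr0 : (0 : ℝ) ≤ r := Nat.cast_nonneg r
    have g4 := mul_le_mul_of_nonneg_left h4 hA0.le
    have g5 := mul_le_mul_of_nonneg_left h5 (by positivity : 0 ≤ A * (m + r : ℕ) + 4 * r)
    have g6 : 2 * (2 * K / lam) = 4 * K / lam := by ring
    simp only [hA] at g3 g4 g5
    linarith

end Panel

end ESPanel

end

/-! ### Assembly of the bounds -/

theorem mainTheorem1 {Ω : Type*} [MeasurableSpace Ω] (μ : Measure Ω) [IsProbabilityMeasure μ]
    {d r : ℕ} (P : ESPanel.Panel Ω d r)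
    (l : Filter (ℕ × ℕ)) (hl : l ≤ atTop ×ˢ atTop)
    (hmodel : ESPanel.ModelAssumption P μ)
    (hdesign : ESPanel.DesignAssumption P μ l)
    (heigen : ESPanel.EigenvalueAssumption P μ l)
    (hfactor : ESPanel.FactorAssumption P μ)
    (herror : ESPanel.ErrorAssumption P μ)
    (hweak : ESPanel.WeakDependenceAssumption P μ)
    (αhat : ℕ → ℕ → Ω → (Fin d → ℝ)) (hα : P.IsQuantileEstimator αhat)
    (βhat : (N T : ℕ) → Ω → Fin N → (Fin d → ℝ))
    (Fhat : (N T : ℕ) → Ω → Matrix (Fin T) (Fin r) ℝ)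
    (hLS : ESPanel.WithProbTendingToOne μ l fun n ω =>
      P.IsLSMinimizer n.1 n.2 (fun i => αhat n.2 i ω) ω (βhat n.1 n.2 ω) (Fhat n.1 n.2 ω)) :
    -- the rotation is invertible with probability tending to one
    (ESPanel.WithProbTendingToOne μ l fun n ω =>
      IsUnit (P.rot n.2 ω (Fhat n.1 n.2 ω)).det) ∧
    -- average consistency of the factors, up to the rotation
    TendstoInMeasure μ (fun (n : ℕ × ℕ) ω =>
      (Real.sqrt n.2)⁻¹ * ESPanel.frobNorm
        (Fhat n.1 n.2 ω - P.Fmat n.2 ω * P.rot n.2 ω (Fhat n.1 n.2 ω))) l (fun _ => 0) ∧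
    -- average consistency of the slopes
    TendstoInMeasure μ (fun (n : ℕ × ℕ) ω =>
      (n.1 : ℝ)⁻¹ * ∑ i : Fin n.1, ESPanel.sqNorm (βhat n.1 n.2 ω i - P.β i)) l (fun _ => 0) ∧
    -- average consistency of slopes and rotated loadings jointly
    TendstoInMeasure μ (fun (n : ℕ × ℕ) ω =>
      (n.1 : ℝ)⁻¹ * ∑ i : Fin n.1, ESPanel.sqNorm
        (Sum.elim (βhat n.1 n.2 ω i)
            (P.lamEst n.2 i (αhat n.2 i ω) ω (βhat n.1 n.2 ω i) (Fhat n.1 n.2 ω)) -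
          Sum.elim (P.β i)
            ((P.rot n.2 ω (Fhat n.1 n.2 ω))⁻¹ *ᵥ P.lam i))) l (fun _ => 0) := by
  obtain ⟨cA, hcA, hA⟩ := heigen.design
  obtain ⟨C0, hC0⟩ := hdesign.sample_moment
  obtain ⟨cS, hcS, hS⟩ := heigen.schur
  obtain ⟨L, hL⟩ := hfactor.loadings_bdd
  obtain ⟨cF, KF0, hcF, hF⟩ := ESPanel.Panel.exists_factor_bounds hl hfactor
  obtain ⟨M, herr⟩ := ESPanel.Panel.exists_errorBound hmodel herror
  have hm := ESPanel.Panel.sigmaXF_le hmodel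
  have hpos := ESPanel.Panel.eventually_pos hl
  have hL0 : 0 ≤ L := (ESPanel.sqNorm_nonneg _).trans (hL 0)
  set C := max C0 1
  have hC : 0 < C := zero_lt_one.trans_le (le_max_right _ _)
  set KF := max KF0 0
  have hKF : 0 ≤ KF := le_max_right _ _
  have hdet : ESPanel.WithProbTendingToOne μ l fun n ω =>
      IsUnit ((P.Fmat n.2 ω)ᵀ * P.Fmat n.2 ω).det := by
    refine hF.mono ?_
    filter_upwards [hpos] with n hn ω hω
    have hT : (0 : ℝ) < n.2 := by exact_mod_cast hn.2
    refine ESPanel.isUnit_det_of_sqNorm_le (mul_pos hT hcF) fun v => ?_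
    have h1 := mul_le_mul_of_nonneg_left (hω.1 v) hT.le
    rw [mul_inv_cancel_left₀ hT.ne'] at h1
    rw [← Matrix.mulVec_mulVec, ESPanel.dotProduct_transpose_mulVec, ← ESPanel.sqNorm_eq_dotProduct]
    linarith
  have hgood : ESPanel.WithProbTendingToOne μ l fun n ω =>
      ∀ i < n.1, P.IsGoodDesign cA C n.2 i ω := by
    refine ((hA.and hC0).and hdet).mono (Eventually.of_forall fun n ω hω i hi => ?_)
    exact ⟨(hω.1.2 i hi).trans (le_max_left _ _), fun v => (hω.1.1 i hi v).trans
      (ESPanel.Panel.dotProduct_Amat_mulVec_le hω.2 v)⟩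
  have hfs : ∀ η : ℝ, 0 < η → ESPanel.WithProbTendingToOne μ l fun n ω =>
      P.firstStepLoss n.1 n.2 ω (fun i => αhat n.2 i ω) ≤ η := fun η hη =>
    ESPanel.Panel.firstStepLoss_consistent hl hmodel hdesign hweak hα hcA hC hgood hη
  have hcore : ∀ q : ℝ, 0 < q → ESPanel.WithProbTendingToOne μ l fun n ω =>
      (ESPanel.IsNormalized (Fhat n.1 n.2 ω) ∧ IsUnit ((P.Fmat n.2 ω)ᵀ * P.Fmat n.2 ω).det ∧
        (∀ i < n.1, ∀ v, cA * ESPanel.sqNorm v ≤ v ⬝ᵥ (P.Amat n.2 i ω (P.Fmat n.2 ω) *ᵥ v)) ∧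
        (∀ i < n.1, P.IsGoodDesign cA C n.2 i ω) ∧
        (n.2 : ℝ)⁻¹ * ESPanel.frobSq (P.Fmat n.2 ω) ≤ KF) ∧
      P.factorDist n.2 ω (Fhat n.1 n.2 ω) ≤ q ∧
      P.signalLoss n.1 n.2 ω (βhat n.1 n.2 ω) (Fhat n.1 n.2 ω) + L * ((n.2 : ℝ)⁻¹ *
        ESPanel.frobSq (ESPanel.annihilator (Fhat n.1 n.2 ω) * P.Fmat n.2 ω)) ≤ q ∧
      P.errGram n.1 n.2 ω ≤ q ∧ P.firstStepLoss n.1 n.2 ω (fun i => αhat n.2 i ω) ≤ q := by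
    intro q hq
    -- A projected signal of at most `q / k` bounds the distance of the column spaces with factor `r
    -- / (c_S c_F)` and the signal plus loading term with factor `1 + L / c_S`; `k` is the sum of
    -- both.
    set k := r / (cS * cF) + (1 + L / cS)
    have hk : 0 < k := by positivity
    have hsig := ESPanel.Panel.signalLoss_consistent (a := fun T ω i => αhat T i ω) hl hm herr hdet
      hfs hLS (div_pos hq hk)
    refine ((((hLS.and hdet).and (hA.and hgood)).and (hF.and hS)).and
      (hsig.and ((herr.errGram_le hm hl hq).and (hfs q hq)))).mono ?_
    filter_upwards [hpos] with n hn ω hω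
    obtain ⟨⟨⟨⟨h1, h2⟩, h3, h4⟩, h5, h6⟩, h7, h8, h9⟩ := hω
    have h10 := P.frobSq_annihilator_mul_Fmat_le hn.2 h2
      (fun i hi => ESPanel.isUnit_det_of_sqNorm_le hcA (h3 i hi)) h6 h1.1 (βhat n.1 n.2 ω)
    set mf := (n.2 : ℝ)⁻¹ * ESPanel.frobSq
      (ESPanel.annihilator (Fhat n.1 n.2 ω) * P.Fmat n.2 ω) with hmf
    have h11 : mf ≤ q / k / cS := by
      rw [le_div_iff₀ hcS, mul_comm]; exact h10.trans h7
    have h12 : P.factorDist n.2 ω (Fhat n.1 n.2 ω) ≤ mf * (r / cF) := by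
      rw [ESPanel.Panel.factorDist, hmf, mul_assoc]
      exact mul_le_mul_of_nonneg_left
        (ESPanel.frobSq_annihilator_mul_le hn.2 h1.1 h2 hcF h5.1) (by positivity)
    have h13 : q / k * k = q := div_mul_cancel₀ q hk.ne'
    have h14 : 0 < q / k := div_pos hq hk
    have e1 : r / (cS * cF) * (q / k) = q / k / cS * (r / cF) := by field_simp
    have e2 : L / cS * (q / k) = L * (q / k / cS) := by field_simp
    have h15 : q / k * k = q / k / cS * (r / cF) + (q / k + L * (q / k / cS)) := by
      rw [← e1, ← e2]; ring
    have h16 : 0 ≤ q / k / cS * (r / cF) := by positivity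
    have h17 : 0 ≤ L * (q / k / cS) := by positivity
    refine ⟨⟨h1.1, h2, h3, h4, h5.2.trans (le_max_left _ _)⟩, ?_, ?_, h8, h9⟩
    · have := mul_le_mul_of_nonneg_right h11 (by positivity : 0 ≤ (r : ℝ) / cF)
      linarith
    · have := mul_le_mul_of_nonneg_left h11 hL0
      linarith
  have hfin : ∀ η : ℝ, 0 < η → ESPanel.WithProbTendingToOne μ l fun n ω =>
      (n.1 : ℝ)⁻¹ * ∑ i : Fin n.1, ESPanel.sqNorm (βhat n.1 n.2 ω i - P.β i)
        + (n.1 : ℝ)⁻¹ * ∑ i : Fin n.1, ESPanel.sqNorm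
          (P.lamEst n.2 i (αhat n.2 i ω) ω (βhat n.1 n.2 ω i) (Fhat n.1 n.2 ω)
            - (P.rot n.2 ω (Fhat n.1 n.2 ω))⁻¹ *ᵥ P.lam i) ≤ η := by
    intro η hη
    -- `k` collects the coefficients of `q` in the slope and loading bounds; the other entries of
    -- the minimum defining `q` bring the column spaces close enough for these bounds to apply.
    set k := (1 + 4 * (1 + C)) * (8 / cA) + 16 * KF * L + 4 * r + 4
    have hk : 0 < k := by positivity
    set q := min (η / k) (min (cA / (4 * (1 + C))) (1 / 4))
    have hq : 0 < q := by positivity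
    have hq1 : q * k ≤ η := by rw [← le_div_iff₀ hk]; exact min_le_left _ _
    have hq2 : 4 * (1 + C) * q ≤ cA := by
      rw [← le_div_iff₀' (by positivity)]
      exact (min_le_right _ _).trans (min_le_left _ _)
    have hq3 : 4 * q ≤ 1 := by
      have : q ≤ 1 / 4 := (min_le_right _ _).trans (min_le_right _ _)
      linarith
    refine (hcore q hq).mono ?_
    filter_upwards [hpos] with n hn ω hω
    obtain ⟨⟨h1, h2, h3, h4, h5⟩, h6, h7, h8, h9⟩ := hω
    have h10 := P.slope_loss_le hn.1 hn.2 h1 h2 hcA h3 (fun i hi => (h4 i hi).1) hL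
      ((mul_le_mul_of_nonneg_left h6 (by positivity)).trans hq2) (βhat n.1 n.2 ω)
    have h11 := P.loading_loss_le hn.1 hn.2 h1 (fun i hi => (h4 i hi).1) hL h5
      (by linarith) (fun i => αhat n.2 i ω) (βhat n.1 n.2 ω)
    have h12 := h10.trans (mul_le_mul_of_nonneg_left h7 (by positivity))
    have h13 := mul_le_mul_of_nonneg_left h12 (by positivity : 0 ≤ 4 * (1 + C))
    have h14 := mul_le_mul_of_nonneg_left h6 (by positivity : 0 ≤ 16 * KF * L)
    have h15 := mul_le_mul_of_nonneg_left h8 (Nat.cast_nonneg (α := ℝ) r)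
    have e : q * k = 8 / cA * q + 4 * (1 + C) * (8 / cA * q) + 16 * KF * L * q + 4 * (r * q)
        + 4 * q := by ring
    linarith
  have hnn : ∀ {p : ℕ} (N : ℕ) (v : Fin N → Fin p → ℝ),
      0 ≤ (N : ℝ)⁻¹ * ∑ i : Fin N, ESPanel.sqNorm (v i) := fun N v =>
    mul_nonneg (by positivity) (Finset.sum_nonneg fun i _ => ESPanel.sqNorm_nonneg _)
  refine ⟨?_, ?_, ?_, ?_⟩
  · refine (hcore (1 / 2) (by norm_num)).mono ?_
    filter_upwards [hpos] with n hn ω hω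
    exact P.isUnit_det_rot hn.2 hω.1.1 (by linarith [hω.2.1])
  · simp only [ESPanel.Panel.sqrt_inv_mul_frobNorm]
    refine ESPanel.tendstoInMeasure_zero_of_forall
      (Eventually.of_forall fun n ω => Real.sqrt_nonneg _) fun η hη => ?_
    exact (hcore (η ^ 2) (by positivity)).mono (Eventually.of_forall fun n ω hω =>
      Real.sqrt_le_iff.mpr ⟨hη.le, hω.2.1⟩)
  · refine ESPanel.tendstoInMeasure_zero_of_forall (Eventually.of_forall fun n ω => hnn _ _)
      fun η hη => (hfin η hη).mono (Eventually.of_forall fun n ω hω => ?_)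
    exact (le_add_of_nonneg_right (hnn _ _)).trans hω
  · have e : ∀ {a b : Fin d → ℝ} {u v : Fin r → ℝ}, ESPanel.sqNorm (Sum.elim a u - Sum.elim b v)
        = ESPanel.sqNorm (a - b) + ESPanel.sqNorm (u - v) := by
      intro a b u v
      rw [← Sum.elim_sub_sub, ESPanel.sqNorm_elim]
    simp only [e, Finset.sum_add_distrib, mul_add]
    exact ESPanel.tendstoInMeasure_zero_of_forall
      (Eventually.of_forall fun n ω => add_nonneg (hnn _ _) (hnn _ _)) hfin
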